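/- **Setting.** Let $(X,\mathcal A)$ be a standard Borel space, $\mu$ a $\sigma$-finite measure on $\mathcal A$ which is continuous ($\mu(\{x\})=0$ for all $x\in X$) and infinite ($\mu(X)=\infty$), and let $T$ be an invertible bi-measurable $\mu$-preserving transformation of $X$ which is ergodic. Let $X^*$ be the set of counting measures $\nu=\sum_{i\in I}\delta_{x_i}$ on $X$ ($I$ countable), put $N(A)(\nu)=\nu(A)$ for $A\in\mathcal A$, $\mathcal A^*=\sigma\{N(A):A\in\mathcal A\}$, and let $\mu^*$ be the law of the Poisson measure of intensity $\mu$, i.e. the probability measure on $\mathcal A^*$ such that for pairwise disjoint $A_1,\dots,A_k\in\mathcal A$ with $0<\mu(A_i)<\infty$ the variables $N(A_1),\dots,N(A_k)$ are independent and Poisson distributed with parameters $\mu(A_1),\dots,\mu(A_k)$. The Poisson suspension is $(X^*,\mathcal A^*,\mu^*,T_*)$ with $T_*\nu=\nu\circ T^{-1}$. For $n\ge 0$ the chaos $H^n\subset L^2(\mu^*)$ (complex scalars) is the range of the $n$-fold stochastic integral; equivalently, the closed linear span of the variables $\prod_{i=1}^n\bigl(N(A_i)-\mu(A_i)\bigr)$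 with $A_1,\dots,A_n\in\mathcal A$ pairwise disjoint of finite measure. **Factors.** A factor of a system $(Y,\mathcal B,m,S)$ is a sub-$\sigma$-algebra $\mathcal C\subset\mathcal B$ with $S^{-1}\mathcal C=\mathcal C$; it is a $\sigma$-finite factor if moreover $m|_{\mathcal C}$ is $\sigma$-finite. Equality, inclusion and triviality of $\sigma$-algebras are understood modulo null sets; a $\sigma$-algebra is trivial if all its sets are null or conull. A probability-preserving system is prime if its only factors are the trivial one and the full $\sigma$-algebra; an ergodic infinite-measure-preserving system is prime if its only $\sigma$-finite factor is the full $\sigma$-algebra. A Poissonian factor of the suspension is either $\{\emptyset,X^*\}$ or a $\sigma$-algebra $\sigma\{N(C):C\in\mathcal G\}$, where $\mathcal G$ is a $\sigma$-finite factor of the restriction of $(X,\mathcal A,\mu,T)$ to some $T$-invariant set $A\in\mathcal A$. The suspension has property CP if for every factor $\mathcal C\subset\mathcal A^*$ the conditional expectation $\mathbb E[\,\cdot\mid\mathcal C]$ on $L^2(\mu^*)$ maps $H^n$ into $H^n$ for every $n\ge0$. **Theorem.** Assume that the Poisson suspension $(X^*,\mathcal A^*,\mu^*,T_*)$ has property CP.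 Then every non-trivial factor $\mathcal C\subset\mathcal A^*$ of the suspension contains a non-trivial Poissonian factor. In particular, if moreover $(X,\mathcal A,\mu,T)$ is prime, then $(X^*,\mathcal A^*,\mu^*,T_*)$ is prime. -/

import Mathlib

open MeasureTheory ProbabilityTheory Set
open scoped ENNReal NNReal

namespace PoissonSuspension

section Factors

/-- A factor of the system `(X, mX, μ, T)`: a sub-σ-algebra `C` of `mX` such that `T⁻¹ C = C`
(`C.comap T` is the σ-algebra `{T⁻¹ s : s ∈ C}`). -/
structure IsFactor {X : Type*} {mX : MeasurableSpace X} (T : X → X) (_μ : Measure[mX] X)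
    (C : MeasurableSpace X) : Prop where
  le : C ≤ mX
  comap_eq : C.comap T = C

/-- A `σ`-finite factor: a factor `B` such that the restriction of `μ` to `B` is `σ`-finite. -/
structure IsSigmaFiniteFactor {X : Type*} {mX : MeasurableSpace X} (T : X → X) (μ : Measure[mX] X)
    (B : MeasurableSpace X) : Prop where
  isFactor : IsFactor T μ B
  sigmaFinite : SigmaFinite (μ.trim isFactor.le)

/-- Inclusion of σ-algebras modulo `μ`-null sets. -/
def LeMod {X : Type*} {mX : MeasurableSpace X} (μ : Measure[mX] X) (B C : MeasurableSpace X) :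
    Prop :=
  ∀ s : Set X, MeasurableSet[B] s → ∃ t : Set X, MeasurableSet[C] t ∧ s =ᵐ[μ] t

/-- `C` coincides, modulo `μ`-null sets, with the σ-algebra `{∅, X}`. -/
def IsTrivialMod {X : Type*} {mX : MeasurableSpace X} (μ : Measure[mX] X) (C : MeasurableSpace X) :
    Prop :=
  LeMod μ C ⊥

/-- A probability-preserving system is prime if its only factors, modulo null sets, are the full
σ-algebra and the trivial one. -/
def IsPrimeProbSystem {X : Type*} {mX : MeasurableSpace X} (T : X → X) (P : Measure[mX] X) : Prop :=
  ∀ C : MeasurableSpace X, IsFactor T P C → LeMod P mX C ∨ IsTrivialMod P C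

/-- An (ergodic) infinite-measure-preserving system is prime if its only `σ`-finite factor, modulo
null sets, is the full σ-algebra. -/
def IsPrimeInfiniteSystem {X : Type*} {mX : MeasurableSpace X} (T : X → X) (μ : Measure[mX] X) :
    Prop :=
  ∀ B : MeasurableSpace X, IsSigmaFiniteFactor T μ B → LeMod μ mX B

end Factors

section PoissonSpace

/-- The space `X*` of counting measures on `X`, i.e. measures `∑ i ∈ I, δ (x i)`, `I` countable. -/
def CountingMeasures (X : Type*) [MeasurableSpace X] : Type _ :=
  {ν : Measure X // ∃ (I : Type) (_ : Countable I) (x : I → X),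
    ν = Measure.sum fun i => Measure.dirac (x i)}

/-- `N(A) : X* → [0, ∞]`, `ν ↦ ν(A)`. -/
def N {X : Type*} [MeasurableSpace X] (A : Set X) (ν : CountingMeasures X) : ℝ≥0∞ := ν.1 A

/-- The σ-algebra generated by the maps `N(A)`, for `A` in a family `S` of sets. -/
abbrev sigmaN {X : Type*} [MeasurableSpace X] (S : Set (Set X)) :
    MeasurableSpace (CountingMeasures X) :=
  ⨆ A ∈ S, MeasurableSpace.comap (N A) (inferInstance : MeasurableSpace ℝ≥0∞)

/-- The σ-algebra `𝒜*` on `X*`, generated by all the maps `N(A)`, `A` measurable. -/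
instance {X : Type*} [MeasurableSpace X] : MeasurableSpace (CountingMeasures X) :=
  sigmaN {A | MeasurableSet A}

/-- `P` is the law `μ*` of the Poisson measure with intensity `μ`: for pairwise disjoint measurable
sets `A i` with `0 < μ (A i) < ∞`, the variables `N (A i)` are independent, and `N (A i)` has the
Poisson law with parameter `μ (A i)`. -/
structure IsPoissonMeasure {X : Type*} [MeasurableSpace X] (μ : Measure X)
    (P : Measure (CountingMeasures X)) : Prop where
  isProbabilityMeasure : IsProbabilityMeasure P
  iIndepFun : ∀ (k : ℕ) (A : Fin k → Set X), (∀ i, MeasurableSet (A i)) →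
    Pairwise (fun i j => Disjoint (A i) (A j)) → (∀ i, 0 < μ (A i) ∧ μ (A i) < ∞) →
    ProbabilityTheory.iIndepFun (fun i => N (A i)) P
  map_eq : ∀ A : Set X, MeasurableSet A → 0 < μ A → μ A < ∞ →
    P.map (N A) = (poissonMeasure (μ A).toNNReal).map (fun n : ℕ => (n : ℝ≥0∞))

/-- The transformation `T_* : ν ↦ ν ∘ T⁻¹` of `X*`. -/
noncomputable def suspension {X : Type*} [MeasurableSpace X] (T : X ≃ᵐ X)
    (ν : CountingMeasures X) : CountingMeasures X :=
  ⟨ν.1.map T, by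
    obtain ⟨ν, I, hI, x, rfl⟩ := ν
    refine ⟨I, hI, fun i => T (x i), ?_⟩
    rw [Measure.map_sum T.measurable.aemeasurable]
    simp [Measure.map_dirac' T.measurable]⟩

/-- The chaos `H^n` of order `n`: the closed linear span in `L²(μ*)` of the multiple stochastic
integrals of the indicators of products `A₁ × ⋯ × Aₙ` with pairwise disjoint `Aᵢ` of finite
measure, that is of the variables `∏ i, (N (A i) - μ (A i))`. For a continuous `μ` these indicators
generate, after symmetrization, a dense subspace of the symmetric functions of `L²(μ^{⊗ n})`, so
that this is the range of the `n`-fold stochastic integral. -/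
noncomputable def chaos {X : Type*} [MeasurableSpace X] (μ : Measure X)
    (P : Measure (CountingMeasures X)) (n : ℕ) : Submodule ℂ (Lp ℂ 2 P) :=
  (Submodule.span ℂ {F : Lp ℂ 2 P | ∃ A : Fin n → Set X,
    (∀ i, MeasurableSet (A i)) ∧ Pairwise (fun i j => Disjoint (A i) (A j)) ∧
    (∀ i, μ (A i) < ∞) ∧
    F =ᵐ[P] fun ν => ∏ i, (((N (A i) ν).toReal - (μ (A i)).toReal : ℝ) : ℂ)}).topologicalClosure

/-- Property CP: the conditional expectation with respect to any factor of the suspension maps each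
chaos into itself. -/
def PropertyCP {X : Type*} [MeasurableSpace X] (T : X ≃ᵐ X) (μ : Measure X)
    (P : Measure (CountingMeasures X)) : Prop :=
  ∀ (C : MeasurableSpace (CountingMeasures X)) (hC : IsFactor (suspension T) P C) (n : ℕ)
    (F : Lp ℂ 2 P), F ∈ chaos μ P n → (condExpL2 ℂ ℂ hC.le F).1 ∈ chaos μ P n

/-- The restriction of `μ` to the subset `A`, as a measure on the space `A` (with the trace of the
σ-algebra of `X`). -/
noncomputable def restrictMeasure {X : Type*} [MeasurableSpace X] (μ : Measure X) (A : Set X) :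
    Measure A :=
  μ.comap Subtype.val

/-- Poissonian factors of the suspension: the trivial σ-algebra, and the σ-algebras
`σ{N(C) : C ∈ G}`, where `G` is a `σ`-finite factor of the system restricted to some `T`-invariant
measurable set `A`. -/
def IsPoissonianFactor {X : Type*} [MeasurableSpace X] (T : X ≃ᵐ X) (μ : Measure X)
    (D : MeasurableSpace (CountingMeasures X)) : Prop :=
  D = ⊥ ∨ ∃ (A : Set X) (_ : MeasurableSet A) (hTA : T ⁻¹' A = A) (G : MeasurableSpace A),
    IsSigmaFiniteFactor (MapsTo.restrict T A A hTA.ge) (restrictMeasure μ A) G ∧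
    D = sigmaN {C | ∃ c : Set A, MeasurableSet[G] c ∧ C = Subtype.val '' c}

end PoissonSpace

end PoissonSuspension

/-! By CP, a non-trivial factor `C` admits a non-zero `C`-measurable `F ∈ Hⁿ` for some `n ≥ 1`. If
`E[N(A) | C] = μ(A)` for all `A`, then `E[N(A) |F|²] = μ(A) ‖F‖²` for all `A`, whereas for an
element of `Hⁿ` built on sets contained in `A` the factor is `μ(A) + n`; hence `C` measures a
non-zero element of `H¹`.

Write `I` for the stochastic integral. For real `f ∈ L²(μ)`, the projection of `e^{i I(f)}` on `H¹`
is a non-zero multiple of `I(e^{if} - 1)`. So, by CP, the closed space `K` of the real functions `f`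
such that `I(f)` is `C`-measurable is stable under `f ↦ cos f - 1` and `f ↦ sin f`. Iterating such
maps produces in `K` the indicator of a set of positive finite measure. The sets whose indicators
multiply the indicators in `K` into `K` form a `T`-invariant σ-algebra, whose trace on an invariant
countable union of sets with indicators in `K` is a `σ`-finite factor, and `C` measures the
corresponding Poissonian factor.

When the base is prime and ergodic, a non-trivial Poissonian factor lives on a conull invariant set,
so the `σ`-finite factor defining it, and hence the Poissonian factor, is full. -/

namespace PoissonSuspension

section PoissonMoments

lemma integral_poissonMeasure_natCast_mul (r : ℝ≥0) (g : ℕ → ℂ) :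
    ∫ k, (k : ℂ) * g k ∂(poissonMeasure r) = r * ∫ k, g (k + 1) ∂(poissonMeasure r) := by
  rw [integral_poissonMeasure, integral_poissonMeasure, ← tsum_mul_left,
    ← Nat.succ_injective.tsum_eq (f := fun n : ℕ =>
      (Real.exp (-r) * (r : ℝ) ^ n / (n.factorial : ℝ)) • ((n : ℂ) * g n))]
  · refine tsum_congr fun k => ?_
    have hk : ((k : ℂ) + 1) ≠ 0 := by exact_mod_cast Nat.succ_ne_zero k
    have hfact : ((k.factorial : ℕ) : ℂ) ≠ 0 := by exact_mod_cast k.factorial_ne_zero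
    simp only [Nat.succ_eq_add_one, Nat.factorial_succ, Complex.real_smul]
    push_cast
    field_simp
    ring
  · intro n hn
    rcases n with _ | n
    · simp at hn
    · exact ⟨n, rfl⟩

lemma integrable_poissonMeasure_pow (r : ℝ≥0) (w : ℂ) :
    Integrable (fun k : ℕ => w ^ k) (poissonMeasure r) := by
  rw [integrable_poissonMeasure_iff]
  have := (Real.summable_pow_div_factorial (r * ‖w‖)).mul_left (Real.exp (-r))
  refine this.congr fun k => ?_
  rw [norm_pow, mul_pow]
  ring

lemma integral_poissonMeasure_pow (r : ℝ≥0) (w : ℂ) :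
    ∫ k, w ^ k ∂(poissonMeasure r) = Complex.exp (r * (w - 1)) := by
  rw [integral_poissonMeasure]
  have h (k : ℕ) : (Real.exp (-r) * (r : ℝ) ^ k / (k.factorial : ℝ)) • w ^ k =
      Complex.exp (-r) * ((r * w) ^ k / (k.factorial : ℂ)) := by
    rw [Complex.real_smul, mul_pow]
    push_cast
    ring
  simp only [h]
  rw [tsum_mul_left, (NormedSpace.expSeries_div_hasSum_exp ((r : ℂ) * w)).tsum_eq,
    ← Complex.exp_eq_exp_ℂ, ← Complex.exp_add]
  congr 1
  ring

lemma integrable_poissonMeasure_natCast_pow {𝕜 : Type*} [RCLike 𝕜] (r : ℝ≥0) (n : ℕ) :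
    Integrable (fun k : ℕ => (k : 𝕜) ^ n) (poissonMeasure r) := by
  have h : Integrable (fun k : ℕ => (n.factorial : ℝ) * ‖(Real.exp 1 : ℂ) ^ k‖)
      (poissonMeasure r) :=
    (integrable_poissonMeasure_pow r (Real.exp 1)).norm.const_mul _
  refine h.mono' (Measurable.of_discrete).aestronglyMeasurable (Filter.Eventually.of_forall ?_)
  intro k
  have h_exp : ‖(Real.exp 1 : ℂ) ^ k‖ = Real.exp k := by
    rw [norm_pow, Complex.norm_real, Real.norm_of_nonneg (Real.exp_pos _).le, ← Real.exp_nat_mul,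
      mul_one]
  have h_pow := Real.pow_div_factorial_le_exp (k : ℝ) (Nat.cast_nonneg k) n
  rw [div_le_iff₀ (by positivity)] at h_pow
  rw [norm_pow, RCLike.norm_natCast, h_exp]
  linarith

lemma integrable_poissonMeasure_natCast (r : ℝ≥0) :
    Integrable (fun k : ℕ => (k : ℂ)) (poissonMeasure r) := by
  simpa using integrable_poissonMeasure_natCast_pow (𝕜 := ℂ) r 1

lemma integral_poissonMeasure_centered_mul {r : ℝ≥0} {g : ℕ → ℂ}
    (hg : Integrable g (poissonMeasure r))
    (hkg : Integrable (fun k : ℕ => (k : ℂ) * g k) (poissonMeasure r)) :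
    ∫ k : ℕ, ((k : ℂ) - r) * g k ∂(poissonMeasure r) =
      r * (∫ k, g (k + 1) ∂(poissonMeasure r) - ∫ k, g k ∂(poissonMeasure r)) := by
  simp only [sub_mul]
  rw [integral_sub hkg (hg.const_mul _), integral_poissonMeasure_natCast_mul, integral_const_mul,
    mul_sub]

lemma integral_poissonMeasure_natCast (r : ℝ≥0) :
    ∫ k : ℕ, (k : ℂ) ∂(poissonMeasure r) = r := by
  simpa using integral_poissonMeasure_natCast_mul r (fun _ => 1)

lemma integral_poissonMeasure_centered (r : ℝ≥0) :
    ∫ k : ℕ, ((k : ℂ) - r) ∂(poissonMeasure r) = 0 := by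
  rw [integral_sub (integrable_poissonMeasure_natCast r) (integrable_const _),
    integral_poissonMeasure_natCast]
  simp

lemma integral_poissonMeasure_centered_sq (r : ℝ≥0) :
    ∫ k : ℕ, ((k : ℂ) - r) * ((k : ℂ) - r) ∂(poissonMeasure r) = r := by
  have i1 := integrable_poissonMeasure_natCast r
  have i2 := integrable_poissonMeasure_natCast_pow (𝕜 := ℂ) r 2
  have hkg : Integrable (fun k : ℕ => (k : ℂ) * (k - r)) (poissonMeasure r) :=
    (i2.sub (i1.const_mul (r : ℂ))).congr
      (Filter.Eventually.of_forall fun k => by simp only [Pi.sub_apply]; ring)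
  have hg : Integrable (fun k : ℕ => (k : ℂ) - r) (poissonMeasure r) :=
    i1.sub (integrable_const _)
  have hshift (k : ℕ) : ((k + 1 : ℕ) : ℂ) - r = (k - r) + 1 := by
    push_cast
    ring
  simp only [integral_poissonMeasure_centered_mul hg hkg, hshift]
  rw [integral_add hg (integrable_const _), add_sub_cancel_left, integral_const, probReal_univ,
    one_smul, mul_one]

lemma integral_poissonMeasure_centered_sq_mul (r : ℝ≥0) :
    ∫ k : ℕ, ((k : ℂ) - r) * ((k : ℂ) - r) * k ∂(poissonMeasure r) = r * (r + 1) := by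
  have i1 := integrable_poissonMeasure_natCast r
  have i2 := integrable_poissonMeasure_natCast_pow (𝕜 := ℂ) r 2
  have i3 := integrable_poissonMeasure_natCast_pow (𝕜 := ℂ) r 3
  have hg : Integrable (fun k : ℕ => ((k : ℂ) - r) * k) (poissonMeasure r) :=
    (i2.sub (i1.const_mul (r : ℂ))).congr
      (Filter.Eventually.of_forall fun k => by simp only [Pi.sub_apply]; ring)
  have hkg : Integrable (fun k : ℕ => (k : ℂ) * ((k - r) * k)) (poissonMeasure r) :=
    (i3.sub (i2.const_mul (r : ℂ))).congr
      (Filter.Eventually.of_forall fun k => by simp only [Pi.sub_apply]; ring)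
  have hshift (k : ℕ) : (((k + 1 : ℕ) : ℂ) - r) * (k + 1 : ℕ) =
      (k - r) * k + (2 * k + (1 - r)) := by
    push_cast
    ring
  have hlin : Integrable (fun k : ℕ => 2 * (k : ℂ)) (poissonMeasure r) := i1.const_mul 2
  have haff : Integrable (fun k : ℕ => 2 * (k : ℂ) + (1 - r)) (poissonMeasure r) :=
    hlin.add (integrable_const _)
  simp only [mul_assoc]
  rw [integral_poissonMeasure_centered_mul hg hkg]
  simp only [hshift]
  rw [integral_add hg haff, integral_add hlin (integrable_const _),
    integral_const_mul, integral_poissonMeasure_natCast, integral_const, probReal_univ, one_smul]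
  ring

lemma integrable_poissonMeasure_natCast_mul_pow (r : ℝ≥0) (w : ℂ) :
    Integrable (fun k : ℕ => (k : ℂ) * w ^ k) (poissonMeasure r) := by
  have h := (integrable_poissonMeasure_pow r (2 * ‖w‖ : ℝ)).norm
  refine h.mono' (Measurable.of_discrete).aestronglyMeasurable (Filter.Eventually.of_forall ?_)
  intro k
  have hk_le : (k : ℝ) ≤ 2 ^ k := by exact_mod_cast (Nat.lt_two_pow_self (n := k)).le
  rw [norm_mul, norm_pow, norm_pow, Complex.norm_real, Complex.norm_natCast,
    Real.norm_of_nonneg (by positivity), mul_pow]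
  gcongr

lemma integral_poissonMeasure_centered_mul_pow (r : ℝ≥0) (w : ℂ) :
    ∫ k : ℕ, ((k : ℂ) - r) * w ^ k ∂(poissonMeasure r) =
      r * (w - 1) * Complex.exp (r * (w - 1)) := by
  rw [integral_poissonMeasure_centered_mul (integrable_poissonMeasure_pow r w)
    (integrable_poissonMeasure_natCast_mul_pow r w)]
  simp only [pow_succ, integral_mul_const, integral_poissonMeasure_pow]
  ring

end PoissonMoments

section Moments

variable {Ω : Type*} {mΩ : MeasurableSpace Ω} {P : Measure Ω}

/-- The random variables all of whose moments are finite. -/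
def HasAllMoments (F : Ω → ℂ) (P : Measure Ω) : Prop :=
  ∀ n : ℕ, MemLp F n P

lemma HasAllMoments.mul {F G : Ω → ℂ} (hF : HasAllMoments F P) (hG : HasAllMoments G P) :
    HasAllMoments (fun x => F x * G x) P := by
  intro n
  have : ENNReal.HolderTriple ((2 * n : ℕ) : ℝ≥0∞) ((2 * n : ℕ) : ℝ≥0∞) (n : ℝ≥0∞) := by
    constructor
    rcases n.eq_zero_or_pos with rfl | -
    · simp
    · push_cast
      rw [ENNReal.mul_inv (Or.inl two_ne_zero) (Or.inl ENNReal.ofNat_ne_top), ← add_mul,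
        ENNReal.inv_two_add_inv_two, one_mul]
  exact (hG (2 * n)).mul' (hF (2 * n))

lemma HasAllMoments.const [IsFiniteMeasure P] (c : ℂ) : HasAllMoments (fun _ => c) P :=
  fun _ => memLp_const c

lemma HasAllMoments.add {F G : Ω → ℂ} (hF : HasAllMoments F P) (hG : HasAllMoments G P) :
    HasAllMoments (fun x => F x + G x) P :=
  fun n => (hF n).add (hG n)

lemma HasAllMoments.sum {ι : Type*} {s : Finset ι} {F : ι → Ω → ℂ}
    (hF : ∀ i ∈ s, HasAllMoments (F i) P) : HasAllMoments (fun x => ∑ i ∈ s, F i x) P :=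
  fun n => memLp_finsetSum s fun i hi => hF i hi n

lemma HasAllMoments.prod [IsFiniteMeasure P] {ι : Type*} {s : Finset ι} {F : ι → Ω → ℂ}
    (hF : ∀ i ∈ s, HasAllMoments (F i) P) : HasAllMoments (fun x => ∏ i ∈ s, F i x) P := by
  classical
  induction s using Finset.induction_on with
  | empty => simpa using HasAllMoments.const 1
  | insert a s ha ih =>
    simp only [Finset.prod_insert ha]
    exact (hF a (Finset.mem_insert_self a s)).mul
      (ih fun i hi => hF i (Finset.mem_insert_of_mem hi))

lemma HasAllMoments.congr {F G : Ω → ℂ} (hF : HasAllMoments F P) (h : F =ᵐ[P] G) :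
    HasAllMoments G P :=
  fun n => (memLp_congr_ae h).1 (hF n)

lemma HasAllMoments.memLp_two {F : Ω → ℂ} (hF : HasAllMoments F P) : MemLp F 2 P := by
  simpa using hF 2

lemma HasAllMoments.integrable {F : Ω → ℂ} (hF : HasAllMoments F P) : Integrable F P :=
  memLp_one_iff_integrable.1 (by simpa using hF 1)

end Moments

section PoissonCounts

variable {X : Type*} [MeasurableSpace X]

lemma measurable_N {A : Set X} (hA : MeasurableSet A) : Measurable (N A) :=
  (comap_measurable (N A)).mono (le_iSup₂_of_le A hA le_rfl) le_rfl

/-- The integer value of `N A`. -/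
noncomputable def num (A : Set X) (ν : CountingMeasures X) : ℕ := ⌊(N A ν).toReal⌋₊

/-- The compensated variable `N A - μ A`. -/
noncomputable def ctr (μ : Measure X) (A : Set X) (ν : CountingMeasures X) : ℝ :=
  (N A ν).toReal - (μ A).toReal

lemma measurable_num {A : Set X} (hA : MeasurableSet A) : Measurable (num A) :=
  Nat.measurable_floor.comp (measurable_N hA).ennreal_toReal

lemma num_eq_of_N_eq {A : Set X} {ν : CountingMeasures X} {n : ℕ} (h : N A ν = n) :
    num A ν = n := by
  simp [num, h]

/-- Families of pairwise disjoint measurable sets of finite measure. -/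
structure IsDisjointFamily (μ : Measure X) {ι : Type*} (B : ι → Set X) : Prop where
  measurableSet : ∀ i, MeasurableSet (B i)
  disjoint : Pairwise (fun i j => Disjoint (B i) (B j))
  measure_lt_top : ∀ i, μ (B i) < ∞

/-- Under `Q`, the number of points in any set of finite measure is almost surely finite. -/
def HasFiniteCounts (μ : Measure X) (Q : Measure (CountingMeasures X)) : Prop :=
  ∀ A, MeasurableSet A → μ A < ∞ → ∀ᵐ ν ∂Q, N A ν = num A ν

/-- The Poisson property, including sets of measure zero and arbitrary finite index types. -/
structure HasPoissonCounts (μ : Measure X) (P : Measure (CountingMeasures X)) : Prop where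
  isProbabilityMeasure : IsProbabilityMeasure P
  ae_N_eq : HasFiniteCounts μ P
  map_num : ∀ A, MeasurableSet A → μ A < ∞ → P.map (num A) = poissonMeasure (μ A).toNNReal
  iIndepFun_num : ∀ {ι : Type} [Fintype ι] (B : ι → Set X), IsDisjointFamily μ B →
    iIndepFun (fun i => num (B i)) P

lemma N_union {A B : Set X} (h : Disjoint A B) (hB : MeasurableSet B) (ν : CountingMeasures X) :
    N (A ∪ B) ν = N A ν + N B ν :=
  measure_union h hB

lemma poissonMeasure_zero : poissonMeasure 0 = Measure.dirac 0 := by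
  refine Measure.ext_of_singleton fun n => ?_
  rw [poissonMeasure_singleton]
  rcases n with _ | n <;> simp

variable {μ : Measure X} {P : Measure (CountingMeasures X)}

lemma lintegral_natCast_poissonMeasure_ne_top (r : ℝ≥0) :
    ∫⁻ k : ℕ, (k : ℝ≥0∞) ∂(poissonMeasure r) ≠ ∞ := by
  have h := (integrable_poissonMeasure_natCast_pow (𝕜 := ℝ) r 1).lintegral_lt_top
  simp only [pow_one, ENNReal.ofReal_natCast] at h
  exact h.ne

namespace IsPoissonMeasure

lemma lintegral_N (hP : IsPoissonMeasure μ P) {A : Set X} (hA : MeasurableSet A) (h0 : 0 < μ A)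
    (hfin : μ A < ∞) :
    ∫⁻ ν, N A ν ∂P = ∫⁻ k : ℕ, (k : ℝ≥0∞) ∂(poissonMeasure (μ A).toNNReal) := by
  have h := lintegral_map (μ := P) measurable_id (measurable_N hA)
  rw [hP.map_eq A hA h0 hfin, lintegral_map measurable_id Measurable.of_discrete] at h
  exact h.symm

-- For `B` disjoint from `A` with `0 < μ B < ∞`, the variables `N (B ∪ A)` and `N B` have the same
-- finite mean.
lemma ae_N_eq_zero [SigmaFinite μ] (hμ : μ ≠ 0) (hP : IsPoissonMeasure μ P) {A : Set X}
    (hA : MeasurableSet A) (h0 : μ A = 0) : ∀ᵐ ν ∂P, N A ν = 0 := by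
  have hAc : 0 < μ Aᶜ := by
    rw [measure_compl hA (by simp [h0]), h0, tsub_zero]
    exact Measure.measure_univ_pos.2 hμ
  obtain ⟨B, hB, hBA, hB0, hB1⟩ := Measure.exists_subset_measure_lt_top hA.compl hAc
  have hdisj : Disjoint B A := disjoint_left.2 fun x hx hxA => hBA hx hxA
  have hUB : μ (B ∪ A) = μ B := by rw [measure_union hdisj hA, h0, add_zero]
  have hmean : ∫⁻ ν, N (B ∪ A) ν ∂P = ∫⁻ ν, N B ν ∂P := by
    rw [hP.lintegral_N (hB.union hA) (hUB ▸ hB0) (hUB ▸ hB1), hP.lintegral_N hB hB0 hB1, hUB]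
  have hfin : ∫⁻ ν, N B ν ∂P ≠ ∞ := by
    rw [hP.lintegral_N hB hB0 hB1]
    exact lintegral_natCast_poissonMeasure_ne_top _
  simp only [N_union hdisj hA] at hmean
  rw [lintegral_add_right _ (measurable_N hA)] at hmean
  have hA_mean : ∫⁻ ν, N A ν ∂P = 0 := by
    by_contra hne
    exact (ENNReal.lt_add_right hfin hne).ne' hmean
  exact (lintegral_eq_zero_iff (measurable_N hA)).1 hA_mean

lemma ae_num_eq_zero [SigmaFinite μ] (hμ : μ ≠ 0) (hP : IsPoissonMeasure μ P) {A : Set X}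
    (hA : MeasurableSet A) (h0 : μ A = 0) : ∀ᵐ ν ∂P, num A ν = 0 := by
  filter_upwards [hP.ae_N_eq_zero hμ hA h0] with ν hν
  simp [num, hν]

lemma hasFiniteCounts [SigmaFinite μ] (hμ : μ ≠ 0) (hP : IsPoissonMeasure μ P) :
    HasFiniteCounts μ P := by
  intro A hA hfin
  rcases eq_or_ne (μ A) 0 with h0 | h0
  · filter_upwards [hP.ae_N_eq_zero hμ hA h0] with ν hν
    simp [num, hν]
  · have hrange : MeasurableSet {x | x ∈ range fun n : ℕ => (n : ℝ≥0∞)} :=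
      (countable_range _).measurableSet
    have hmap : ∀ᵐ x ∂(P.map (N A)), x ∈ range fun n : ℕ => (n : ℝ≥0∞) := by
      rw [hP.map_eq A hA h0.bot_lt hfin, ae_map_iff Measurable.of_discrete.aemeasurable hrange]
      exact Filter.Eventually.of_forall fun n => ⟨n, rfl⟩
    rw [ae_map_iff (measurable_N hA).aemeasurable hrange] at hmap
    filter_upwards [hmap] with ν ⟨n, hn⟩
    rw [num_eq_of_N_eq hn.symm, ← hn]

lemma map_num [SigmaFinite μ] (hμ : μ ≠ 0) (hP : IsPoissonMeasure μ P) {A : Set X}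
    (hA : MeasurableSet A) (hfin : μ A < ∞) :
    P.map (num A) = poissonMeasure (μ A).toNNReal := by
  have hprob := hP.isProbabilityMeasure
  rcases eq_or_ne (μ A) 0 with h0 | h0
  · rw [Measure.map_congr (hP.ae_num_eq_zero hμ hA h0), h0, ENNReal.toNNReal_zero,
      poissonMeasure_zero, Measure.map_const, measure_univ, one_smul]
  · have hfloor : Measurable (fun x : ℝ≥0∞ => ⌊x.toReal⌋₊) :=
      Nat.measurable_floor.comp ENNReal.measurable_toReal
    have hnum : num A = (fun x : ℝ≥0∞ => ⌊x.toReal⌋₊) ∘ N A := rfl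
    rw [hnum, ← Measure.map_map hfloor (measurable_N hA), hP.map_eq A hA h0.bot_lt hfin,
      Measure.map_map hfloor Measurable.of_discrete]
    convert! Measure.map_id
    ext n
    simp

end IsPoissonMeasure

lemma iIndepFun_of_subtype {ι Ω : Type*} {β : ι → Type*} [∀ i, MeasurableSpace (β i)]
    {mΩ : MeasurableSpace Ω} {P : Measure Ω} [IsProbabilityMeasure P] {f : ∀ i, Ω → β i}
    {p : ι → Prop} {c : ∀ i, β i} (h : iIndepFun (fun i : {i // p i} => f i) P)
    (hc : ∀ i, ¬ p i → ∀ᵐ ω ∂P, f i ω = c i) : iIndepFun f P := by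
  classical
  let g : ∀ i, Ω → β i := fun i => if p i then f i else fun _ => c i
  suffices hg : iIndepFun g P by
    refine hg.congr fun i => ?_
    by_cases hi : p i
    · simp [g, hi]
    · filter_upwards [hc i hi] with ω hω
      simp [g, hi, hω]
  rw [iIndepFun_iff_measure_inter_preimage_eq_mul] at h ⊢
  intro S E hE
  by_cases hz : ∃ i ∈ S, ¬ p i ∧ c i ∉ E i
  · obtain ⟨i, hiS, hip, hi0⟩ := hz
    have hempty : g i ⁻¹' E i = ∅ := by
      ext ω
      simp [g, hip, hi0]
    rw [Finset.prod_eq_zero hiS (by rw [hempty, measure_empty])]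
    exact measure_mono_null (iInter₂_subset i hiS) (by rw [hempty, measure_empty])
  · push Not at hz
    have hinter : ⋂ i ∈ S, g i ⁻¹' E i = ⋂ i ∈ S.subtype p, f i ⁻¹' E i := by
      ext ω
      simp only [mem_iInter, mem_preimage, Finset.mem_subtype, Subtype.forall]
      refine forall_congr' fun i => ?_
      by_cases hi : p i
      · simp [g, hi]
      · simpa [g, hi] using fun hS => hz i hS hi
    rw [hinter, h (S.subtype p) (sets := fun i => E i) fun i hi => hE i (Finset.mem_subtype.1 hi),
      Finset.prod_subtype_eq_prod_filter (fun i => P (f i ⁻¹' E i)), Finset.prod_filter]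
    refine Finset.prod_congr rfl fun i hi => ?_
    by_cases hp : p i
    · simp [g, hp]
    · have huniv : g i ⁻¹' E i = univ := by
        ext ω
        simpa [g, hp] using hz i hi hp
      simp [hp, huniv]

lemma IsPoissonMeasure.hasPoissonCounts [SigmaFinite μ] (hμ : μ ≠ 0)
    (hP : IsPoissonMeasure μ P) : HasPoissonCounts μ P := by
  have hprob := hP.isProbabilityMeasure
  refine ⟨hprob, hP.hasFiniteCounts hμ, fun A => hP.map_num hμ, fun {ι} _ B hB => ?_⟩
  refine iIndepFun_of_subtype (p := fun i => 0 < μ (B i)) (c := fun _ => 0) ?_ fun i hi =>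
    hP.ae_num_eq_zero hμ (hB.measurableSet i) (by simpa using hi)
  let e := (Fintype.equivFin {i // 0 < μ (B i)}).symm
  have h := hP.iIndepFun _ (fun j => B (e j)) (fun j => hB.measurableSet _)
    (fun j k hjk => hB.disjoint fun h => hjk (e.injective (Subtype.ext h)))
    (fun j => ⟨(e j).2, hB.measure_lt_top _⟩)
  exact (h.comp (fun _ x => ⌊x.toReal⌋₊)
    fun _ => Nat.measurable_floor.comp ENNReal.measurable_toReal).of_precomp e.surjective

namespace HasPoissonCounts

lemma integral_comp_num (hP : HasPoissonCounts μ P) {A : Set X} (hA : MeasurableSet A)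
    (hfin : μ A < ∞) (g : ℕ → ℂ) :
    ∫ ν, g (num A ν) ∂P = ∫ k, g k ∂(poissonMeasure (μ A).toNNReal) := by
  rw [← hP.map_num A hA hfin, integral_map (measurable_num hA).aemeasurable
    Measurable.of_discrete.aestronglyMeasurable]

lemma integral_prod_comp_num (hP : HasPoissonCounts μ P) {ι : Type} [Fintype ι] {B : ι → Set X}
    (hB : IsDisjointFamily μ B) (g : ι → ℕ → ℂ) :
    ∫ ν, ∏ i, g i (num (B i) ν) ∂P = ∏ i, ∫ k, g i k ∂(poissonMeasure (μ (B i)).toNNReal) := by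
  rw [(hP.iIndepFun_num B hB).integral_fun_prod_comp
    (fun i => (measurable_num (hB.measurableSet i)).aemeasurable)
    (fun i => Measurable.of_discrete.aestronglyMeasurable)]
  exact Finset.prod_congr rfl fun i _ =>
    hP.integral_comp_num (hB.measurableSet i) (hB.measure_lt_top i) (g i)

lemma hasAllMoments_num (hP : HasPoissonCounts μ P) {A : Set X} (hA : MeasurableSet A)
    (hfin : μ A < ∞) : HasAllMoments (fun ν => (num A ν : ℂ)) P := by
  intro n
  have h : MemLp (fun k : ℕ => (k : ℂ)) n (P.map (num A)) := by
    rw [hP.map_num A hA hfin]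
    rcases eq_or_ne n 0 with rfl | hn
    · simpa using (Measurable.of_discrete (f := fun k : ℕ => (k : ℂ))).aestronglyMeasurable
    · rw [← integrable_norm_rpow_iff Measurable.of_discrete.aestronglyMeasurable
        (by exact_mod_cast hn) (ENNReal.natCast_ne_top n)]
      simpa using integrable_poissonMeasure_natCast_pow (μ A).toNNReal n
  exact h.comp_of_map (measurable_num hA).aemeasurable

lemma ae_ctr_eq (hP : HasPoissonCounts μ P) {A : Set X} (hA : MeasurableSet A)
    (hfin : μ A < ∞) : ∀ᵐ ν ∂P, (ctr μ A ν : ℂ) = (num A ν : ℂ) - (μ A).toNNReal := by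
  filter_upwards [hP.ae_N_eq A hA hfin] with ν hν
  simp only [ctr, hν]
  push_cast
  simp [ENNReal.toReal]

lemma hasAllMoments_ctr (hP : HasPoissonCounts μ P) {A : Set X} (hA : MeasurableSet A)
    (hfin : μ A < ∞) : HasAllMoments (fun ν => (ctr μ A ν : ℂ)) P := by
  have := hP.isProbabilityMeasure
  refine ((hP.hasAllMoments_num hA hfin).add (HasAllMoments.const (-((μ A).toNNReal : ℂ)))).congr ?_
  filter_upwards [hP.ae_ctr_eq hA hfin] with ν hν
  rw [hν, sub_eq_add_neg]

end HasPoissonCounts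

end PoissonCounts

section Atoms

variable {X : Type*} [MeasurableSpace X] {μ : Measure X} {P : Measure (CountingMeasures X)}

/-- The set of points which belong to exactly those members of the family `A` whose index is
in `s`. -/
def atom {κ : Type*} (A : κ → Set X) (s : Finset κ) : Set X := {x | ∀ k, k ∈ s ↔ x ∈ A k}

lemma measurableSet_atom {κ : Type*} [Countable κ] {A : κ → Set X} (hA : ∀ k, MeasurableSet (A k))
    (s : Finset κ) : MeasurableSet (atom A s) := by
  classical
  have h : atom A s = ⋂ k, if k ∈ s then A k else (A k)ᶜ := by
    ext x
    simp only [atom, mem_ofPred_eq, mem_iInter]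
    refine forall_congr' fun k => ?_
    by_cases hk : k ∈ s <;> simp [hk]
  rw [h]
  refine MeasurableSet.iInter fun k => ?_
  split_ifs
  · exact hA k
  · exact (hA k).compl

lemma exists_atoms {κ : Type*} [Finite κ] (A : κ → Set X) (hA : ∀ k, MeasurableSet (A k))
    (hfin : ∀ k, μ (A k) < ∞) :
    ∃ (m : ℕ) (B : Fin m → Set X) (S : κ → Finset (Fin m)), IsDisjointFamily μ B ∧
      (∀ b, (B b).Nonempty) ∧ ∀ k, A k = ⋃ b ∈ S k, B b := by
  classical
  have := Fintype.ofFinite κ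
  let e := (Fintype.equivFin {s : Finset κ // s.Nonempty ∧ (atom A s).Nonempty}).symm
  refine ⟨_, fun b => atom A (e b), fun k => Finset.univ.filter fun b => k ∈ (e b).1,
    ⟨fun b => measurableSet_atom hA _, fun b c hbc => ?_, fun b => ?_⟩, fun b => (e b).2.2,
    fun k => ?_⟩
  · exact disjoint_left.2 fun x hx hx' =>
      hbc (e.injective (Subtype.ext (Finset.ext fun k => (hx k).trans (hx' k).symm)))
  · obtain ⟨k, hk⟩ := (e b).2.1
    exact (measure_mono fun x hx => (hx k).1 hk).trans_lt (hfin k)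
  · ext x
    simp only [mem_iUnion, Finset.mem_filter, Finset.mem_univ, true_and, exists_prop]
    constructor
    · intro hxk
      let s : Finset κ := {k | x ∈ A k}
      have hks : k ∈ s := by simpa [s] using hxk
      have hx : x ∈ atom A s := fun k => by simp [s]
      exact ⟨e.symm ⟨s, ⟨k, hks⟩, ⟨x, hx⟩⟩, by simpa using hks,
        by simpa only [e.apply_symm_apply] using hx⟩
    · rintro ⟨b, hk, hx⟩
      exact (hx k).1 hk

lemma N_biUnion {ι : Type*} {B : ι → Set X} (hB : IsDisjointFamily μ B) (S : Finset ι)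
    (ν : CountingMeasures X) : N (⋃ b ∈ S, B b) ν = ∑ b ∈ S, N (B b) ν :=
  measure_biUnion_finset (fun _ _ _ _ h => hB.disjoint h) fun b _ => hB.measurableSet b

lemma IsDisjointFamily.measure_biUnion_lt_top {ι : Type*} {B : ι → Set X}
    (hB : IsDisjointFamily μ B) (S : Finset ι) : μ (⋃ b ∈ S, B b) < ∞ :=
  MeasureTheory.measure_biUnion_lt_top S.finite_toSet fun b _ => hB.measure_lt_top b

lemma num_biUnion {ι : Type*} {B : ι → Set X} (hB : IsDisjointFamily μ B) (S : Finset ι)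
    {ν : CountingMeasures X} (h : ∀ b, N (B b) ν = num (B b) ν) :
    num (⋃ b ∈ S, B b) ν = ∑ b ∈ S, num (B b) ν := by
  refine num_eq_of_N_eq ?_
  rw [N_biUnion hB, Finset.sum_congr rfl fun b _ => h b]
  push_cast
  rfl

lemma ctr_biUnion {ι : Type*} {B : ι → Set X} (hB : IsDisjointFamily μ B) (S : Finset ι)
    {ν : CountingMeasures X} (h : ∀ b, N (B b) ν = num (B b) ν) :
    ctr μ (⋃ b ∈ S, B b) ν = ∑ b ∈ S, ctr μ (B b) ν := by
  simp only [ctr, Finset.sum_sub_distrib]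
  rw [N_biUnion hB, ENNReal.toReal_sum fun b _ => by rw [h b]; exact ENNReal.natCast_ne_top _,
    measure_biUnion_finset (fun _ _ _ _ h => hB.disjoint h) fun b _ => hB.measurableSet b,
    ENNReal.toReal_sum fun b _ => (hB.measure_lt_top b).ne]

lemma HasFiniteCounts.ae_forall (hP : HasFiniteCounts μ P) {ι : Type*} [Countable ι]
    {B : ι → Set X} (hB : IsDisjointFamily μ B) : ∀ᵐ ν ∂P, ∀ b, N (B b) ν = num (B b) ν :=
  ae_all_iff.2 fun b => hP _ (hB.measurableSet b) (hB.measure_lt_top b)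

end Atoms

section Determination

variable {X : Type*} [MeasurableSpace X] {μ : Measure X}

lemma measurable_N_of_finite [SigmaFinite μ] {m : MeasurableSpace (CountingMeasures X)}
    {A : Set X} (h : ∀ n : ℕ, Measurable[m] (N (A ∩ spanningSets μ n))) : Measurable[m] (N A) := by
  have hN : N A = fun ν => ⨆ n, N (A ∩ spanningSets μ n) ν := by
    funext ν
    have hmono : Monotone fun n => A ∩ spanningSets μ n :=
      monotone_const.inter (monotone_spanningSets μ)
    change ν.1 A = ⨆ n, ν.1 (A ∩ spanningSets μ n)
    rw [← hmono.measure_iUnion, ← inter_iUnion, iUnion_spanningSets, inter_univ]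
  rw [hN]
  exact Measurable.iSup h

lemma sigmaN_finite_eq [SigmaFinite μ] :
    (inferInstance : MeasurableSpace (CountingMeasures X)) =
      sigmaN {A | MeasurableSet A ∧ μ A < ∞} := by
  apply le_antisymm
  · refine iSup₂_le fun A (hA : MeasurableSet A) => ?_
    refine Measurable.comap_le (measurable_N_of_finite (μ := μ) fun n => ?_)
    have hn : A ∩ spanningSets μ n ∈ {A | MeasurableSet A ∧ μ A < ∞} :=
      ⟨hA.inter (measurableSet_spanningSets _ _),
        (measure_mono inter_subset_right).trans_lt (measure_spanningSets_lt_top _ _)⟩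
    exact (comap_measurable _).mono (le_iSup₂_of_le _ hn le_rfl) le_rfl
  · exact iSup₂_le fun A hA => (measurable_N hA.1).comap_le

lemma charFunDual_map_num {Q : Measure (CountingMeasures X)} (hQ : HasFiniteCounts μ Q)
    {κ : Type*} [Fintype κ] {A : κ → Set X} (hA : ∀ k, MeasurableSet (A k)) {ι : Type*}
    [Fintype ι] [DecidableEq κ] [DecidableEq ι] {B : ι → Set X} {S : κ → Finset ι}
    (hB : IsDisjointFamily μ B) (hS : ∀ k, A k = ⋃ b ∈ S k, B b) (L : StrongDual ℝ (κ → ℝ)) :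
    charFunDual (Q.map fun ν k => (num (A k) ν : ℝ)) L =
      ∫ ν, ∏ b, Complex.exp ((∑ k with b ∈ S k, L (Pi.single k 1) : ℝ) * Complex.I) ^
        num (B b) ν ∂Q := by
  have hV : Measurable fun (ν : CountingMeasures X) k => (num (A k) ν : ℝ) :=
    measurable_pi_lambda _ fun k =>
      (Measurable.of_discrete (f := fun n : ℕ => (n : ℝ))).comp (measurable_num (hA k))
  rw [charFunDual_apply, integral_map hV.aemeasurable
    (Continuous.aestronglyMeasurable (by fun_prop))]
  refine integral_congr_ae ?_
  filter_upwards [hQ.ae_forall hB] with ν hν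
  have hL : L (fun k => (num (A k) ν : ℝ)) =
      ∑ b, (num (B b) ν : ℝ) * ∑ k with b ∈ S k, L (Pi.single k 1) := by
    conv_lhs => rw [pi_eq_sum_univ' fun k => (num (A k) ν : ℝ)]
    simp only [hS, num_biUnion hB _ hν, map_sum, map_smul, smul_eq_mul, Nat.cast_sum,
      Finset.mul_sum, Finset.sum_mul]
    exact Finset.sum_comm' (by simp)
  simp only [← Complex.exp_nat_mul]
  rw [← Complex.exp_sum, hL]
  push_cast
  rw [Finset.sum_mul]
  exact congrArg Complex.exp (Finset.sum_congr rfl fun b _ => by ring)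

lemma measure_iInter_N_preimage {Q : Measure (CountingMeasures X)} (hQ : HasFiniteCounts μ Q)
    {κ : Type*} [Countable κ] {A : κ → Set X} (hA : ∀ k, MeasurableSet (A k))
    (hfin : ∀ k, μ (A k) < ∞) {E : κ → Set ℝ≥0∞} (hE : ∀ k, MeasurableSet (E k)) :
    Q (⋂ k, N (A k) ⁻¹' E k) =
      Q.map (fun ν k => (num (A k) ν : ℝ)) (univ.pi fun k => ENNReal.ofReal ⁻¹' E k) := by
  have hV : Measurable fun (ν : CountingMeasures X) k => (num (A k) ν : ℝ) :=
    measurable_pi_lambda _ fun k =>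
      (Measurable.of_discrete (f := fun n : ℕ => (n : ℝ))).comp (measurable_num (hA k))
  rw [Measure.map_apply hV (MeasurableSet.univ_pi fun k => ENNReal.measurable_ofReal (hE k))]
  refine measure_congr ?_
  filter_upwards [ae_all_iff.2 fun k => hQ _ (hA k) (hfin k)] with ν hν
  refine propext ?_
  change ν ∈ ⋂ k, N (A k) ⁻¹' E k ↔
    (fun k => (num (A k) ν : ℝ)) ∈ univ.pi fun k => ENNReal.ofReal ⁻¹' E k
  simp [hν]

theorem ext_of_integral_num [SigmaFinite μ] {Q₁ Q₂ : Measure (CountingMeasures X)}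
    [IsFiniteMeasure Q₁] [IsFiniteMeasure Q₂] (h₁ : HasFiniteCounts μ Q₁)
    (h₂ : HasFiniteCounts μ Q₂)
    (h : ∀ (m : ℕ) (B : Fin m → Set X), IsDisjointFamily μ B → ∀ v : Fin m → ℝ,
      ∫ ν, ∏ b, Complex.exp (v b * Complex.I) ^ num (B b) ν ∂Q₁ =
        ∫ ν, ∏ b, Complex.exp (v b * Complex.I) ^ num (B b) ν ∂Q₂) :
    Q₁ = Q₂ := by
  classical
  let S : Set (Set X) := {A | MeasurableSet A ∧ μ A < ∞}
  let π : Set X → Set (Set (CountingMeasures X)) := fun A =>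
    {s | MeasurableSet[MeasurableSpace.comap (N A) inferInstance] s}
  have hcylinder : ∀ s ∈ piiUnionInter π S, Q₁ s = Q₂ s := by
    rintro s ⟨t, htS, f, hf, rfl⟩
    choose! E hEm hE using hf
    have hmap : Q₁.map (fun ν (A : t) => (num A.1 ν : ℝ)) =
        Q₂.map (fun ν (A : t) => (num A.1 ν : ℝ)) := by
      refine Measure.ext_of_charFunDual (funext fun L => ?_)
      obtain ⟨m, B, T, hB, -, hT⟩ := exists_atoms (μ := μ) (fun A : t => A.1)
        (fun A => (htS A.2).1) fun A => (htS A.2).2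
      rw [charFunDual_map_num h₁ (fun A : t => (htS A.2).1) hB hT,
        charFunDual_map_num h₂ (fun A : t => (htS A.2).1) hB hT, h m B hB]
    have hinter : ⋂ A ∈ t, f A = ⋂ A : t, N A.1 ⁻¹' E A := by
      ext ν
      simp only [mem_iInter, Subtype.forall]
      exact forall₂_congr fun A hA => by rw [hE A hA]
    rw [hinter,
      measure_iInter_N_preimage h₁ (fun A : t => (htS A.2).1) (fun A => (htS A.2).2)
        (fun A => hEm A A.2),
      measure_iInter_N_preimage h₂ (fun A : t => (htS A.2).1) (fun A => (htS A.2).2)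
        (fun A => hEm A A.2), hmap]
  refine ext_of_generate_finite (piiUnionInter π S) ?_ ?_ hcylinder
    (hcylinder univ ⟨∅, by simp, fun _ => univ, by simp, by simp⟩)
  · exact (sigmaN_finite_eq (μ := μ)).trans (generateFrom_piiUnionInter_measurableSet
      (fun A => MeasurableSpace.comap (N A) inferInstance) S).symm
  · exact isPiSystem_piiUnionInter _
      (fun A => @MeasurableSpace.isPiSystem_measurableSet _
        (MeasurableSpace.comap (N A) inferInstance)) _

end Determination

section Suspension

variable {X : Type*} [MeasurableSpace X] {μ : Measure X} {P : Measure (CountingMeasures X)}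

lemma N_suspension (T : X ≃ᵐ X) {A : Set X} (hA : MeasurableSet A) (ν : CountingMeasures X) :
    N A (suspension T ν) = N (T ⁻¹' A) ν :=
  Measure.map_apply T.measurable hA

lemma measurable_suspension (T : X ≃ᵐ X) : Measurable (suspension T) := by
  refine Measurable.of_le_map (iSup₂_le fun A hA => ?_)
  rw [MeasurableSpace.comap_le_iff_le_map]
  have hcomp : N A ∘ suspension T = N (T ⁻¹' A) := funext fun ν => N_suspension T hA ν
  have hmeas : Measurable (N A ∘ suspension T) := hcomp ▸ measurable_N (T.measurable hA)
  exact fun s hs => hmeas hs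

lemma measurePreserving_suspension [SigmaFinite μ] {T : X ≃ᵐ X} (hT : MeasurePreserving T μ μ)
    (hP : HasPoissonCounts μ P) : MeasurePreserving (suspension T) P P := by
  have := hP.isProbabilityMeasure
  have hm := measurable_suspension T
  have := Measure.isProbabilityMeasure_map hm.aemeasurable (μ := P)
  have hnum : ∀ A, MeasurableSet A → ∀ ν, num A (suspension T ν) = num (T ⁻¹' A) ν := by
    intro A hA ν
    simp only [num, N_suspension T hA]
  have hpre : ∀ A, MeasurableSet A → μ (T ⁻¹' A) = μ A := fun A hA =>
    hT.measure_preimage hA.nullMeasurableSet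
  refine ⟨hm, ext_of_integral_num (μ := μ) (fun A hA hfin => ?_) hP.ae_N_eq
    fun m B hB v => ?_⟩
  · have h : ∀ᵐ ν ∂P, N A (suspension T ν) = num A (suspension T ν) := by
      filter_upwards [hP.ae_N_eq _ (T.measurable hA) (hpre A hA ▸ hfin)] with ν hν
      rw [hnum A hA, N_suspension T hA, hν]
    refine (ae_map_iff hm.aemeasurable (measurableSet_eq_fun (measurable_N hA) ?_)).2 h
    exact (Measurable.of_discrete (f := fun n : ℕ => (n : ℝ≥0∞))).comp (measurable_num hA)
  · have hB' : IsDisjointFamily μ fun b => T ⁻¹' (B b) :=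
      ⟨fun b => T.measurable (hB.measurableSet b), fun b c hbc => (hB.disjoint hbc).preimage T,
        fun b => (hpre _ (hB.measurableSet b)) ▸ hB.measure_lt_top b⟩
    rw [integral_map hm.aemeasurable]
    · simp only [hnum _ (hB.measurableSet _)]
      rw [hP.integral_prod_comp_num hB' fun b k => Complex.exp (v b * Complex.I) ^ k,
        hP.integral_prod_comp_num hB fun b k => Complex.exp (v b * Complex.I) ^ k]
      simp only [hpre _ (hB.measurableSet _)]
    · refine Measurable.aestronglyMeasurable (Finset.measurable_prod _ fun b _ => ?_)
      exact (Measurable.of_discrete (f := fun n : ℕ => Complex.exp (v b * Complex.I) ^ n)).comp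
        (measurable_num (hB.measurableSet b))

end Suspension

section Splitting

lemma exists_measure_Iic_eq (ρ : Measure ℝ) [IsFiniteMeasure ρ] [NullSingletonClass ρ] {r : ℝ}
    (h0 : 0 < r) (h1 : r < ρ.real univ) : ∃ t, ρ.real (Iic t) = r := by
  have hc : Continuous fun t => ρ.real (Iic t) := by
    have hprim : (fun t => ρ.real (Iic t)) =
        fun t => ρ.real (Iic 0) + ∫ _ in (0 : ℝ)..t, (1 : ℝ) ∂ρ := by
      funext t
      have h := intervalIntegral.integral_Iic_sub_Iic (μ := ρ) (f := fun _ => (1 : ℝ))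
        (a := 0) (b := t) (integrable_const _).integrableOn (integrable_const _).integrableOn
      simp only [setIntegral_const, smul_eq_mul, mul_one] at h
      linarith
    rw [hprim]
    exact continuous_const.add (intervalIntegral.continuous_primitive
      (fun a b => intervalIntegrable_const) 0)
  refine mem_range_of_exists_le_of_exists_ge hc ?_ ?_
  · have h := (ENNReal.tendsto_toReal (measure_ne_top ρ univ)).comp
      (tendsto_measure_Ici_atBot ρ)
    obtain ⟨t, ht⟩ := (h.eventually (eventually_gt_nhds
      (show ρ.real univ - r < (ρ univ).toReal by simpa [Measure.real] using h0))).exists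
    refine ⟨t, ?_⟩
    have hIci : ρ.real (Ici t) = ρ.real (Ioi t) := measureReal_congr Ioi_ae_eq_Ici.symm
    have hcompl : ρ.real (Iic t) + ρ.real (Ioi t) = ρ.real univ := by
      rw [← compl_Iic]
      exact measureReal_add_measureReal_compl measurableSet_Iic
    have ht' : ρ.real univ - r < ρ.real (Ici t) := ht
    linarith
  · have h := (ENNReal.tendsto_toReal (measure_ne_top ρ univ)).comp
      (tendsto_measure_Iic_atTop ρ)
    obtain ⟨t, ht⟩ := (h.eventually (eventually_gt_nhds
      (show r < (ρ univ).toReal by simpa [Measure.real] using h1))).exists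
    exact ⟨t, ht.le⟩

variable {X : Type*} [MeasurableSpace X] {μ : Measure X}

lemma exists_measurable_injective_real (X : Type*) [MeasurableSpace X]
    [MeasurableSpace.CountablySeparated X] : ∃ f : X → ℝ, Measurable f ∧ f.Injective := by
  obtain ⟨f, hf, hinj⟩ := MeasurableSpace.measurable_injection_nat_bool_of_countablySeparated X
  have he := measurableEmbedding_embeddingReal (ℕ → Bool)
  exact ⟨_, he.measurable.comp hf, he.injective.comp hinj⟩

lemma exists_subset_measure_eq [MeasurableSpace.CountablySeparated X] [NullSingletonClass μ]
    {A : Set X} (hA : MeasurableSet A) (hfin : μ A < ∞) {r : ℝ} (h0 : 0 ≤ r)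
    (h1 : r ≤ μ.real A) : ∃ B ⊆ A, MeasurableSet B ∧ μ.real B = r := by
  rcases h0.eq_or_lt with rfl | h0
  · exact ⟨∅, empty_subset _, MeasurableSet.empty, by simp⟩
  rcases h1.eq_or_lt with rfl | h1
  · exact ⟨A, Subset.rfl, hA, rfl⟩
  obtain ⟨f, hf, hinj⟩ := exists_measurable_injective_real X
  have : IsFiniteMeasure (μ.restrict A) := ⟨by simpa using hfin⟩
  let ρ := (μ.restrict A).map f
  have : NullSingletonClass ρ := by
    refine ⟨fun x => ?_⟩
    rw [Measure.map_apply hf (measurableSet_singleton x)]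
    exact (subsingleton_singleton.preimage hinj).measure_zero _
  have hρ : ∀ s, MeasurableSet s → ρ.real s = μ.real (f ⁻¹' s ∩ A) := by
    intro s hs
    simp only [ρ, Measure.real]
    rw [Measure.map_apply hf hs, Measure.restrict_apply (hf hs)]
  obtain ⟨t, ht⟩ := exists_measure_Iic_eq ρ h0 (by rw [hρ _ MeasurableSet.univ]; simpa using h1)
  exact ⟨_, inter_subset_right, (hf measurableSet_Iic).inter hA,
    by rw [← ht, hρ _ measurableSet_Iic]⟩

lemma IsDisjointFamily.cons {n : ℕ} {B : Set X} {C : Fin n → Set X} (hC : IsDisjointFamily μ C)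
    (hB : MeasurableSet B) (hfin : μ B < ∞) (hBC : ∀ i, Disjoint B (C i)) :
    IsDisjointFamily μ (Fin.cons B C : Fin (n + 1) → Set X) where
  measurableSet := Fin.cases hB hC.measurableSet
  disjoint i j hij := by
    cases i using Fin.cases with
    | zero =>
      cases j using Fin.cases with
      | zero => exact absurd rfl hij
      | succ j => simpa using hBC j
    | succ i =>
      cases j using Fin.cases with
      | zero => simpa using (hBC i).symm
      | succ j => simpa using hC.disjoint fun h => hij (congrArg _ h)
  measure_lt_top := Fin.cases hfin hC.measure_lt_top

lemma exists_equal_pieces [MeasurableSpace.CountablySeparated X] [NullSingletonClass μ] (n : ℕ)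
    {A : Set X} (hA : MeasurableSet A) (hfin : μ A < ∞) {r : ℝ} (hr : 0 ≤ r)
    (h : μ.real A = (n + 1) * r) :
    ∃ C : Fin (n + 1) → Set X, IsDisjointFamily μ C ∧ (⋃ i, C i) = A ∧ ∀ i, μ.real (C i) = r := by
  induction n generalizing A with
  | zero =>
    exact ⟨fun _ => A, ⟨fun _ => hA, fun i j hij => absurd (Fin.subsingleton_one.elim i j) hij,
      fun _ => hfin⟩, iUnion_const _,
      fun _ => by simpa using h⟩
  | succ n ih =>
    push_cast at h
    obtain ⟨B, hBA, hB, hBr⟩ := exists_subset_measure_eq hA hfin hr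
      (h.symm ▸ le_mul_of_one_le_left hr (by linarith [Nat.cast_nonneg (α := ℝ) n]))
    have hdiff : μ.real (A \ B) = (n + 1) * r := by
      rw [measureReal_sdiff hBA hB hfin.ne, h, hBr]
      ring
    obtain ⟨C, hC, hCu, hCr⟩ :=
      ih (hA.diff hB) ((measure_mono sdiff_subset).trans_lt hfin) hdiff
    have hBC : ∀ i, Disjoint B (C i) := fun i =>
      disjoint_sdiff_right.mono_right (hCu ▸ subset_iUnion C i)
    refine ⟨Fin.cons B C, hC.cons hB ((measure_mono hBA).trans_lt hfin) hBC, ?_,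
      Fin.cases hBr hCr⟩
    ext x
    rw [mem_iUnion, Fin.exists_fin_succ]
    simp only [Fin.cons_zero, Fin.cons_succ]
    rw [← mem_iUnion, hCu, ← mem_union, union_sdiff_cancel hBA]

end Splitting

section Chaos

variable {X : Type*} [MeasurableSpace X] {μ : Measure X} {P : Measure (CountingMeasures X)}

lemma HasPoissonCounts.hasAllMoments_prod_ctr (hP : HasPoissonCounts μ P) {ι : Type*}
    {B : ι → Set X} (hB : IsDisjointFamily μ B) (t : Finset ι) :
    HasAllMoments (fun ν => ∏ i ∈ t, (ctr μ (B i) ν : ℂ)) P := by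
  have := hP.isProbabilityMeasure
  exact HasAllMoments.prod fun i _ =>
    hP.hasAllMoments_ctr (hB.measurableSet i) (hB.measure_lt_top i)

lemma mem_chaos_of_ae_eq {n : ℕ} {A : Fin n → Set X} (hA : IsDisjointFamily μ A)
    {F : Lp ℂ 2 P} (hF : F =ᵐ[P] fun ν => ∏ i, (ctr μ (A i) ν : ℂ)) : F ∈ chaos μ P n :=
  Submodule.le_topologicalClosure _ (Submodule.subset_span
    ⟨A, hA.measurableSet, hA.disjoint, hA.measure_lt_top, hF⟩)

lemma mem_chaos_of_finset {ι : Type*} {B : ι → Set X} (hB : IsDisjointFamily μ B) (t : Finset ι)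
    {F : Lp ℂ 2 P} (hF : F =ᵐ[P] fun ν => ∏ i ∈ t, (ctr μ (B i) ν : ℂ)) :
    F ∈ chaos μ P t.card := by
  refine mem_chaos_of_ae_eq (A := fun i => B (t.equivFin.symm i))
    ⟨fun i => hB.measurableSet _, fun i j hij => hB.disjoint fun h =>
      hij (t.equivFin.symm.injective (Subtype.ext h)), fun i => hB.measure_lt_top _⟩ (hF.trans ?_)
  refine Filter.Eventually.of_forall fun ν => ?_
  simp only
  rw [← Finset.prod_coe_sort]
  exact (Equiv.prod_comp t.equivFin.symm fun i : t => (ctr μ (B i) ν : ℂ)).symm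

lemma inner_toLp {Ω : Type*} {mΩ : MeasurableSpace Ω} {P : Measure Ω} {F G : Ω → ℂ}
    (hF : MemLp F 2 P) (hG : MemLp G 2 P) :
    inner ℂ (hF.toLp F) (hG.toLp G) = ∫ ω, (starRingEnd ℂ) (F ω) * G ω ∂P := by
  rw [L2.inner_def]
  refine integral_congr_ae ?_
  filter_upwards [hF.coeFn_toLp, hG.coeFn_toLp] with ω hFω hGω
  rw [hFω, hGω, RCLike.inner_apply, mul_comm]

end Chaos

section OneVariable

variable (r : ℝ≥0) (w : ℂ)

open scoped ComplexConjugate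

lemma integrable_poissonMeasure_centered_mul_pow :
    Integrable (fun k : ℕ => ((k : ℂ) - r) * w ^ k) (poissonMeasure r) := by
  simp only [sub_mul]
  exact (integrable_poissonMeasure_natCast_mul_pow r w).sub
    ((integrable_poissonMeasure_pow r w).const_mul _)

lemma integral_poissonMeasure_affine_normSq (z : ℂ) :
    ∫ k : ℕ, conj (1 + z * ((k : ℂ) - r)) * (1 + z * ((k : ℂ) - r)) ∂(poissonMeasure r) =
      1 + conj z * z * r := by
  have hlin : Integrable (fun k : ℕ => (conj z + z) * ((k : ℂ) - r)) (poissonMeasure r) :=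
    ((integrable_poissonMeasure_natCast r).sub (integrable_const _)).const_mul _
  have hsq : Integrable (fun k : ℕ => conj z * z * (((k : ℂ) - r) * ((k : ℂ) - r)))
      (poissonMeasure r) := by
    refine Integrable.const_mul ?_ _
    have h := (integrable_poissonMeasure_natCast_pow (𝕜 := ℂ) r 2).sub
      (((integrable_poissonMeasure_natCast r).const_mul (2 * r : ℂ)).sub
        (integrable_const ((r : ℂ) ^ 2)))
    refine h.congr (Filter.Eventually.of_forall fun k => ?_)
    simp only [Pi.sub_apply]
    ring
  have hexpand (k : ℕ) : conj (1 + z * ((k : ℂ) - r)) * (1 + z * ((k : ℂ) - r)) =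
      1 + ((conj z + z) * ((k : ℂ) - r) + conj z * z * (((k : ℂ) - r) * ((k : ℂ) - r))) := by
    simp only [map_add, map_one, map_mul, map_sub, Complex.conj_natCast, Complex.conj_ofReal]
    ring
  have hsum : Integrable (fun k : ℕ => (conj z + z) * ((k : ℂ) - r) +
      conj z * z * (((k : ℂ) - r) * ((k : ℂ) - r))) (poissonMeasure r) := hlin.add hsq
  simp only [hexpand]
  rw [integral_add (integrable_const _) hsum, integral_add hlin hsq, integral_const_mul,
    integral_const_mul, integral_poissonMeasure_centered, integral_poissonMeasure_centered_sq]
  simp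

lemma integral_poissonMeasure_affine_mul_pow (z : ℂ) :
    ∫ k : ℕ, conj (1 + z * ((k : ℂ) - r)) * (w ^ k * Complex.exp (-((w - 1) * r)))
      ∂(poissonMeasure r) = 1 + conj z * (w - 1) * r := by
  have hexpand (k : ℕ) :
      conj (1 + z * ((k : ℂ) - r)) * (w ^ k * Complex.exp (-((w - 1) * r))) =
      (w ^ k + conj z * (((k : ℂ) - r) * w ^ k)) * Complex.exp (-((w - 1) * r)) := by
    simp only [map_add, map_one, map_mul, map_sub, Complex.conj_natCast, Complex.conj_ofReal]
    ring
  simp only [hexpand]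
  rw [integral_mul_const, integral_add (integrable_poissonMeasure_pow r w)
    ((integrable_poissonMeasure_centered_mul_pow r w).const_mul _), integral_const_mul,
    integral_poissonMeasure_centered_mul_pow, integral_poissonMeasure_pow, Complex.exp_neg]
  have h := Complex.exp_ne_zero ((w - 1) * r)
  rw [mul_comm (r : ℂ) (w - 1)]
  field_simp

lemma integral_poissonMeasure_pow_normSq :
    ∫ k : ℕ, conj (w ^ k * Complex.exp (-((w - 1) * r))) *
      (w ^ k * Complex.exp (-((w - 1) * r))) ∂(poissonMeasure r) =
      Complex.exp (conj (w - 1) * (w - 1) * r) := by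
  have hexpand (k : ℕ) : conj (w ^ k * Complex.exp (-((w - 1) * r))) *
      (w ^ k * Complex.exp (-((w - 1) * r))) = (conj w * w) ^ k *
        Complex.exp (conj (-((w - 1) * r)) + (-((w - 1) * r))) := by
    rw [Complex.exp_add, Complex.exp_conj, mul_pow, map_mul, map_pow]
    ring
  simp only [hexpand]
  rw [integral_mul_const, integral_poissonMeasure_pow, ← Complex.exp_add]
  congr 1
  simp only [map_neg, map_mul, map_sub, map_one, Complex.conj_ofReal]
  ring

end OneVariable

section ExponentialVariables

variable {X : Type*} [MeasurableSpace X] {μ : Measure X} {P : Measure (CountingMeasures X)}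

open scoped ComplexConjugate

/-- The exponential variable `∏ b, w b ^ N (B b)`, normalized to have mean `1` under the law of the
Poisson process of intensity `μ`. -/
noncomputable def wickExp (μ : Measure X) {ι : Type*} [Fintype ι] (B : ι → Set X) (w : ι → ℂ)
    (ν : CountingMeasures X) : ℂ :=
  ∏ b, (w b ^ num (B b) ν * Complex.exp (-((w b - 1) * (μ (B b)).toNNReal)))

/-- The approximation of `wickExp μ B w` of order one in each variable `N (B b)`; it is a sum of
elements of the chaoses. -/
noncomputable def linearizedExp (μ : Measure X) {ι : Type*} [Fintype ι] (B : ι → Set X)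
    (w : ι → ℂ) (ν : CountingMeasures X) : ℂ :=
  ∏ b, (1 + (w b - 1) * (ctr μ (B b) ν : ℂ))

namespace HasPoissonCounts

lemma hasAllMoments_pow_num (hP : HasPoissonCounts μ P) {A : Set X} (hA : MeasurableSet A)
    (hfin : μ A < ∞) (w : ℂ) : HasAllMoments (fun ν => w ^ num A ν) P := by
  intro n
  have h : MemLp (fun k : ℕ => w ^ k) n (P.map (num A)) := by
    rw [hP.map_num A hA hfin]
    rcases eq_or_ne n 0 with rfl | hn
    · simpa using (Measurable.of_discrete (f := fun k : ℕ => w ^ k)).aestronglyMeasurable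
    · rw [← integrable_norm_rpow_iff Measurable.of_discrete.aestronglyMeasurable
        (by exact_mod_cast hn) (ENNReal.natCast_ne_top n)]
      simpa [← pow_mul, mul_comm n] using
        (integrable_poissonMeasure_pow (μ A).toNNReal (w ^ n)).norm
  exact h.comp_of_map (measurable_num hA).aemeasurable

variable {ι : Type*} [Fintype ι] {B : ι → Set X}

lemma hasAllMoments_wickExp (hP : HasPoissonCounts μ P) (hB : IsDisjointFamily μ B) (w : ι → ℂ) :
    HasAllMoments (wickExp μ B w) P := by
  have := hP.isProbabilityMeasure
  exact HasAllMoments.prod fun b _ =>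
    (hP.hasAllMoments_pow_num (hB.measurableSet b) (hB.measure_lt_top b) _).mul
      (HasAllMoments.const _)

lemma hasAllMoments_linearizedExp (hP : HasPoissonCounts μ P) (hB : IsDisjointFamily μ B)
    (w : ι → ℂ) : HasAllMoments (linearizedExp μ B w) P := by
  have := hP.isProbabilityMeasure
  exact HasAllMoments.prod fun b _ => (HasAllMoments.const 1).add ((HasAllMoments.const _).mul
    (hP.hasAllMoments_ctr (hB.measurableSet b) (hB.measure_lt_top b)))

lemma ae_linearizedExp_eq (hP : HasPoissonCounts μ P) (hB : IsDisjointFamily μ B) (w : ι → ℂ) :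
    ∀ᵐ ν ∂P, linearizedExp μ B w ν =
      ∏ b, (1 + (w b - 1) * ((num (B b) ν : ℂ) - (μ (B b)).toNNReal)) := by
  filter_upwards [ae_all_iff.2 fun b =>
    hP.ae_ctr_eq (hB.measurableSet b) (hB.measure_lt_top b)] with ν hν
  simp only [linearizedExp, hν]

lemma inner_linearizedExp_eq_zero (hP : HasPoissonCounts μ P) (hB : IsDisjointFamily μ B)
    (w : ι → ℂ) {g : Lp ℂ 2 P} (hg : ∀ n, ∀ F ∈ chaos μ P n, inner ℂ F g = 0) :
    inner ℂ ((hP.hasAllMoments_linearizedExp hB w).memLp_two.toLp _) g = 0 := by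
  classical
  let Z (t : Finset ι) : Lp ℂ 2 P := (hP.hasAllMoments_prod_ctr hB t).memLp_two.toLp _
  have hZ (t : Finset ι) : Z t =ᵐ[P] fun ν => ∏ b ∈ t, (ctr μ (B b) ν : ℂ) :=
    MemLp.coeFn_toLp _
  have hexpand : (hP.hasAllMoments_linearizedExp hB w).memLp_two.toLp _ =
      ∑ t : Finset ι, (∏ b ∈ t, (w b - 1)) • Z t := by
    refine Lp.ext ?_
    filter_upwards [MemLp.coeFn_toLp (hP.hasAllMoments_linearizedExp hB w).memLp_two,
      Lp.coeFn_finsetSum Finset.univ fun t => (∏ b ∈ t, (w b - 1)) • Z t,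
      ae_all_iff.2 fun t => Lp.coeFn_smul (∏ b ∈ t, (w b - 1)) (Z t),
      ae_all_iff.2 hZ] with ν hlin hsum hsmul hν
    rw [hlin, hsum, linearizedExp, Finset.prod_one_add, Finset.powerset_univ, Finset.sum_apply]
    refine Finset.sum_congr rfl fun t _ => ?_
    rw [hsmul, Pi.smul_apply, hν, smul_eq_mul, Finset.prod_mul_distrib]
  rw [hexpand, sum_inner]
  refine Finset.sum_eq_zero fun t _ => ?_
  rw [inner_smul_left, hg _ _ (mem_chaos_of_finset hB t (hZ t)), mul_zero]

end HasPoissonCounts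

lemma inner_toLp_prod_comp_num (hP : HasPoissonCounts μ P) {ι : Type} [Fintype ι]
    {B : ι → Set X} (hB : IsDisjointFamily μ B) {F G : CountingMeasures X → ℂ}
    (hF : MemLp F 2 P) (hG : MemLp G 2 P) {a b : ι → ℕ → ℂ}
    (hFa : ∀ᵐ ν ∂P, F ν = ∏ i, a i (num (B i) ν)) (hGb : ∀ᵐ ν ∂P, G ν = ∏ i, b i (num (B i) ν)) :
    inner ℂ (hF.toLp F) (hG.toLp G) =
      ∏ i, ∫ k, conj (a i k) * b i k ∂(poissonMeasure (μ (B i)).toNNReal) := by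
  rw [inner_toLp, ← hP.integral_prod_comp_num hB fun i k => conj (a i k) * b i k]
  refine integral_congr_ae ?_
  filter_upwards [hFa, hGb] with ν hFν hGν
  rw [hFν, hGν, map_prod, ← Finset.prod_mul_distrib]

lemma norm_sub_sq_of_inner_eq {E : Type*} [NormedAddCommGroup E] [InnerProductSpace ℂ E]
    {x y : E} {a b : ℂ} (hxx : inner ℂ x x = a) (hxy : inner ℂ x y = a)
    (hyy : inner ℂ y y = b) : ‖x - y‖ ^ 2 = (b - a).re := by
  have hx : ‖x‖ ^ 2 = a.re := by
    rw [← hxx, ← inner_self_eq_norm_sq (𝕜 := ℂ), RCLike.re_to_complex]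
  have hy : ‖y‖ ^ 2 = b.re := by
    rw [← hyy, ← inner_self_eq_norm_sq (𝕜 := ℂ), RCLike.re_to_complex]
  rw [norm_sub_sq (𝕜 := ℂ), hxy, hx, hy, Complex.sub_re, RCLike.re_to_complex]
  ring

lemma norm_linearizedExp_sub_wickExp_sq (hP : HasPoissonCounts μ P) {ι : Type} [Fintype ι]
    {B : ι → Set X} (hB : IsDisjointFamily μ B) (w : ι → ℂ) :
    ‖(hP.hasAllMoments_linearizedExp hB w).memLp_two.toLp _ -
        (hP.hasAllMoments_wickExp hB w).memLp_two.toLp _‖ ^ 2 =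
      (∏ b, Complex.exp (conj (w b - 1) * (w b - 1) * (μ (B b)).toNNReal) -
        ∏ b, (1 + conj (w b - 1) * (w b - 1) * (μ (B b)).toNNReal)).re := by
  let lin (b : ι) (k : ℕ) : ℂ := 1 + (w b - 1) * ((k : ℂ) - (μ (B b)).toNNReal)
  let wick (b : ι) (k : ℕ) : ℂ := w b ^ k * Complex.exp (-((w b - 1) * (μ (B b)).toNNReal))
  have hlin : ∀ᵐ ν ∂P, linearizedExp μ B w ν = ∏ b, lin b (num (B b) ν) :=
    hP.ae_linearizedExp_eq hB w
  have hwick : ∀ᵐ ν ∂P, wickExp μ B w ν = ∏ b, wick b (num (B b) ν) :=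
    Filter.Eventually.of_forall fun ν => rfl
  refine norm_sub_sq_of_inner_eq ?_ ?_ ?_
  · rw [inner_toLp_prod_comp_num hP hB _ _ (a := lin) (b := lin) hlin hlin]
    exact Finset.prod_congr rfl fun b _ => integral_poissonMeasure_affine_normSq _ (w b - 1)
  · rw [inner_toLp_prod_comp_num hP hB _ _ (a := lin) (b := wick) hlin hwick]
    exact Finset.prod_congr rfl fun b _ =>
      integral_poissonMeasure_affine_mul_pow _ (w b) (w b - 1)
  · rw [inner_toLp_prod_comp_num hP hB _ _ (a := wick) (b := wick) hwick hwick]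
    exact Finset.prod_congr rfl fun b _ => integral_poissonMeasure_pow_normSq _ (w b)

lemma exists_equal_refinement [MeasurableSpace.CountablySeparated X] [NullSingletonClass μ]
    {ι : Type*} {B : ι → Set X} (hB : IsDisjointFamily μ B) (n : ℕ) :
    ∃ D : ι × Fin (n + 1) → Set X, IsDisjointFamily μ D ∧ (∀ b, ⋃ i, D (b, i) = B b) ∧
      ∀ j, (μ (D j)).toNNReal = (μ (B j.1)).toNNReal / (n + 1 : ℕ) := by
  choose C hC hCu hCr using fun b =>
    exists_equal_pieces n (hB.measurableSet b) (hB.measure_lt_top b)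
      (r := μ.real (B b) / (n + 1)) (by positivity) (by field_simp)
  refine ⟨fun j => C j.1 j.2, ⟨fun j => (hC _).measurableSet _, ?_,
    fun j => (hC _).measure_lt_top _⟩, hCu, fun j => NNReal.eq ?_⟩
  · rintro ⟨b, i⟩ ⟨b', i'⟩ h
    rcases eq_or_ne b b' with rfl | hb
    · exact (hC b).disjoint fun hi => h (Prod.ext rfl hi)
    · exact (hB.disjoint hb).mono (hCu b ▸ subset_iUnion (C b) i)
        (hCu b' ▸ subset_iUnion (C b') i')
  · push_cast
    exact hCr j.1 j.2

lemma wickExp_refinement_ae_eq (hP : HasFiniteCounts μ P) {ι : Type*} [Fintype ι]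
    {B : ι → Set X} (w : ι → ℂ) {n : ℕ} {D : ι × Fin (n + 1) → Set X} (hD : IsDisjointFamily μ D)
    (hDu : ∀ b, ⋃ i, D (b, i) = B b)
    (hDr : ∀ j, (μ (D j)).toNNReal = (μ (B j.1)).toNNReal / (n + 1 : ℕ)) :
    wickExp μ D (w ∘ Prod.fst) =ᵐ[P] wickExp μ B w := by
  have hDb (b : ι) : IsDisjointFamily μ fun i => D (b, i) :=
    ⟨fun i => hD.measurableSet _, fun i j hij => hD.disjoint (by simpa using hij),
      fun i => hD.measure_lt_top _⟩
  filter_upwards [ae_all_iff.2 fun b => hP.ae_forall (hDb b)] with ν hν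
  rw [wickExp, wickExp, Fintype.prod_prod_type]
  refine Finset.prod_congr rfl fun b _ => ?_
  have hnum : num (B b) ν = ∑ i, num (D (b, i)) ν := by
    simpa only [Finset.mem_univ, iUnion_true, hDu] using num_biUnion (hDb b) Finset.univ (hν b)
  have hn : ((n : ℂ) + 1) ≠ 0 := by exact_mod_cast n.succ_ne_zero
  simp only [Finset.prod_mul_distrib, Function.comp_apply]
  rw [hnum, Finset.prod_pow_eq_pow_sum, ← Complex.exp_sum]
  congr 2
  simp only [hDr, Finset.sum_const, Finset.card_univ, Fintype.card_fin, nsmul_eq_mul]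
  push_cast
  field_simp

variable [MeasurableSpace.CountablySeparated X] [NullSingletonClass μ]

-- Cutting each set into `n + 1` pieces of equal measure does not change the exponential variable,
-- while the distance to its linearization tends to zero.
lemma inner_wickExp_eq_zero (hP : HasPoissonCounts μ P) {ι : Type} [Fintype ι] {B : ι → Set X}
    (hB : IsDisjointFamily μ B) (w : ι → ℂ) {g : Lp ℂ 2 P}
    (hg : ∀ n, ∀ F ∈ chaos μ P n, inner ℂ F g = 0) :
    inner ℂ ((hP.hasAllMoments_wickExp hB w).memLp_two.toLp _) g = 0 := by
  choose D hD hDu hDr using exists_equal_refinement hB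
  let c (b : ι) : ℂ := conj (w b - 1) * (w b - 1) * (μ (B b)).toNNReal
  let x (n : ℕ) : Lp ℂ 2 P :=
    (hP.hasAllMoments_linearizedExp (hD n) (w ∘ Prod.fst)).memLp_two.toLp _
  let y : Lp ℂ 2 P := (hP.hasAllMoments_wickExp hB w).memLp_two.toLp _
  have hdist (n : ℕ) : ‖x n - y‖ ^ 2 =
      (∏ b, Complex.exp (c b) - ∏ b, (1 + c b / (n + 1 : ℕ)) ^ (n + 1)).re := by
    have hy : y = (hP.hasAllMoments_wickExp (hD n) (w ∘ Prod.fst)).memLp_two.toLp _ :=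
      MemLp.toLp_congr _ _ (wickExp_refinement_ae_eq hP.ae_N_eq w (hD n) (hDu n) (hDr n)).symm
    have hc (j : ι × Fin (n + 1)) :
        conj (w j.1 - 1) * (w j.1 - 1) * ((μ (D n j)).toNNReal : ℂ) = c j.1 / (n + 1 : ℕ) := by
      rw [hDr n j]
      push_cast
      exact (mul_div_assoc _ _ _).symm
    have hn : ((n + 1 : ℕ) : ℂ) ≠ 0 := by exact_mod_cast n.succ_ne_zero
    rw [hy, norm_linearizedExp_sub_wickExp_sq hP (hD n)]
    simp only [Function.comp_apply, hc, Fintype.prod_prod_type, Finset.prod_const,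
      Finset.card_univ, Fintype.card_fin, ← Complex.exp_nat_mul, mul_div_cancel₀ _ hn]
  have hpow : Filter.Tendsto (fun n : ℕ => ∏ b, (1 + c b / (n + 1 : ℕ)) ^ (n + 1)) Filter.atTop
      (nhds (∏ b, Complex.exp (c b))) :=
    tendsto_finsetProd _ fun b _ =>
      (Complex.tendsto_one_add_div_pow_exp (c b)).comp (Filter.tendsto_add_atTop_nat 1)
  have hlim : Filter.Tendsto x Filter.atTop (nhds y) := by
    rw [tendsto_iff_norm_sub_tendsto_zero]
    have hsq : Filter.Tendsto (fun n => ‖x n - y‖ ^ 2) Filter.atTop (nhds 0) := by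
      simp only [hdist]
      simpa [Function.comp_def] using
        (Complex.continuous_re.tendsto _).comp (hpow.const_sub (∏ b, Complex.exp (c b)))
    simpa using hsq.sqrt
  have hx (n : ℕ) : inner ℂ (x n) g = 0 := hP.inner_linearizedExp_eq_zero (hD n) _ hg
  exact tendsto_nhds_unique (hlim.inner tendsto_const_nhds) (by simp [hx])

lemma integral_prod_pow_num_mul_eq_zero (hP : HasPoissonCounts μ P) {ι : Type} [Fintype ι]
    {B : ι → Set X} (hB : IsDisjointFamily μ B) (w : ι → ℂ) {g : Lp ℂ 2 P}
    (hg : ∀ n, ∀ F ∈ chaos μ P n, inner ℂ F g = 0) :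
    ∫ ν, g ν * ∏ b, w b ^ num (B b) ν ∂P = 0 := by
  let c : ℂ := ∏ b, Complex.exp (-((conj (w b) - 1) * (μ (B b)).toNNReal))
  have hc : conj c ≠ 0 :=
    (map_ne_zero _).2 (Finset.prod_ne_zero_iff.2 fun b _ => Complex.exp_ne_zero _)
  have hinner := inner_wickExp_eq_zero hP hB (fun b => conj (w b)) hg
  have hfactor : inner ℂ ((hP.hasAllMoments_wickExp hB fun b => conj (w b)).memLp_two.toLp _) g =
      (∫ ν, g ν * ∏ b, w b ^ num (B b) ν ∂P) * conj c := by
    rw [L2.inner_def, ← integral_mul_const]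
    refine integral_congr_ae ?_
    filter_upwards [MemLp.coeFn_toLp
      (hP.hasAllMoments_wickExp hB fun b => conj (w b)).memLp_two] with ν hν
    rw [hν, RCLike.inner_apply, wickExp, Finset.prod_mul_distrib, map_mul, map_prod, mul_assoc]
    simp only [map_pow, Complex.conj_conj, c]
  exact (mul_eq_zero.1 (hfactor ▸ hinner)).resolve_right hc

end ExponentialVariables

section Totality

variable {X : Type*} [MeasurableSpace X] {μ : Measure X} {P : Measure (CountingMeasures X)}

open scoped ComplexConjugate

lemma ae_eq_zero_of_withDensity_ofReal_eq {Ω : Type*} {mΩ : MeasurableSpace Ω} {P : Measure Ω}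
    {h : Ω → ℝ} (hh : Integrable h P) (hdens : P.withDensity (fun ω => ENNReal.ofReal (h ω)) =
      P.withDensity fun ω => ENNReal.ofReal (-h ω)) : h =ᵐ[P] 0 := by
  filter_upwards [(withDensity_eq_iff hh.1.aemeasurable.ennreal_ofReal
    hh.neg.1.aemeasurable.ennreal_ofReal hh.lintegral_lt_top.ne).1 hdens] with ω hω
  rw [Pi.neg_apply] at hω
  rcases le_total (h ω) 0 with hle | hle
  · rw [ENNReal.ofReal_of_nonpos hle, eq_comm, ENNReal.ofReal_eq_zero, neg_nonpos] at hω
    exact le_antisymm hle hω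
  · rw [ENNReal.ofReal_of_nonpos (neg_nonpos.2 hle), ENNReal.ofReal_eq_zero] at hω
    exact le_antisymm hω hle

-- The measures of densities `h⁺` and `h⁻` have the same characteristic functions.
lemma ae_eq_zero_of_integral_mul_prod_num [SigmaFinite μ]
    (hP : HasFiniteCounts μ P) {h : CountingMeasures X → ℝ} (hh : Integrable h P)
    (h0 : ∀ (m : ℕ) (B : Fin m → Set X), IsDisjointFamily μ B → ∀ v : Fin m → ℝ,
      ∫ ν, (h ν : ℂ) * ∏ b, Complex.exp (v b * Complex.I) ^ num (B b) ν ∂P = 0) :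
    h =ᵐ[P] 0 := by
  let Q (u : CountingMeasures X → ℝ) : Measure (CountingMeasures X) :=
    P.withDensity fun ν => ENNReal.ofReal (u ν)
  have hfinite {u : CountingMeasures X → ℝ} (hu : Integrable u P) : IsFiniteMeasure (Q u) :=
    isFiniteMeasure_withDensity_ofReal hu.2
  have hcounts (u : CountingMeasures X → ℝ) : HasFiniteCounts μ (Q u) := fun A hA hfin =>
    (withDensity_absolutelyContinuous P _).ae_le (hP A hA hfin)
  have hpos := hfinite hh
  have hneg := hfinite hh.neg
  have hQ : Q h = Q (-h) := by
    refine ext_of_integral_num (hcounts h) (hcounts _) fun m B hB v => ?_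
    let E (ν : CountingMeasures X) : ℂ := ∏ b, Complex.exp (v b * Complex.I) ^ num (B b) ν
    have hE : Measurable E := Finset.measurable_prod _ fun b _ => (Measurable.of_discrete
      (f := fun n : ℕ => Complex.exp (v b * Complex.I) ^ n)).comp
        (measurable_num (hB.measurableSet b))
    have hE_norm (ν : CountingMeasures X) : ‖E ν‖ ≤ 1 := by
      simp [E, norm_prod, Complex.norm_exp_ofReal_mul_I]
    have hdensity {u : CountingMeasures X → ℝ} (hu : Integrable u P) :
        ∫ ν, E ν ∂(Q u) = ∫ ν, ((max (u ν) 0 : ℝ) : ℂ) * E ν ∂P := by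
      rw [integral_withDensity_eq_integral_toReal_smul₀ hu.1.aemeasurable.ennreal_ofReal
        (Filter.Eventually.of_forall fun ν => ENNReal.ofReal_lt_top)]
      simp only [ENNReal.toReal_ofReal', Complex.real_smul]
    have hint {u : CountingMeasures X → ℝ} (hu : Integrable u P) :
        Integrable (fun ν => ((max (u ν) 0 : ℝ) : ℂ) * E ν) P :=
      hu.pos_part.ofReal.mul_bdd hE.aestronglyMeasurable (Filter.Eventually.of_forall hE_norm)
    change ∫ ν, E ν ∂(Q h) = ∫ ν, E ν ∂(Q (-h))
    rw [hdensity hh, hdensity hh.neg, ← sub_eq_zero, ← integral_sub (hint hh) (hint hh.neg),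
      ← h0 m B hB v]
    refine integral_congr_ae (Filter.Eventually.of_forall fun ν => ?_)
    simp only [Pi.neg_apply]
    rw [← sub_mul, ← Complex.ofReal_sub, max_zero_sub_max_neg_zero_eq_self]
  exact ae_eq_zero_of_withDensity_ofReal_eq hh hQ

lemma integral_ofReal_re_mul_eq_zero {Ω : Type*} {mΩ : MeasurableSpace Ω} {P : Measure Ω}
    {g E : Ω → ℂ} (hgE : ∫ ω, g ω * E ω ∂P = 0) (hgE' : ∫ ω, g ω * conj (E ω) ∂P = 0)
    (hint : Integrable (fun ω => g ω * E ω) P) (hint' : Integrable (fun ω => g ω * conj (E ω)) P) :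
    ∫ ω, ((g ω).re : ℂ) * E ω ∂P = 0 := by
  have hconj : ∫ ω, conj (g ω * conj (E ω)) ∂P = 0 := by rw [integral_conj, hgE', map_zero]
  have hre (ω : Ω) : ((g ω).re : ℂ) * E ω = (g ω * E ω + conj (g ω * conj (E ω))) / 2 := by
    rw [Complex.re_eq_add_conj, map_mul, Complex.conj_conj]
    ring
  simp only [hre]
  have hint_conj : Integrable (fun ω => conj (g ω * conj (E ω))) P :=
    Complex.conjCLE.integrable_comp_iff.2 hint'
  rw [integral_div, integral_add hint hint_conj, hgE, hconj, add_zero, zero_div]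

variable [MeasurableSpace.CountablySeparated X] [NullSingletonClass μ] [SigmaFinite μ]

lemma re_ae_eq_zero_of_forall_inner_chaos (hP : HasPoissonCounts μ P) {g : Lp ℂ 2 P}
    (hg : ∀ n, ∀ F ∈ chaos μ P n, inner ℂ F g = 0) : (fun ν => (g ν).re) =ᵐ[P] 0 := by
  have := hP.isProbabilityMeasure
  have hg_int : Integrable g P := (Lp.memLp g).integrable one_le_two
  refine ae_eq_zero_of_integral_mul_prod_num hP.ae_N_eq hg_int.re fun m B hB v => ?_
  have hmoments (w : Fin m → ℂ) : HasAllMoments (fun ν => ∏ b, w b ^ num (B b) ν) P :=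
    HasAllMoments.prod fun b _ =>
      hP.hasAllMoments_pow_num (hB.measurableSet b) (hB.measure_lt_top b) (w b)
  have hint (w : Fin m → ℂ) : Integrable (fun ν => g ν * ∏ b, w b ^ num (B b) ν) P :=
    (Lp.memLp g).integrable_mul (hmoments w).memLp_two
  have hconj (ν : CountingMeasures X) :
      conj (∏ b, Complex.exp (v b * Complex.I) ^ num (B b) ν) =
        ∏ b, (conj (Complex.exp (v b * Complex.I))) ^ num (B b) ν := by
    simp only [map_prod, map_pow]
  refine integral_ofReal_re_mul_eq_zero (integral_prod_pow_num_mul_eq_zero hP hB _ hg) ?_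
    (hint _) ?_ <;> simp only [hconj]
  exacts [integral_prod_pow_num_mul_eq_zero hP hB _ hg, hint _]

theorem eq_zero_of_forall_inner_chaos (hP : HasPoissonCounts μ P) {g : Lp ℂ 2 P}
    (hg : ∀ n, ∀ F ∈ chaos μ P n, inner ℂ F g = 0) : g = 0 := by
  have him := re_ae_eq_zero_of_forall_inner_chaos hP (g := -Complex.I • g) fun n F hF => by
    rw [inner_smul_right, hg n F hF, mul_zero]
  rw [Lp.eq_zero_iff_ae_eq_zero]
  filter_upwards [re_ae_eq_zero_of_forall_inner_chaos hP hg, him,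
    Lp.coeFn_smul (-Complex.I) g] with ν hre him hsmul
  rw [hsmul] at him
  exact Complex.ext hre (by simpa using him)

end Totality

section Finsets

lemma prod_sum_eq_sum_powersetCard {R ι κ : Type*} [CommSemiring R] [Fintype ι] [Fintype κ]
    (S : κ → Finset ι) (hS : Pairwise fun i j => Disjoint (S i) (S j)) :
    ∃ a : Finset ι → R, ∀ x : ι → R, ∏ i, ∑ b ∈ S i, x b =
      ∑ s ∈ Finset.powersetCard (Fintype.card κ) Finset.univ, a s * ∏ b ∈ s, x b := by
  classical
  have hinj : ∀ φ ∈ Fintype.piFinset S, Function.Injective φ := by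
    intro φ hφ i j hij
    by_contra hne
    rw [Fintype.mem_piFinset] at hφ
    exact Finset.disjoint_left.1 (hS hne) (hφ i) (hij ▸ hφ j)
  refine ⟨fun s => ((Fintype.piFinset S).filter fun φ => Finset.univ.image φ = s).card,
    fun x => ?_⟩
  rw [Finset.prod_univ_sum, ← Finset.sum_fiberwise_of_maps_to
    (t := Finset.powersetCard (Fintype.card κ) Finset.univ)
    (g := fun φ : κ → ι => Finset.univ.image φ)]
  · refine Finset.sum_congr rfl fun s _ => ?_
    rw [← nsmul_eq_mul, ← Finset.sum_const]
    refine Finset.sum_congr rfl fun φ hφ => ?_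
    rw [Finset.mem_filter] at hφ
    rw [← hφ.2, Finset.prod_image fun i _ j _ h => hinj φ hφ.1 h]
  · intro φ hφ
    rw [Finset.mem_powersetCard]
    refine ⟨Finset.subset_univ _, ?_⟩
    rw [Finset.card_image_of_injective _ (hinj φ hφ), Finset.card_univ]

lemma disjoint_of_disjoint_biUnion {X ι : Type*} {B : ι → Set X} (hB : ∀ b, (B b).Nonempty)
    {S T : Finset ι} (h : Disjoint (⋃ b ∈ S, B b) (⋃ b ∈ T, B b)) : Disjoint S T :=
  Finset.disjoint_left.2 fun b hS hT =>
    let ⟨_, hx⟩ := hB b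
    disjoint_left.1 h (mem_biUnion hS hx) (mem_biUnion hT hx)

lemma exists_mem_symmDiff_notMem {ι : Type*} [DecidableEq ι] {s s' e : Finset ι} (hne : s ≠ s')
    (hcard : s.card = s'.card) (he : e.card ≤ 1) : ∃ b ∈ symmDiff s s', b ∉ e := by
  refine Finset.exists_mem_notMem_of_card_lt_card (he.trans_lt ?_)
  have hs : (s \ s').Nonempty := Finset.sdiff_nonempty.2 fun h =>
    hne (Finset.eq_of_subset_of_card_le h hcard.ge)
  have hs' : (s' \ s).Nonempty := Finset.sdiff_nonempty.2 fun h =>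
    hne (Finset.eq_of_subset_of_card_le h hcard.le).symm
  rw [symmDiff_def, Finset.sup_eq_union, Finset.card_union_of_disjoint disjoint_sdiff_sdiff]
  have := hs.card_pos
  have := hs'.card_pos
  omega

end Finsets

section Polynomials

variable {X : Type*} [MeasurableSpace X] {μ : Measure X} {P : Measure (CountingMeasures X)}

open scoped ComplexConjugate

/-- The linear span of the generators of the chaos of order `n`. -/
noncomputable def chaosSpan (μ : Measure X) (P : Measure (CountingMeasures X)) (n : ℕ) :
    Submodule ℂ (Lp ℂ 2 P) :=
  Submodule.span ℂ {F : Lp ℂ 2 P | ∃ A : Fin n → Set X,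
    (∀ i, MeasurableSet (A i)) ∧ Pairwise (fun i j => Disjoint (A i) (A j)) ∧
    (∀ i, μ (A i) < ∞) ∧
    F =ᵐ[P] fun ν => ∏ i, (((N (A i) ν).toReal - (μ (A i)).toReal : ℝ) : ℂ)}

/-- The homogeneous multiaffine polynomial of degree `n` with coefficients `a` in the compensated
variables of the family `B`. -/
noncomputable def ctrPoly (μ : Measure X) {ι : Type*} [Fintype ι] (B : ι → Set X) (n : ℕ)
    (a : Finset ι → ℂ) (ν : CountingMeasures X) : ℂ :=
  ∑ s ∈ Finset.powersetCard n Finset.univ, a s * ∏ b ∈ s, (ctr μ (B b) ν : ℂ)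

lemma exists_prod_ctr_eq_ctrPoly {ι κ : Type*} [Fintype ι] [Fintype κ] {B : ι → Set X}
    (hB : IsDisjointFamily μ B) (hBn : ∀ b, (B b).Nonempty) {D : κ → Set X}
    (hD : Pairwise fun i j => Disjoint (D i) (D j)) {S : κ → Finset ι}
    (hS : ∀ i, D i = ⋃ b ∈ S i, B b) :
    ∃ a : Finset ι → ℂ, ∀ ν, (∀ b, N (B b) ν = num (B b) ν) →
      ∏ i, (ctr μ (D i) ν : ℂ) = ctrPoly μ B (Fintype.card κ) a ν := by
  obtain ⟨a, ha⟩ := prod_sum_eq_sum_powersetCard (R := ℂ) S fun i j hij =>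
    disjoint_of_disjoint_biUnion hBn (by simpa only [hS] using hD hij)
  refine ⟨a, fun ν hν => ?_⟩
  rw [ctrPoly, ← ha]
  refine Finset.prod_congr rfl fun i _ => ?_
  rw [hS i, ctr_biUnion hB _ hν, Complex.ofReal_sum]

/-- The set `A` is decomposed along with the sets occurring in `F`, so that weighting by `N A` can
be computed on the same polynomial. -/
lemma exists_eq_ctrPoly_of_mem_chaosSpan (hP : HasPoissonCounts μ P) {n : ℕ} {F : Lp ℂ 2 P}
    (hF : F ∈ chaosSpan μ P n) {A : Set X} (hA : MeasurableSet A) (hfin : μ A < ∞) :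
    ∃ (m : ℕ) (B : Fin m → Set X) (S : Finset (Fin m)) (a : Finset (Fin m) → ℂ),
      IsDisjointFamily μ B ∧ A = ⋃ b ∈ S, B b ∧ F =ᵐ[P] ctrPoly μ B n a := by
  obtain ⟨L, c, G, rfl⟩ := Submodule.mem_span_set'.1 hF
  choose D hDm hDd hDf hDG using fun l => (G l).2
  obtain ⟨m, B, S, hB, hBn, hS⟩ := exists_atoms (μ := μ)
    (fun k : Option (Fin L × Fin n) => k.elim A fun j => D j.1 j.2)
    (by rintro (_ | j); exacts [hA, hDm _ _]) (by rintro (_ | j); exacts [hfin, hDf _ _])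
  choose a ha using fun l =>
    exists_prod_ctr_eq_ctrPoly hB hBn (hDd l) fun i => hS (some (l, i))
  rw [Fintype.card_fin] at ha
  refine ⟨m, B, S none, fun s => ∑ l, c l * a l s, hB, hS none, ?_⟩
  have hsmul : ∀ᵐ ν ∂P, ∀ l, (c l • (G l : Lp ℂ 2 P)) ν = c l * ∏ i, (ctr μ (D l i) ν : ℂ) := by
    refine ae_all_iff.2 fun l => ?_
    filter_upwards [Lp.coeFn_smul (c l) (G l : Lp ℂ 2 P), hDG l] with ν hsmul hprod
    rw [hsmul, Pi.smul_apply, hprod, smul_eq_mul]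
    rfl
  filter_upwards [hsmul, Lp.coeFn_finsetSum Finset.univ fun l => c l • (G l : Lp ℂ 2 P),
    hP.ae_N_eq.ae_forall hB] with ν hsmul hsum hν
  simp only [hsum, Finset.sum_apply, hsmul, ha _ ν hν, ctrPoly, Finset.sum_mul, Finset.mul_sum,
    mul_assoc]
  exact Finset.sum_comm

variable {ι : Type} {B : ι → Set X}

lemma hasAllMoments_ctrPoly [Fintype ι] (hP : HasPoissonCounts μ P)
    (hB : IsDisjointFamily μ B) (n : ℕ)
    (a : Finset ι → ℂ) : HasAllMoments (ctrPoly μ B n a) P := by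
  have hprob := hP.isProbabilityMeasure
  exact HasAllMoments.sum fun s _ =>
    (HasAllMoments.const (a s)).mul (hP.hasAllMoments_prod_ctr hB s)

lemma integral_prod_ctr_mul_eq_prod [Fintype ι] [DecidableEq ι] (hP : HasPoissonCounts μ P)
    (hB : IsDisjointFamily μ B)
    (s s' e : Finset ι) :
    ∫ ν, (∏ b ∈ s, (ctr μ (B b) ν : ℂ)) * (∏ b ∈ s', (ctr μ (B b) ν : ℂ)) *
      (∏ b ∈ e, (num (B b) ν : ℂ)) ∂P =
    ∏ b, ∫ k : ℕ, (if b ∈ s then (k : ℂ) - (μ (B b)).toNNReal else 1) *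
      (if b ∈ s' then (k : ℂ) - (μ (B b)).toNNReal else 1) *
      (if b ∈ e then (k : ℂ) else 1) ∂(poissonMeasure (μ (B b)).toNNReal) := by
  rw [← hP.integral_prod_comp_num hB fun b k =>
    (if b ∈ s then (k : ℂ) - (μ (B b)).toNNReal else 1) *
      (if b ∈ s' then (k : ℂ) - (μ (B b)).toNNReal else 1) * (if b ∈ e then (k : ℂ) else 1)]
  refine integral_congr_ae ?_
  filter_upwards [ae_all_iff.2 fun b =>
    hP.ae_ctr_eq (hB.measurableSet b) (hB.measure_lt_top b)] with ν hν
  simp only [Finset.prod_mul_distrib, Finset.prod_ite_mem, Finset.univ_inter, hν]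

lemma integral_prod_ctr_mul_self [Finite ι] [DecidableEq ι] (hP : HasPoissonCounts μ P)
    (hB : IsDisjointFamily μ B)
    (s e : Finset ι) :
    ∫ ν, (∏ b ∈ s, (ctr μ (B b) ν : ℂ)) * (∏ b ∈ s, (ctr μ (B b) ν : ℂ)) *
      (∏ b ∈ e, (num (B b) ν : ℂ)) ∂P = (∏ b ∈ s, ((μ.real (B b) : ℝ) : ℂ)) *
        ∏ b ∈ e, (((μ.real (B b) : ℝ) : ℂ) + if b ∈ s then 1 else 0) := by
  have := Fintype.ofFinite ι
  have hprod : ∀ (t : Finset ι) (f : ι → ℂ), ∏ b ∈ t, f b = ∏ b, if b ∈ t then f b else 1 :=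
    fun t f => by rw [Finset.prod_ite_mem, Finset.univ_inter]
  rw [integral_prod_ctr_mul_eq_prod hP hB, hprod s, hprod e, ← Finset.prod_mul_distrib]
  refine Finset.prod_congr rfl fun b _ => ?_
  have hreal : ((μ.real (B b) : ℝ) : ℂ) = (μ (B b)).toNNReal := rfl
  rw [hreal]
  by_cases hs : b ∈ s <;> by_cases he : b ∈ e <;> simp only [hs, he, if_true, if_false]
  · exact integral_poissonMeasure_centered_sq_mul _
  · simpa using integral_poissonMeasure_centered_sq _
  · simpa using integral_poissonMeasure_natCast _
  · simp

lemma integral_prod_ctr_mul_of_ne [Finite ι] (hP : HasPoissonCounts μ P)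
    (hB : IsDisjointFamily μ B)
    {s s' e : Finset ι} (hne : s ≠ s') (hcard : s.card = s'.card) (he : e.card ≤ 1) :
    ∫ ν, (∏ b ∈ s, (ctr μ (B b) ν : ℂ)) * (∏ b ∈ s', (ctr μ (B b) ν : ℂ)) *
      (∏ b ∈ e, (num (B b) ν : ℂ)) ∂P = 0 := by
  classical
  have := Fintype.ofFinite ι
  obtain ⟨b, hb, hbe⟩ := exists_mem_symmDiff_notMem hne hcard he
  rw [integral_prod_ctr_mul_eq_prod hP hB]
  refine Finset.prod_eq_zero (Finset.mem_univ b) ?_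
  rcases Finset.mem_symmDiff.1 hb with ⟨hs, hs'⟩ | ⟨hs', hs⟩ <;>
    simpa only [hs, hs', hbe, if_true, if_false, mul_one, one_mul] using
      integral_poissonMeasure_centered _

lemma integral_normSq_ctrPoly_mul [Fintype ι] [DecidableEq ι] (hP : HasPoissonCounts μ P)
    (hB : IsDisjointFamily μ B) (n : ℕ)
    (a : Finset ι → ℂ) {e : Finset ι} (he : e.card ≤ 1) :
    ∫ ν, conj (ctrPoly μ B n a ν) * ctrPoly μ B n a ν * (∏ b ∈ e, (num (B b) ν : ℂ)) ∂P =
      ∑ s ∈ Finset.powersetCard n Finset.univ, conj (a s) * a s *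
        ((∏ b ∈ s, ((μ.real (B b) : ℝ) : ℂ)) *
          ∏ b ∈ e, (((μ.real (B b) : ℝ) : ℂ) + if b ∈ s then 1 else 0)) := by
  have hprob := hP.isProbabilityMeasure
  have hint : ∀ s s' : Finset ι, Integrable (fun ν => (∏ b ∈ s, (ctr μ (B b) ν : ℂ)) *
      (∏ b ∈ s', (ctr μ (B b) ν : ℂ)) * (∏ b ∈ e, (num (B b) ν : ℂ))) P := fun s s' =>
    (((hP.hasAllMoments_prod_ctr hB s).mul (hP.hasAllMoments_prod_ctr hB s')).mul
      (HasAllMoments.prod fun b _ =>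
        hP.hasAllMoments_num (hB.measurableSet b) (hB.measure_lt_top b))).integrable
  have hexpand : ∀ ν, conj (ctrPoly μ B n a ν) * ctrPoly μ B n a ν *
      (∏ b ∈ e, (num (B b) ν : ℂ)) =
      ∑ s ∈ Finset.powersetCard n Finset.univ, ∑ s' ∈ Finset.powersetCard n Finset.univ,
        conj (a s) * a s' * ((∏ b ∈ s, (ctr μ (B b) ν : ℂ)) *
          (∏ b ∈ s', (ctr μ (B b) ν : ℂ)) * (∏ b ∈ e, (num (B b) ν : ℂ))) := fun ν => by
    rw [ctrPoly, map_sum, Finset.sum_mul_sum, Finset.sum_mul]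
    refine Finset.sum_congr rfl fun s _ => ?_
    rw [Finset.sum_mul]
    refine Finset.sum_congr rfl fun s' _ => ?_
    simp only [map_mul, map_prod, Complex.conj_ofReal]
    ring
  simp only [hexpand]
  rw [integral_finsetSum _ fun s _ => integrable_finsetSum _ fun s' _ => (hint s s').const_mul _]
  refine Finset.sum_congr rfl fun s hs => ?_
  rw [integral_finsetSum _ fun s' _ => (hint s s').const_mul _, Finset.sum_eq_single s]
  · rw [integral_const_mul, integral_prod_ctr_mul_self hP hB]
  · intro s' hs' hne
    rw [Finset.mem_powersetCard] at hs hs'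
    rw [integral_const_mul, integral_prod_ctr_mul_of_ne hP hB hne.symm (hs.2.trans hs'.2.symm) he,
      mul_zero]
  · exact fun h => absurd hs h

end Polynomials

section SquareIntegrable

variable {Ω : Type*} {mΩ : MeasurableSpace Ω} {ρ P : Measure Ω}

open scoped ComplexConjugate

lemma inner_self_eq_ofReal {E : Type*} [NormedAddCommGroup E] [InnerProductSpace ℂ E] (x : E) :
    inner ℂ x x = ((‖x‖ ^ 2 : ℝ) : ℂ) := by
  rw [Complex.ofReal_pow]
  exact inner_self_eq_norm_sq_to_K x

lemma norm_toLp_sq {F : Ω → ℂ} (hF : MemLp F 2 ρ) :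
    ‖hF.toLp F‖ ^ 2 = ∫ ω, ‖F ω‖ ^ 2 ∂ρ := by
  have h := inner_self_eq_ofReal (hF.toLp F)
  rw [inner_toLp] at h
  simp only [Complex.conj_mul', ← Complex.ofReal_pow] at h
  rw [integral_complex_ofReal] at h
  exact_mod_cast h.symm

lemma norm_sq_eq_integral_of_ae_eq {F : Lp ℂ 2 ρ} {G : Ω → ℂ} (h : F =ᵐ[ρ] G) :
    ‖F‖ ^ 2 = ∫ ω, ‖G ω‖ ^ 2 ∂ρ := by
  have hF := norm_toLp_sq (Lp.memLp F)
  rw [Lp.toLp_coeFn] at hF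
  exact hF.trans (integral_congr_ae (h.mono fun _ h => by simp only [h]))

lemma norm_toLp_sq_eq_lintegral {F : Ω → ℂ} (hF : MemLp F 2 ρ) :
    ‖hF.toLp F‖ ^ 2 = (∫⁻ ω, ‖F ω‖ₑ ^ 2 ∂ρ).toReal := by
  have hm : AEStronglyMeasurable (fun ω => ‖F ω‖ ^ 2) ρ := hF.aestronglyMeasurable.norm.pow 2
  rw [norm_toLp_sq, integral_eq_lintegral_of_nonneg_ae (Filter.Eventually.of_forall fun ω => by
    positivity) hm]
  congr 1
  refine lintegral_congr fun ω => ?_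
  rw [ENNReal.ofReal_pow (norm_nonneg _), ofReal_norm]

lemma isClosed_eLpNorm_le (hρ : ρ ≪ P) (C : ℝ) :
    IsClosed {F : Lp ℂ 2 P | eLpNorm F 2 ρ ≤ ENNReal.ofReal (C * ‖F‖)} := by
  refine IsSeqClosed.isClosed fun F G hF hFG => ?_
  obtain ⟨k, hk, hae⟩ := (tendstoInMeasure_of_tendsto_Lp hFG).exists_seq_tendsto_ae
  have hfatou := Lp.eLpNorm_lim_le_liminf_eLpNorm (p := 2) (μ := ρ) (f := fun n => F (k n))
    (fun n => (Lp.aestronglyMeasurable _).mono_ac hρ) G (hρ.ae_le hae)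
  refine hfatou.trans ?_
  have hlim : Filter.Tendsto (fun n => ENNReal.ofReal (C * ‖F (k n)‖)) Filter.atTop
      (nhds (ENNReal.ofReal (C * ‖G‖))) :=
    ENNReal.tendsto_ofReal ((hFG.norm.const_mul C).comp hk.tendsto_atTop)
  rw [← hlim.liminf_eq]
  exact Filter.liminf_le_liminf (Filter.Eventually.of_forall fun n => hF (k n))

end SquareIntegrable

section Weighted

variable {X : Type*} [MeasurableSpace X] {μ : Measure X} {P : Measure (CountingMeasures X)}

open scoped ComplexConjugate

/-- The measure with density `N A` with respect to `P`. -/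
noncomputable def weighted (P : Measure (CountingMeasures X)) (A : Set X) :
    Measure (CountingMeasures X) :=
  P.withDensity (N A)

lemma weighted_ac (A : Set X) : weighted P A ≪ P := withDensity_absolutelyContinuous _ _

lemma HasPoissonCounts.ae_N_lt_top (hP : HasPoissonCounts μ P) {A : Set X} (hA : MeasurableSet A)
    (hfin : μ A < ∞) : ∀ᵐ ν ∂P, N A ν < ∞ := by
  filter_upwards [hP.ae_N_eq A hA hfin] with ν hν
  rw [hν]
  exact ENNReal.natCast_lt_top _

lemma HasPoissonCounts.integral_weighted (hP : HasPoissonCounts μ P) {A : Set X}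
    (hA : MeasurableSet A) (hfin : μ A < ∞) (f : CountingMeasures X → ℝ) :
    ∫ ν, f ν ∂(weighted P A) = ∫ ν, f ν * num A ν ∂P := by
  rw [weighted, integral_withDensity_eq_integral_toReal_smul (measurable_N hA)
    (hP.ae_N_lt_top hA hfin)]
  refine integral_congr_ae ?_
  filter_upwards [hP.ae_N_eq A hA hfin] with ν hν
  rw [hν, smul_eq_mul, mul_comm, ENNReal.toReal_natCast]

lemma integral_norm_sq_weighted_congr {A : Set X} {F G : CountingMeasures X → ℂ} (h : F =ᵐ[P] G) :
    ∫ ν, ‖F ν‖ ^ 2 ∂(weighted P A) = ∫ ν, ‖G ν‖ ^ 2 ∂(weighted P A) :=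
  integral_congr_ae <| (weighted_ac A).ae_le <| h.mono fun _ h => by simp only [h]

lemma HasPoissonCounts.memLp_weighted (hP : HasPoissonCounts μ P) {A : Set X}
    (hA : MeasurableSet A) (hfin : μ A < ∞) {F : CountingMeasures X → ℂ}
    (hF : HasAllMoments F P) : MemLp F 2 (weighted P A) := by
  rw [memLp_two_iff_integrable_sq_norm (hF.integrable.aestronglyMeasurable.mono_ac (weighted_ac A)),
    weighted, integrable_withDensity_iff_integrable_smul₀' (measurable_N hA).aemeasurable
      (hP.ae_N_lt_top hA hfin)]
  have h := ((hF.mul hF).mul (hP.hasAllMoments_num hA hfin)).integrable.norm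
  refine h.congr ?_
  filter_upwards [hP.ae_N_eq A hA hfin] with ν hν
  rw [hν]
  simp only [norm_mul, Complex.norm_natCast, smul_eq_mul, ENNReal.toReal_natCast]
  ring

lemma hasAllMoments_of_mem_chaosSpan (hP : HasPoissonCounts μ P) {n : ℕ} {F : Lp ℂ 2 P}
    (hF : F ∈ chaosSpan μ P n) : HasAllMoments F P := by
  obtain ⟨m, B, S, a, hB, -, hFa⟩ :=
    exists_eq_ctrPoly_of_mem_chaosSpan hP hF MeasurableSet.empty (by simp)
  exact (hasAllMoments_ctrPoly hP hB n a).congr hFa.symm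

variable {ι : Type} [Fintype ι] {B : ι → Set X}

lemma integral_norm_sq_ctrPoly (hP : HasPoissonCounts μ P) (hB : IsDisjointFamily μ B) (n : ℕ)
    (a : Finset ι → ℂ) : ∫ ν, ‖ctrPoly μ B n a ν‖ ^ 2 ∂P =
      ∑ s ∈ Finset.powersetCard n Finset.univ, ‖a s‖ ^ 2 * ∏ b ∈ s, μ.real (B b) := by
  classical
  have h := integral_normSq_ctrPoly_mul hP hB n a (e := ∅) (by simp)
  simp only [Finset.prod_empty, mul_one, Complex.conj_mul', ← Complex.ofReal_pow] at h
  rw [integral_complex_ofReal] at h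
  exact_mod_cast h

lemma integral_norm_sq_ctrPoly_mul_num [DecidableEq ι] (hP : HasPoissonCounts μ P)
    (hB : IsDisjointFamily μ B) (n : ℕ) (a : Finset ι → ℂ) (b : ι) :
    ∫ ν, ‖ctrPoly μ B n a ν‖ ^ 2 * num (B b) ν ∂P =
      ∑ s ∈ Finset.powersetCard n Finset.univ, ‖a s‖ ^ 2 * (∏ b ∈ s, μ.real (B b)) *
        (μ.real (B b) + if b ∈ s then 1 else 0) := by
  have h := integral_normSq_ctrPoly_mul hP hB n a (e := {b}) (by simp)
  simp only [Finset.prod_singleton, Complex.conj_mul', ← Complex.ofReal_pow,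
    ← Complex.ofReal_natCast, ← Complex.ofReal_mul] at h
  rw [integral_complex_ofReal] at h
  simp only [mul_assoc]
  refine Complex.ofReal_injective (h.trans ?_)
  push_cast
  simp only [apply_ite (Complex.ofReal), Complex.ofReal_one, Complex.ofReal_zero]

lemma integral_norm_sq_ctrPoly_weighted [DecidableEq ι] (hP : HasPoissonCounts μ P)
    (hB : IsDisjointFamily μ B) (n : ℕ) (a : Finset ι → ℂ) (S : Finset ι) :
    ∫ ν, ‖ctrPoly μ B n a ν‖ ^ 2 ∂(weighted P (⋃ b ∈ S, B b)) =
      ∑ s ∈ Finset.powersetCard n Finset.univ,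
        ‖a s‖ ^ 2 * (∏ b ∈ s, μ.real (B b)) * (μ.real (⋃ b ∈ S, B b) + (s ∩ S).card) := by
  have hreal : μ.real (⋃ b ∈ S, B b) = ∑ b ∈ S, μ.real (B b) :=
    measureReal_biUnion_finset (fun _ _ _ _ h => hB.disjoint h) (fun b _ => hB.measurableSet b)
      (fun b _ => (hB.measure_lt_top b).ne)
  have hcard : ∀ s : Finset ι, ((s ∩ S).card : ℝ) = ∑ b ∈ S, if b ∈ s then (1 : ℝ) else 0 :=
    fun s => by rw [Finset.sum_boole, Finset.filter_mem_eq_inter, Finset.inter_comm]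
  have hint : ∀ b ∈ S, Integrable (fun ν => ‖ctrPoly μ B n a ν‖ ^ 2 * num (B b) ν) P := by
    intro b _
    have hpoly := hasAllMoments_ctrPoly hP hB n a
    refine ((hpoly.mul hpoly).mul
      (hP.hasAllMoments_num (hB.measurableSet b) (hB.measure_lt_top b))).integrable.norm.congr ?_
    exact Filter.Eventually.of_forall fun ν => by
      simp only [norm_mul, Complex.norm_natCast, sq]
  rw [hP.integral_weighted (S.measurableSet_biUnion fun b _ => hB.measurableSet b)
    (hB.measure_biUnion_lt_top S)]
  calc ∫ ν, ‖ctrPoly μ B n a ν‖ ^ 2 * num (⋃ b ∈ S, B b) ν ∂P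
      = ∫ ν, ∑ b ∈ S, ‖ctrPoly μ B n a ν‖ ^ 2 * num (B b) ν ∂P := by
        refine integral_congr_ae ?_
        filter_upwards [hP.ae_N_eq.ae_forall hB] with ν hν
        rw [num_biUnion hB S hν, Nat.cast_sum, Finset.mul_sum]
    _ = ∑ b ∈ S, ∑ s ∈ Finset.powersetCard n Finset.univ, ‖a s‖ ^ 2 * (∏ b ∈ s, μ.real (B b)) *
          (μ.real (B b) + if b ∈ s then 1 else 0) := by
        rw [integral_finsetSum _ hint]
        exact Finset.sum_congr rfl fun b _ => integral_norm_sq_ctrPoly_mul_num hP hB n a b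
    _ = _ := by
        rw [Finset.sum_comm]
        simp only [← Finset.mul_sum, Finset.sum_add_distrib, hreal, hcard]

lemma weighted_bounds_of_mem_chaosSpan (hP : HasPoissonCounts μ P) {n : ℕ} {F : Lp ℂ 2 P}
    (hF : F ∈ chaosSpan μ P n) {A : Set X} (hA : MeasurableSet A) (hfin : μ A < ∞) :
    μ.real A * ‖F‖ ^ 2 ≤ ∫ ν, ‖F ν‖ ^ 2 ∂(weighted P A) ∧
      ∫ ν, ‖F ν‖ ^ 2 ∂(weighted P A) ≤ (μ.real A + n) * ‖F‖ ^ 2 := by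
  classical
  obtain ⟨m, B, S, a, hB, rfl, hFa⟩ := exists_eq_ctrPoly_of_mem_chaosSpan hP hF hA hfin
  rw [integral_norm_sq_weighted_congr hFa, integral_norm_sq_ctrPoly_weighted hP hB,
    norm_sq_eq_integral_of_ae_eq hFa, integral_norm_sq_ctrPoly hP hB, Finset.mul_sum,
    Finset.mul_sum]
  have hnonneg : ∀ s, 0 ≤ ‖a s‖ ^ 2 * ∏ b ∈ s, μ.real (B b) := fun s =>
    mul_nonneg (by positivity) (Finset.prod_nonneg fun b _ => measureReal_nonneg)
  refine ⟨Finset.sum_le_sum fun s _ => ?_, Finset.sum_le_sum fun s hs => ?_⟩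
  · rw [mul_comm]
    exact mul_le_mul_of_nonneg_left (by simp) (hnonneg s)
  · rw [mul_comm (_ + _)]
    refine mul_le_mul_of_nonneg_left ?_ (hnonneg s)
    have hcard : (s ∩ S).card ≤ n :=
      (Finset.card_le_card Finset.inter_subset_left).trans (Finset.mem_powersetCard.1 hs).2.le
    gcongr

lemma exists_weighted_eq_of_mem_chaosSpan (hP : HasPoissonCounts μ P) {n : ℕ} {F : Lp ℂ 2 P}
    (hF : F ∈ chaosSpan μ P n) : ∃ A, MeasurableSet A ∧ μ A < ∞ ∧
      ∫ ν, ‖F ν‖ ^ 2 ∂(weighted P A) = (μ.real A + n) * ‖F‖ ^ 2 := by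
  classical
  obtain ⟨m, B, -, a, hB, -, hFa⟩ :=
    exists_eq_ctrPoly_of_mem_chaosSpan hP hF MeasurableSet.empty (by simp)
  refine ⟨⋃ b ∈ Finset.univ, B b, Finset.univ.measurableSet_biUnion fun b _ => hB.measurableSet b,
    hB.measure_biUnion_lt_top _, ?_⟩
  rw [integral_norm_sq_weighted_congr hFa, integral_norm_sq_ctrPoly_weighted hP hB,
    norm_sq_eq_integral_of_ae_eq hFa, integral_norm_sq_ctrPoly hP hB, Finset.mul_sum]
  refine Finset.sum_congr rfl fun s hs => ?_
  rw [Finset.inter_univ, (Finset.mem_powersetCard.1 hs).2]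
  ring

lemma eLpNorm_weighted_le (hP : HasPoissonCounts μ P) {n : ℕ} {F : Lp ℂ 2 P}
    (hF : F ∈ chaos μ P n) {A : Set X} (hA : MeasurableSet A) (hfin : μ A < ∞) :
    eLpNorm F 2 (weighted P A) ≤ ENNReal.ofReal (√(μ.real A + n) * ‖F‖) := by
  refine closure_minimal (s := (chaosSpan μ P n : Set (Lp ℂ 2 P))) ?_
    (isClosed_eLpNorm_le (weighted_ac A) _) hF
  intro G hG
  have hM := hP.memLp_weighted hA hfin (hasAllMoments_of_mem_chaosSpan hP hG)
  rw [mem_ofPred_eq, ENNReal.le_ofReal_iff_toReal_le hM.eLpNorm_ne_top (by positivity),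
    ← Lp.norm_toLp _ hM]
  refine le_of_sq_le_sq ?_ (by positivity)
  rw [mul_pow, Real.sq_sqrt (by positivity), norm_toLp_sq]
  exact (weighted_bounds_of_mem_chaosSpan hP hG hA hfin).2

lemma memLp_weighted_of_mem_chaos (hP : HasPoissonCounts μ P) {n : ℕ} {F : Lp ℂ 2 P}
    (hF : F ∈ chaos μ P n) {A : Set X} (hA : MeasurableSet A) (hfin : μ A < ∞) :
    MemLp F 2 (weighted P A) :=
  ⟨(Lp.aestronglyMeasurable F).mono_ac (weighted_ac A),
    (eLpNorm_weighted_le hP hF hA hfin).trans_lt ENNReal.ofReal_lt_top⟩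

/-- The inclusion of the chaos of order `n` in the weighted `L²` space. -/
noncomputable def chaosToWeighted (hP : HasPoissonCounts μ P) (n : ℕ) {A : Set X}
    (hA : MeasurableSet A) (hfin : μ A < ∞) : chaos μ P n →L[ℂ] Lp ℂ 2 (weighted P A) :=
  LinearMap.mkContinuous
    { toFun := fun F => (memLp_weighted_of_mem_chaos hP F.2 hA hfin).toLp F
      map_add' := fun F G => by
        rw [← MemLp.toLp_add]
        exact MemLp.toLp_congr _ _ ((weighted_ac A).ae_le (Lp.coeFn_add F.1 G.1))
      map_smul' := fun c F => by
        rw [RingHom.id_apply, ← MemLp.toLp_const_smul]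
        exact MemLp.toLp_congr _ _ ((weighted_ac A).ae_le (Lp.coeFn_smul c F.1)) }
    √(μ.real A + n) (fun F => by
      refine (Lp.norm_toLp _ (memLp_weighted_of_mem_chaos hP F.2 hA hfin)).trans_le ?_
      exact ENNReal.toReal_le_of_le_ofReal (by positivity) (eLpNorm_weighted_le hP F.2 hA hfin))

lemma dense_chaosSpan (n : ℕ) :
    Dense {F : chaos μ P n | (F : Lp ℂ 2 P) ∈ chaosSpan μ P n} := by
  intro F
  have hF : (F : Lp ℂ 2 P) ∈ closure (chaosSpan μ P n : Set (Lp ℂ 2 P)) := F.2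
  rw [closure_subtype]
  convert hF
  ext G
  constructor
  · rintro ⟨H, hH, rfl⟩
    exact hH
  · exact fun hG => ⟨⟨G, Submodule.le_topologicalClosure _ hG⟩, hG, rfl⟩

lemma norm_chaosToWeighted_sq (hP : HasPoissonCounts μ P) {n : ℕ} {A : Set X}
    (hA : MeasurableSet A) (hfin : μ A < ∞) (F : chaos μ P n) :
    ‖chaosToWeighted hP n hA hfin F‖ ^ 2 = ∫ ν, ‖(F : Lp ℂ 2 P) ν‖ ^ 2 ∂(weighted P A) :=
  norm_toLp_sq (memLp_weighted_of_mem_chaos hP F.2 hA hfin)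

lemma weighted_bounds_of_mem_chaos (hP : HasPoissonCounts μ P) {n : ℕ} (F : chaos μ P n)
    {A : Set X} (hA : MeasurableSet A) (hfin : μ A < ∞) :
    μ.real A * ‖F‖ ^ 2 ≤ ‖chaosToWeighted hP n hA hfin F‖ ^ 2 ∧
      ‖chaosToWeighted hP n hA hfin F‖ ^ 2 ≤ (μ.real A + n) * ‖F‖ ^ 2 := by
  have hJ : Continuous fun F : chaos μ P n => ‖chaosToWeighted hP n hA hfin F‖ ^ 2 := by fun_prop
  have hnorm : ∀ c : ℝ, Continuous fun F : chaos μ P n => c * ‖F‖ ^ 2 := fun c => by fun_prop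
  refine closure_minimal (s := {G : chaos μ P n | (G : Lp ℂ 2 P) ∈ chaosSpan μ P n}) ?_
    ((isClosed_le (hnorm (μ.real A)) hJ).inter (isClosed_le hJ (hnorm (μ.real A + n))))
    (dense_chaosSpan n F)
  intro G hG
  have hbounds := weighted_bounds_of_mem_chaosSpan hP hG hA hfin
  rw [← norm_chaosToWeighted_sq hP hA hfin] at hbounds
  exact hbounds

lemma norm_chaosToWeighted_sq_of_lintegral_eq (hP : HasPoissonCounts μ P) {n : ℕ} {A : Set X}
    (hA : MeasurableSet A) (hfin : μ A < ∞) {F : chaos μ P n}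
    (h : ∫⁻ ν, ‖(F : Lp ℂ 2 P) ν‖ₑ ^ 2 ∂(weighted P A) =
      μ A * ∫⁻ ν, ‖(F : Lp ℂ 2 P) ν‖ₑ ^ 2 ∂P) :
    ‖chaosToWeighted hP n hA hfin F‖ ^ 2 = μ.real A * ‖F‖ ^ 2 := by
  have hF := norm_toLp_sq_eq_lintegral (Lp.memLp (F : Lp ℂ 2 P))
  rw [Lp.toLp_coeFn] at hF
  calc ‖chaosToWeighted hP n hA hfin F‖ ^ 2
      = (∫⁻ ν, ‖(F : Lp ℂ 2 P) ν‖ₑ ^ 2 ∂(weighted P A)).toReal :=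
        norm_toLp_sq_eq_lintegral (memLp_weighted_of_mem_chaos hP F.2 hA hfin)
    _ = μ.real A * ‖F‖ ^ 2 := by
        rw [h, ENNReal.toReal_mul]
        exact congrArg _ hF.symm

lemma norm_sq_le_of_parallelogram {E E' : Type*} [NormedAddCommGroup E] [InnerProductSpace ℂ E]
    [NormedAddCommGroup E'] [InnerProductSpace ℂ E'] (J : E →L[ℂ] E') {c d : ℝ} (hd : 0 < d)
    (hJ : ∀ x, c * ‖x‖ ^ 2 ≤ ‖J x‖ ^ 2 ∧ ‖J x‖ ^ 2 ≤ (c + d) * ‖x‖ ^ 2) {f g : E}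
    (hf : ‖J f‖ ^ 2 = c * ‖f‖ ^ 2) (hg : ‖J g‖ ^ 2 = (c + d) * ‖g‖ ^ 2) :
    ‖g‖ ^ 2 ≤ 2 * ‖g - f‖ ^ 2 := by
  have hadd : f + (g - f) = g := by abel
  have hsub : f - (g - f) = (2 : ℂ) • f - g := by rw [two_smul]; abel
  have hlaw := parallelogram_law_with_norm ℂ f (g - f)
  have hlawJ := parallelogram_law_with_norm ℂ (J f) (J (g - f))
  rw [← map_add, ← map_sub, hadd, hsub] at hlawJ
  rw [hadd, hsub] at hlaw
  have hlaw' : c * (‖g‖ ^ 2 + ‖(2 : ℂ) • f - g‖ ^ 2) = c * (2 * (‖f‖ ^ 2 + ‖g - f‖ ^ 2)) := by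
    simpa only [sq] using congrArg (c * ·) hlaw
  refine le_of_mul_le_mul_left ?_ hd
  nlinarith [(hJ (g - f)).2, (hJ ((2 : ℂ) • f - g)).1]

/-- Weighting by `N A` multiplies `‖F‖²` by `μ A`, whereas for polynomials `g` in variables
contained in `A` it multiplies `‖g‖²` by `μ A + n`. Since these are the extreme values of the
quadratic form, `g` cannot be close to `F`. -/
theorem eq_zero_of_lintegral_weighted (hP : HasPoissonCounts μ P) {n : ℕ} (hn : n ≠ 0)
    {F : Lp ℂ 2 P} (hF : F ∈ chaos μ P n)
    (h : ∀ A, MeasurableSet A → μ A < ∞ →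
      ∫⁻ ν, ‖F ν‖ₑ ^ 2 ∂(weighted P A) = μ A * ∫⁻ ν, ‖F ν‖ₑ ^ 2 ∂P) : F = 0 := by
  let f : chaos μ P n := ⟨F, hF⟩
  have hspan : ∀ g : chaos μ P n, (g : Lp ℂ 2 P) ∈ chaosSpan μ P n →
      ‖g‖ ^ 2 ≤ 2 * ‖g - f‖ ^ 2 := by
    intro g hg
    obtain ⟨A, hA, hfin, hAg⟩ := exists_weighted_eq_of_mem_chaosSpan hP hg
    exact norm_sq_le_of_parallelogram (chaosToWeighted hP n hA hfin)
      (Nat.cast_pos.2 (Nat.pos_of_ne_zero hn))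
      (fun x => weighted_bounds_of_mem_chaos hP x hA hfin)
      (norm_chaosToWeighted_sq_of_lintegral_eq hP hA hfin (h A hA hfin))
      ((norm_chaosToWeighted_sq hP hA hfin g).trans hAg)
  have hchaos : ∀ g : chaos μ P n, ‖g‖ ^ 2 ≤ 2 * ‖g - f‖ ^ 2 := fun g =>
    closure_minimal (fun g hg => hspan g hg)
      (isClosed_le (f := fun g : chaos μ P n => ‖g‖ ^ 2) (by fun_prop) (by fun_prop))
      (dense_chaosSpan n g)
  have hf : ‖f‖ ^ 2 ≤ 0 := by simpa using hchaos f
  exact congrArg Subtype.val (norm_eq_zero.1 (sq_eq_zero_iff.1 (hf.antisymm (sq_nonneg _))))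

end Weighted

section CondExp

variable {Ω : Type*} {C mΩ : MeasurableSpace Ω} {P : Measure Ω}

lemma condExpL2_eq_self (hm : C ≤ mΩ) {F : Lp ℂ 2 P} (hF : AEStronglyMeasurable[C] F P) :
    (condExpL2 ℂ ℂ hm F : Lp ℂ 2 P) = F := by
  have : Fact (C ≤ mΩ) := ⟨hm⟩
  exact Submodule.starProjection_eq_self_iff.2 (mem_lpMeas_iff_aestronglyMeasurable.2 hF)

lemma aestronglyMeasurable_component (hm : C ≤ mΩ) {H : Submodule ℂ (Lp ℂ 2 P)}
    (hH : ∀ x ∈ H, (condExpL2 ℂ ℂ hm x : Lp ℂ 2 P) ∈ H) {G h : Lp ℂ 2 P}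
    (hG : AEStronglyMeasurable[C] G P) (hh : h ∈ H) (hr : ∀ x ∈ H, inner ℂ x (G - h) = 0) :
    AEStronglyMeasurable[C] h P := by
  set Eh : Lp ℂ 2 P := (condExpL2 ℂ ℂ hm h : Lp ℂ 2 P) with hEh
  suffices heq : h - Eh = 0 by
    rw [sub_eq_zero.1 heq]
    exact lpMeas.aestronglyMeasurable _
  have hd : h - Eh ∈ H := H.sub_mem hh (hH h hh)
  have hdiff : h - Eh = (condExpL2 ℂ ℂ hm (G - h) : Lp ℂ 2 P) - (G - h) := by
    rw [map_sub, Submodule.coe_sub, condExpL2_eq_self hm hG, ← hEh]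
    abel
  refine inner_self_eq_zero.1 ((congrArg (inner ℂ (h - Eh)) hdiff).trans ?_)
  rw [inner_sub_right, hr _ hd, ← inner_condExpL2_left_eq_right, hr _ (hH _ hd), sub_zero]

lemma exists_measure_ne_of_not_isTrivialMod [IsProbabilityMeasure P] (hm : C ≤ mΩ)
    (hC : ¬ IsTrivialMod P C) : ∃ s, MeasurableSet[C] s ∧ P s ≠ 0 ∧ P s ≠ 1 := by
  by_contra! h
  refine hC fun s hs => ?_
  by_cases h0 : P s = 0
  · exact ⟨∅, MeasurableSpace.measurableSet_bot_iff.2 (Or.inl rfl), ae_eq_empty.2 h0⟩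
  · exact ⟨univ, MeasurableSpace.measurableSet_bot_iff.2 (Or.inr rfl),
      ae_eq_univ.2 ((prob_compl_eq_zero_iff (hm s hs)).2 (h s hs h0))⟩

lemma exists_integral_eq_zero_of_not_isTrivialMod [IsProbabilityMeasure P] (hm : C ≤ mΩ)
    (hC : ¬ IsTrivialMod P C) :
    ∃ G : Lp ℂ 2 P, AEStronglyMeasurable[C] G P ∧ ∫ ω, G ω ∂P = 0 ∧ G ≠ 0 := by
  obtain ⟨s, hs, hs0, hs1⟩ := exists_measure_ne_of_not_isTrivialMod hm hC
  let g : Ω → ℂ := fun ω => s.indicator (fun _ => (1 : ℂ)) ω - P.real s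
  have hgC : StronglyMeasurable[C] g :=
    (stronglyMeasurable_const.indicator hs).sub stronglyMeasurable_const
  have hg : MemLp g 2 P :=
    (memLp_indicator_const 2 (hm s hs) _ (Or.inr (measure_ne_top P s))).sub (memLp_const _)
  refine ⟨hg.toLp g, ⟨g, hgC, hg.coeFn_toLp⟩, ?_, fun h0 => ?_⟩
  · rw [integral_congr_ae hg.coeFn_toLp, integral_sub
      ((integrable_const _).indicator (hm s hs)) (integrable_const _), integral_indicator (hm s hs)]
    simp [Measure.real]
  · have hzero : ∀ᵐ ω ∂P, g ω = 0 := by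
      filter_upwards [hg.coeFn_toLp, Lp.eq_zero_iff_ae_eq_zero.1 h0] with ω hgω hzero
      exact hgω.symm.trans hzero
    obtain ⟨ω, hω, hgω⟩ := ((frequently_ae_mem_iff.2 hs0).and_eventually hzero).exists
    obtain ⟨ω', hω', hgω'⟩ := ((frequently_ae_mem_iff.2
      (mt (prob_compl_eq_zero_iff (hm s hs)).1 hs1)).and_eventually hzero).exists
    simp only [g, indicator_of_mem hω, sub_eq_zero] at hgω
    simp only [g, indicator_of_notMem hω', sub_eq_zero] at hgω'
    exact one_ne_zero (hgω.trans hgω'.symm)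

lemma integral_eq_zero_of_condExpL2_eq_zero [IsFiniteMeasure P] (hm : C ≤ mΩ) {G : Lp ℂ 2 P}
    (h0 : (condExpL2 ℂ ℂ hm G : Lp ℂ 2 P) = 0) {s : Set Ω} (hs : MeasurableSet[C] s) :
    ∫ ω in s, G ω ∂P = 0 := by
  have h := L2.inner_indicatorConstLp_one (𝕜 := ℂ) (hm s hs) (measure_ne_top P s) G
  rw [← h, ← condExpL2_indicator_of_measurable (𝕜 := ℂ) hm hs (measure_ne_top P s) (1 : ℂ),
    inner_condExpL2_left_eq_right, h0, inner_zero_right]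

end CondExp

section FirstChaos

variable {X : Type*} [MeasurableSpace X] {μ : Measure X} {P : Measure (CountingMeasures X)}

lemma isClosed_chaos (n : ℕ) : IsClosed (chaos μ P n : Set (Lp ℂ 2 P)) :=
  Submodule.isClosed_topologicalClosure _

lemma inner_eq_zero_of_mem_chaos_zero {F G : Lp ℂ 2 P} (hF : F ∈ chaos μ P 0)
    (hG : ∫ ν, G ν ∂P = 0) : inner ℂ F G = 0 := by
  suffices hle : chaos μ P 0 ≤ (ℂ ∙ G)ᗮ from
    Submodule.mem_orthogonal_singleton_iff_inner_left.1 (hle hF)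
  refine Submodule.topologicalClosure_minimal _ (Submodule.span_le.2 ?_)
    (Submodule.isClosed_orthogonal _)
  rintro H ⟨A, -, -, -, hH⟩
  refine Submodule.mem_orthogonal_singleton_iff_inner_left.2 ?_
  rw [L2.inner_def, ← hG]
  refine integral_congr_ae ?_
  filter_upwards [hH] with ν hν
  rw [hν, RCLike.inner_apply]
  simp

lemma exists_ne_zero_mem_chaos [MeasurableSpace.CountablySeparated X] [NullSingletonClass μ]
    [SigmaFinite μ] {C : MeasurableSpace (CountingMeasures X)}
    (hP : HasPoissonCounts μ P) (hm : C ≤ instMeasurableSpaceCountingMeasures)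
    (hC : ¬ IsTrivialMod P C)
    (hCP : ∀ n, ∀ F ∈ chaos μ P n, (condExpL2 ℂ ℂ hm F : Lp ℂ 2 P) ∈ chaos μ P n) :
    ∃ n, n ≠ 0 ∧ ∃ F ∈ chaos μ P n, AEStronglyMeasurable[C] F P ∧ F ≠ 0 := by
  have hprob := hP.isProbabilityMeasure
  obtain ⟨G, hGC, hG, hG0⟩ := exists_integral_eq_zero_of_not_isTrivialMod hm hC
  obtain ⟨n, F₀, hF₀, hne⟩ : ∃ n, ∃ F ∈ chaos μ P n, inner ℂ F G ≠ 0 := by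
    by_contra! h
    exact hG0 (eq_zero_of_forall_inner_chaos hP h)
  have : CompleteSpace (chaos μ P n) := (isClosed_chaos n).completeSpace_coe
  have horth : ∀ x ∈ chaos μ P n, inner ℂ x (G - (chaos μ P n).starProjection G) = 0 :=
    fun x hx => (Submodule.mem_orthogonal _ _).1
      (Submodule.sub_starProjection_mem_orthogonal G) x hx
  refine ⟨n, ?_, (chaos μ P n).starProjection G, Submodule.starProjection_apply_mem _ _,
    aestronglyMeasurable_component hm (hCP n) hGC (Submodule.starProjection_apply_mem _ _) horth,
    fun h0 => hne ?_⟩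
  · rintro rfl
    exact hne (inner_eq_zero_of_mem_chaos_zero hF₀ hG)
  · simpa only [h0, sub_zero] using horth F₀ hF₀

lemma lintegral_weighted_eq {C : MeasurableSpace (CountingMeasures X)}
    (hm : C ≤ instMeasurableSpaceCountingMeasures) {A : Set X}
    (h : ∀ s, MeasurableSet[C] s → ∫⁻ ν in s, N A ν ∂P = μ A * P s) {F : Lp ℂ 2 P}
    (hF : AEStronglyMeasurable[C] F P) :
    ∫⁻ ν, ‖F ν‖ₑ ^ 2 ∂(weighted P A) = μ A * ∫⁻ ν, ‖F ν‖ₑ ^ 2 ∂P := by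
  obtain ⟨F', hF', hFF'⟩ := hF
  have hmeas : Measurable[C] fun ν => ‖F' ν‖ₑ ^ 2 := (StronglyMeasurable.enorm hF').pow_const 2
  have hae : (fun ν => ‖F ν‖ₑ ^ 2) =ᵐ[P] fun ν => ‖F' ν‖ₑ ^ 2 :=
    hFF'.mono fun ν h => by simp only [h]
  have htrim : (weighted P A).trim hm = μ A • P.trim hm := by
    refine @Measure.ext _ C _ _ fun s hs => ?_
    rw [trim_measurableSet_eq hm hs, Measure.smul_apply, trim_measurableSet_eq hm hs, weighted,
      withDensity_apply _ (hm s hs), h s hs, smul_eq_mul]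
  rw [lintegral_congr_ae ((weighted_ac A).ae_le hae), lintegral_congr_ae hae,
    ← lintegral_trim hm hmeas, ← lintegral_trim hm hmeas, htrim, lintegral_smul_measure,
    smul_eq_mul]

lemma toLp_ctr_mem_chaos (hP : HasPoissonCounts μ P) {A : Set X} (hA : MeasurableSet A)
    (hfin : μ A < ∞) :
    (hP.hasAllMoments_ctr hA hfin).memLp_two.toLp _ ∈ chaos μ P 1 := by
  refine mem_chaos_of_ae_eq (A := fun _ => A) ⟨fun _ => hA,
    fun i j hij => absurd (Subsingleton.elim i j) hij, fun _ => hfin⟩ ?_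
  filter_upwards [(hP.hasAllMoments_ctr hA hfin).memLp_two.coeFn_toLp] with ν h
  simpa using h

lemma setLIntegral_N_eq_of_integral_eq_zero (hP : HasPoissonCounts μ P) {A : Set X}
    (hA : MeasurableSet A) (hfin : μ A < ∞) {s : Set (CountingMeasures X)}
    (h : ∫ ν in s, (ctr μ A ν : ℂ) ∂P = 0) : ∫⁻ ν in s, N A ν ∂P = μ A * P s := by
  have hprob := hP.isProbabilityMeasure
  have hint : Integrable (fun ν => (N A ν).toReal) P := by
    refine (hP.hasAllMoments_num hA hfin).integrable.norm.congr ?_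
    filter_upwards [hP.ae_N_eq A hA hfin] with ν hν
    rw [hν, Complex.norm_natCast, ENNReal.toReal_natCast]
  have hne : ∫⁻ ν in s, N A ν ∂P ≠ ∞ := by
    have hlt := hint.integrableOn.lintegral_lt_top (μ := P.restrict s)
    rw [lintegral_congr_ae (g := N A) ((ae_restrict_of_ae (hP.ae_N_lt_top hA hfin)).mono
      fun ν h => ENNReal.ofReal_toReal h.ne)] at hlt
    exact hlt.ne
  rw [integral_complex_ofReal, Complex.ofReal_eq_zero] at h
  simp only [ctr] at h
  rw [integral_sub hint.integrableOn (integrable_const _), setIntegral_const,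
    sub_eq_zero, integral_toReal (measurable_N hA).aemeasurable
      (ae_restrict_of_ae (hP.ae_N_lt_top hA hfin)), smul_eq_mul, Measure.real,
    ← ENNReal.toReal_mul] at h
  rw [mul_comm]
  exact (ENNReal.toReal_eq_toReal_iff' hne (ENNReal.mul_ne_top (measure_ne_top P s) hfin.ne)).1 h

theorem exists_ne_zero_mem_chaos_one [MeasurableSpace.CountablySeparated X]
    [NullSingletonClass μ] [SigmaFinite μ] {C : MeasurableSpace (CountingMeasures X)}
    (hP : HasPoissonCounts μ P) (hm : C ≤ instMeasurableSpaceCountingMeasures)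
    (hC : ¬ IsTrivialMod P C)
    (hCP : ∀ n, ∀ F ∈ chaos μ P n, (condExpL2 ℂ ℂ hm F : Lp ℂ 2 P) ∈ chaos μ P n) :
    ∃ F ∈ chaos μ P 1, AEStronglyMeasurable[C] F P ∧ F ≠ 0 := by
  have hprob := hP.isProbabilityMeasure
  obtain ⟨n, hn, F, hFn, hFC, hF0⟩ := exists_ne_zero_mem_chaos hP hm hC hCP
  -- Some `N A` is correlated with `C`, so its conditional expectation is not constant.
  obtain ⟨A, hA, hfin, s, hs, hne⟩ : ∃ A, ∃ _ : MeasurableSet A, ∃ _ : μ A < ∞, ∃ s,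
      MeasurableSet[C] s ∧ ∫⁻ ν in s, N A ν ∂P ≠ μ A * P s := by
    by_contra! h
    exact hF0 (eq_zero_of_lintegral_weighted hP hn hFn fun A hA hfin =>
      lintegral_weighted_eq hm (h A hA hfin) hFC)
  have hL := (hP.hasAllMoments_ctr hA hfin).memLp_two
  refine ⟨condExpL2 ℂ ℂ hm (hL.toLp _), hCP 1 _ (toLp_ctr_mem_chaos hP hA hfin),
    lpMeas.aestronglyMeasurable _, fun h0 => hne ?_⟩
  refine setLIntegral_N_eq_of_integral_eq_zero hP hA hfin ?_
  rw [← integral_eq_zero_of_condExpL2_eq_zero hm h0 hs]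
  exact integral_congr_ae (ae_restrict_of_ae hL.coeFn_toLp.symm)

end FirstChaos

section StochasticIntegral

variable {X : Type*} [MeasurableSpace X] {μ : Measure X} {P : Measure (CountingMeasures X)}

/-- Measurable sets of finite measure. -/
abbrev FiniteMeasureSet (μ : Measure X) : Type _ := {A : Set X // MeasurableSet A ∧ μ A < ∞}

/-- The indicator function of a set of finite measure, in `L²(μ)`. -/
noncomputable def indLp (𝕜 : Type*) [RCLike 𝕜] (A : FiniteMeasureSet μ) : Lp 𝕜 2 μ :=
  indicatorConstLp 2 A.2.1 A.2.2.ne (1 : 𝕜)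

lemma coeFn_indLp (𝕜 : Type*) [RCLike 𝕜] (A : FiniteMeasureSet μ) :
    indLp 𝕜 A =ᵐ[μ] A.1.indicator fun _ => (1 : 𝕜) := indicatorConstLp_coeFn

/-- The centered variable `N(A) - μ(A)`, in `L²(μ*)`. -/
noncomputable def ctrLp (hP : HasPoissonCounts μ P) (A : FiniteMeasureSet μ) : Lp ℂ 2 P :=
  (hP.hasAllMoments_ctr A.2.1 A.2.2).memLp_two.toLp _

lemma coeFn_ctrLp (hP : HasPoissonCounts μ P) (A : FiniteMeasureSet μ) :
    ctrLp hP A =ᵐ[P] fun ν => (ctr μ A.1 ν : ℂ) := MemLp.coeFn_toLp _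

/-- The members of a disjoint family, as sets of finite measure. -/
abbrev IsDisjointFamily.set {ι : Type*} {B : ι → Set X} (hB : IsDisjointFamily μ B) (b : ι) :
    FiniteMeasureSet μ := ⟨B b, hB.measurableSet b, hB.measure_lt_top b⟩

lemma indLp_biUnion {𝕜 : Type*} [RCLike 𝕜] {ι : Type*} {B : ι → Set X}
    (hB : IsDisjointFamily μ B) (S : Finset ι)
    {A : FiniteMeasureSet μ} (hA : A.1 = ⋃ b ∈ S, B b) :
    indLp 𝕜 A = ∑ b ∈ S, indLp 𝕜 (hB.set b) := by
  refine Lp.ext ?_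
  have h : ∀ᵐ x ∂μ, ∀ b ∈ S, indLp 𝕜 (hB.set b) x = (B b).indicator (fun _ => (1 : 𝕜)) x :=
    (Finset.eventually_all S).2 fun b _ => coeFn_indLp 𝕜 (hB.set b)
  filter_upwards [coeFn_indLp 𝕜 A, h, Lp.coeFn_finsetSum S fun b => indLp 𝕜 (hB.set b)]
    with x hxA hxB hsum
  rw [hxA, hsum, Finset.sum_apply, Finset.sum_congr rfl hxB, hA,
    Finset.indicator_biUnion_apply S B fun _ _ _ _ h => hB.disjoint h]

lemma ctrLp_biUnion (hP : HasPoissonCounts μ P) {ι : Type*} [Countable ι] {B : ι → Set X}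
    (hB : IsDisjointFamily μ B) (S : Finset ι)
    {A : FiniteMeasureSet μ} (hA : A.1 = ⋃ b ∈ S, B b) :
    ctrLp hP A = ∑ b ∈ S, ctrLp hP (hB.set b) := by
  refine Lp.ext ?_
  have h : ∀ᵐ ν ∂P, ∀ b ∈ S, ctrLp hP (hB.set b) ν = (ctr μ (B b) ν : ℂ) :=
    (Finset.eventually_all S).2 fun b _ => coeFn_ctrLp hP (hB.set b)
  filter_upwards [coeFn_ctrLp hP A, h, Lp.coeFn_finsetSum S fun b => ctrLp hP (hB.set b),
    hP.ae_N_eq.ae_forall hB] with ν hνA hνB hsum hN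
  rw [hνA, hsum, Finset.sum_apply, Finset.sum_congr rfl hνB, hA, ctr_biUnion hB S hN,
    Complex.ofReal_sum]

lemma inner_indLp (𝕜 : Type*) [RCLike 𝕜] (A B : FiniteMeasureSet μ) :
    inner 𝕜 (indLp 𝕜 A) (indLp 𝕜 B) = ((μ.real (A.1 ∩ B.1) : ℝ) : 𝕜) := by
  rw [indLp, L2.inner_indicatorConstLp_one, setIntegral_congr_ae A.2.1
    ((coeFn_indLp 𝕜 B).mono fun _ h _ => h), setIntegral_indicator B.2.1, setIntegral_const,
    RCLike.real_smul_eq_coe_mul, mul_one]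

lemma inner_ctrLp_family (hP : HasPoissonCounts μ P) {ι : Type} [Finite ι] {B : ι → Set X}
    (hB : IsDisjointFamily μ B) (b b' : ι) :
    inner ℂ (ctrLp hP (hB.set b)) (ctrLp hP (hB.set b')) =
      inner ℂ (indLp ℂ (hB.set b)) (indLp ℂ (hB.set b')) := by
  classical
  rw [inner_indLp, ctrLp, ctrLp, inner_toLp]
  simp only [Complex.conj_ofReal]
  obtain rfl | hb := eq_or_ne b b'
  · simpa using integral_prod_ctr_mul_self hP hB {b} ∅
  · simpa [(hB.disjoint hb).inter_eq] using integral_prod_ctr_mul_of_ne hP hB (e := ∅)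
      (Finset.singleton_injective.ne hb) rfl zero_le_one

lemma inner_ctrLp (hP : HasPoissonCounts μ P) (A A' : FiniteMeasureSet μ) :
    inner ℂ (ctrLp hP A) (ctrLp hP A') = inner ℂ (indLp ℂ A) (indLp ℂ A') := by
  obtain ⟨m, B, S, hB, -, hS⟩ := exists_atoms (μ := μ) (fun k : Bool => cond k A.1 A'.1)
    (by rintro (_ | _) <;> [exact A'.2.1; exact A.2.1])
    (by rintro (_ | _) <;> [exact A'.2.2; exact A.2.2])
  rw [ctrLp_biUnion hP hB _ (hS true), ctrLp_biUnion hP hB _ (hS false),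
    indLp_biUnion hB _ (hS true), indLp_biUnion hB _ (hS false)]
  simp only [sum_inner, inner_sum, inner_ctrLp_family]

/-- Linear combinations of indicator functions. -/
noncomputable def stepLp (𝕜 : Type*) [RCLike 𝕜] (μ : Measure X) :
    (FiniteMeasureSet μ →₀ 𝕜) →ₗ[𝕜] Lp 𝕜 2 μ := Finsupp.linearCombination 𝕜 (indLp 𝕜)

lemma denseRange_stepLp (𝕜 : Type*) [RCLike 𝕜] : DenseRange (stepLp 𝕜 μ) := by
  intro f
  change f ∈ (LinearMap.range (stepLp 𝕜 μ)).topologicalClosure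
  refine Lp.induction ENNReal.ofNat_ne_top (motive := fun f => f ∈
    ((LinearMap.range (stepLp 𝕜 μ)).topologicalClosure : Set (Lp 𝕜 2 μ))) (fun c s hs hμs => ?_)
    (fun f g _ _ _ hf hg => Submodule.add_mem _ hf hg)
    (Submodule.isClosed_topologicalClosure _) f
  refine Submodule.le_topologicalClosure _ ⟨Finsupp.single ⟨s, hs, hμs⟩ c, ?_⟩
  rw [stepLp, Finsupp.linearCombination_single, Lp.simpleFunc.coe_indicatorConst]
  refine Lp.ext ?_
  filter_upwards [Lp.coeFn_smul c (indLp 𝕜 (⟨s, hs, hμs⟩ : FiniteMeasureSet μ)),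
    coeFn_indLp 𝕜 (⟨s, hs, hμs⟩ : FiniteMeasureSet μ),
    indicatorConstLp_coeFn (p := 2) (hs := hs) (hμs := hμs.ne) (c := c)] with x hsmul hone hconst
  rw [hsmul, Pi.smul_apply, hone, hconst]
  by_cases hx : x ∈ s <;> simp [hx]

lemma norm_linearCombination_ctrLp (hP : HasPoissonCounts μ P) (c : FiniteMeasureSet μ →₀ ℂ) :
    ‖Finsupp.linearCombination ℂ (ctrLp hP) c‖ = ‖stepLp ℂ μ c‖ := by
  rw [@norm_eq_sqrt_re_inner ℂ, @norm_eq_sqrt_re_inner ℂ]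
  simp only [stepLp, Finsupp.linearCombination_apply, Finsupp.sum_inner, Finsupp.inner_sum,
    inner_smul_left, inner_smul_right, inner_ctrLp]

/-- The stochastic integral, an isometry from `L²(μ)` to `L²(μ*)`. -/
noncomputable def stochInt (hP : HasPoissonCounts μ P) : Lp ℂ 2 μ →ₗᵢ[ℂ] Lp ℂ 2 P where
  toLinearMap := ((Finsupp.linearCombination ℂ (ctrLp hP)).extendOfNorm (stepLp ℂ μ)).toLinearMap
  norm_map' f := by
    refine (denseRange_stepLp ℂ).induction_on (p := fun f =>
      ‖(Finsupp.linearCombination ℂ (ctrLp hP)).extendOfNorm (stepLp ℂ μ) f‖ = ‖f‖) f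
      (isClosed_eq (by fun_prop) continuous_norm) fun c => ?_
    rw [LinearMap.extendOfNorm_eq (denseRange_stepLp ℂ)
      ⟨1, fun c => by rw [norm_linearCombination_ctrLp, one_mul]⟩, norm_linearCombination_ctrLp]

lemma stochInt_indLp (hP : HasPoissonCounts μ P) (A : FiniteMeasureSet μ) :
    stochInt hP (indLp ℂ A) = ctrLp hP A := by
  have h : stochInt hP (stepLp ℂ μ (Finsupp.single A 1)) =
      Finsupp.linearCombination ℂ (ctrLp hP) (Finsupp.single A 1) :=
    LinearMap.extendOfNorm_eq (denseRange_stepLp ℂ)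
      ⟨1, fun c => by rw [norm_linearCombination_ctrLp, one_mul]⟩ _
  simpa only [stepLp, Finsupp.linearCombination_single, one_smul] using h

lemma stochInt_mem_chaos (hP : HasPoissonCounts μ P) (f : Lp ℂ 2 μ) :
    stochInt hP f ∈ chaos μ P 1 := by
  refine (denseRange_stepLp ℂ).induction_on (p := fun f => stochInt hP f ∈ chaos μ P 1) f
    ((isClosed_chaos 1).preimage (stochInt hP).continuous) fun c => ?_
  rw [stepLp, Finsupp.linearCombination_apply, Finsupp.sum, map_sum]
  refine Submodule.sum_mem _ fun A _ => ?_
  rw [map_smul, stochInt_indLp]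
  exact Submodule.smul_mem _ _ (toLp_ctr_mem_chaos hP A.2.1 A.2.2)

lemma exists_stochInt_eq (hP : HasPoissonCounts μ P) {F : Lp ℂ 2 P} (hF : F ∈ chaos μ P 1) :
    ∃ f, stochInt hP f = F := by
  have h : chaos μ P 1 ≤ LinearMap.range (stochInt hP).toLinearMap := by
    refine Submodule.topologicalClosure_minimal _ (Submodule.span_le.2 ?_)
      (stochInt hP).isometry.isClosedEmbedding.isClosed_range
    rintro F ⟨A, hA, -, hfin, hF⟩
    refine ⟨indLp ℂ ⟨A 0, hA 0, hfin 0⟩, (stochInt_indLp hP _).trans (Lp.ext ?_)⟩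
    filter_upwards [hF, coeFn_ctrLp hP ⟨A 0, hA 0, hfin 0⟩] with ν hFν hctr
    rw [hFν, hctr, Fin.prod_univ_one]
    rfl
  exact h hF

end StochasticIntegral

section RealPart

variable {Ω : Type*} {mΩ : MeasurableSpace Ω}

/-- The real part, from complex to real `L²`. -/
noncomputable def reLp (ρ : Measure Ω) : Lp ℂ 2 ρ →L[ℝ] Lp ℝ 2 ρ := Complex.reCLM.compLpL 2 ρ

/-- The imaginary part, from complex to real `L²`. -/
noncomputable def imLp (ρ : Measure Ω) : Lp ℂ 2 ρ →L[ℝ] Lp ℝ 2 ρ := Complex.imCLM.compLpL 2 ρ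

/-- The inclusion of real into complex `L²`. -/
noncomputable def ofRealLp (ρ : Measure Ω) : Lp ℝ 2 ρ →L[ℝ] Lp ℂ 2 ρ :=
  Complex.ofRealCLM.compLpL 2 ρ

variable {ρ : Measure Ω}

lemma coeFn_reLp (f : Lp ℂ 2 ρ) : ∀ᵐ x ∂ρ, reLp ρ f x = (f x).re :=
  ContinuousLinearMap.coeFn_compLpL _ f

lemma coeFn_imLp (f : Lp ℂ 2 ρ) : ∀ᵐ x ∂ρ, imLp ρ f x = (f x).im :=
  ContinuousLinearMap.coeFn_compLpL _ f

lemma coeFn_ofRealLp (f : Lp ℝ 2 ρ) : ∀ᵐ x ∂ρ, ofRealLp ρ f x = (f x : ℂ) :=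
  ContinuousLinearMap.coeFn_compLpL _ f

lemma reLp_ofRealLp (f : Lp ℝ 2 ρ) : reLp ρ (ofRealLp ρ f) = f := by
  refine Lp.ext ?_
  filter_upwards [coeFn_reLp (ofRealLp ρ f), coeFn_ofRealLp f] with x hre hof
  rw [hre, hof, Complex.ofReal_re]

lemma imLp_ofRealLp (f : Lp ℝ 2 ρ) : imLp ρ (ofRealLp ρ f) = 0 := by
  refine Lp.ext ?_
  filter_upwards [coeFn_imLp (ofRealLp ρ f), coeFn_ofRealLp f, Lp.coeFn_zero ℝ 2 ρ]
    with x him hof hzero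
  rw [him, hof, hzero, Complex.ofReal_im, Pi.zero_apply]

lemma reLp_I_smul (f : Lp ℂ 2 ρ) : reLp ρ (Complex.I • f) = -imLp ρ f := by
  refine Lp.ext ?_
  filter_upwards [coeFn_reLp (Complex.I • f), coeFn_imLp f, Lp.coeFn_smul Complex.I f,
    Lp.coeFn_neg (imLp ρ f)] with x hre him hI hneg
  rw [hre, hI, hneg, Pi.smul_apply, Pi.neg_apply, him, smul_eq_mul, Complex.I_mul_re]

lemma imLp_I_smul (f : Lp ℂ 2 ρ) : imLp ρ (Complex.I • f) = reLp ρ f := by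
  refine Lp.ext ?_
  filter_upwards [coeFn_imLp (Complex.I • f), coeFn_reLp f, Lp.coeFn_smul Complex.I f]
    with x him hre hI
  rw [him, hI, Pi.smul_apply, hre, smul_eq_mul, Complex.I_mul_im]

lemma ofRealLp_reLp_add (f : Lp ℂ 2 ρ) :
    ofRealLp ρ (reLp ρ f) + Complex.I • ofRealLp ρ (imLp ρ f) = f := by
  refine Lp.ext ?_
  filter_upwards [coeFn_reLp f, coeFn_imLp f, coeFn_ofRealLp (reLp ρ f), coeFn_ofRealLp (imLp ρ f),
    Lp.coeFn_smul Complex.I (ofRealLp ρ (imLp ρ f)),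
    Lp.coeFn_add (ofRealLp ρ (reLp ρ f)) (Complex.I • ofRealLp ρ (imLp ρ f))]
    with x hre him hofRe hofIm hI hadd
  rw [hadd, Pi.add_apply, hI, Pi.smul_apply, hofRe, hofIm, hre, him, smul_eq_mul, mul_comm,
    Complex.re_add_im]

/-- The function `x ↦ exp (i x) - 1`. -/
noncomputable def expSubOne (x : ℝ) : ℂ := Complex.exp (Complex.I * x) - 1

lemma lipschitzWith_expSubOne : LipschitzWith 1 expSubOne := by
  refine LipschitzWith.of_dist_le_mul fun x y => ?_
  have h : expSubOne x - expSubOne y =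
      Complex.exp (Complex.I * y) * (Complex.exp (Complex.I * (x - y : ℝ)) - 1) := by
    rw [mul_sub, ← Complex.exp_add]
    simp only [expSubOne]
    push_cast
    ring_nf
  rw [dist_eq_norm, h, norm_mul, Complex.norm_exp_I_mul_ofReal, one_mul, NNReal.coe_one, one_mul,
    Real.dist_eq, ← Real.norm_eq_abs]
  exact Real.norm_exp_I_mul_ofReal_sub_one_le

lemma expSubOne_zero : expSubOne 0 = 0 := by simp [expSubOne]

/-- The map `f ↦ exp (i f) - 1` on `L²`. -/
noncomputable def expLp (f : Lp ℝ 2 ρ) : Lp ℂ 2 ρ :=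
  lipschitzWith_expSubOne.compLp expSubOne_zero f

lemma coeFn_expLp (f : Lp ℝ 2 ρ) : ∀ᵐ x ∂ρ, expLp f x = Complex.exp (Complex.I * f x) - 1 :=
  lipschitzWith_expSubOne.coeFn_compLp expSubOne_zero f

lemma continuous_expLp : Continuous (expLp (ρ := ρ)) :=
  lipschitzWith_expSubOne.continuous_compLp expSubOne_zero

end RealPart

section RealIntegral

variable {X : Type*} [MeasurableSpace X] {μ : Measure X} {P : Measure (CountingMeasures X)}

/-- The stochastic integral of real functions. -/
noncomputable def realInt (hP : HasPoissonCounts μ P) : Lp ℝ 2 μ →L[ℝ] Lp ℝ 2 P :=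
  reLp P ∘L (stochInt hP).toContinuousLinearMap.restrictScalars ℝ ∘L ofRealLp μ

lemma ofRealLp_indLp (A : FiniteMeasureSet μ) : ofRealLp μ (indLp ℝ A) = indLp ℂ A := by
  refine Lp.ext ?_
  filter_upwards [coeFn_ofRealLp (indLp ℝ A), coeFn_indLp ℝ A, coeFn_indLp ℂ A] with x hof hr hc
  rw [hof, hr, hc]
  by_cases hx : x ∈ A.1 <;> simp [hx]

lemma coeFn_realInt_indLp (hP : HasPoissonCounts μ P) (A : FiniteMeasureSet μ) :
    realInt hP (indLp ℝ A) =ᵐ[P] ctr μ A.1 := by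
  have h : realInt hP (indLp ℝ A) = reLp P (ctrLp hP A) := by
    rw [← stochInt_indLp, ← ofRealLp_indLp]
    rfl
  rw [h]
  filter_upwards [coeFn_reLp (ctrLp hP A), coeFn_ctrLp hP A] with ν hre hctr
  rw [hre, hctr, Complex.ofReal_re]

lemma ofRealLp_realInt (hP : HasPoissonCounts μ P) (f : Lp ℝ 2 μ) :
    ofRealLp P (realInt hP f) = stochInt hP (ofRealLp μ f) := by
  refine (denseRange_stepLp ℝ).induction_on (p := fun f =>
    ofRealLp P (realInt hP f) = stochInt hP (ofRealLp μ f)) f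
    (isClosed_eq (by fun_prop) ((stochInt hP).continuous.comp (ofRealLp μ).continuous)) fun c => ?_
  have hind (A : FiniteMeasureSet μ) : ofRealLp P (realInt hP (indLp ℝ A)) =
      (stochInt hP).toContinuousLinearMap.restrictScalars ℝ (ofRealLp μ (indLp ℝ A)) := by
    refine Eq.trans ?_ ((stochInt_indLp hP A).symm.trans
      (congrArg (stochInt hP) (ofRealLp_indLp A).symm))
    refine Lp.ext ?_
    filter_upwards [coeFn_ofRealLp (realInt hP (indLp ℝ A)), coeFn_realInt_indLp hP A,
      coeFn_ctrLp hP A] with ν hof hreal hctr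
    rw [hof, hreal, hctr]
  change _ = (stochInt hP).toContinuousLinearMap.restrictScalars ℝ (ofRealLp μ (stepLp ℝ μ c))
  simp only [stepLp, Finsupp.linearCombination_apply, Finsupp.sum, map_sum, map_smul, hind]

lemma reLp_stochInt_and_imLp_stochInt (hP : HasPoissonCounts μ P) (f : Lp ℂ 2 μ) :
    reLp P (stochInt hP f) = realInt hP (reLp μ f) ∧
      imLp P (stochInt hP f) = realInt hP (imLp μ f) := by
  have h : stochInt hP f =
      ofRealLp P (realInt hP (reLp μ f)) + Complex.I • ofRealLp P (realInt hP (imLp μ f)) := by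
    rw [ofRealLp_realInt, ofRealLp_realInt, ← map_smul, ← map_add, ofRealLp_reLp_add]
  rw [h, map_add, map_add, reLp_I_smul, imLp_I_smul]
  simp only [reLp_ofRealLp, imLp_ofRealLp, neg_zero, add_zero, zero_add, and_self]

end RealIntegral

section Characteristic

variable {X : Type*} [MeasurableSpace X] {μ : Measure X} {P : Measure (CountingMeasures X)}

/-- The linear combination of the indicator functions of a disjoint family. -/
noncomputable def familyLp {ι : Type*} [Fintype ι] {B : ι → Set X} (hB : IsDisjointFamily μ B)
    (v : ι → ℝ) : Lp ℝ 2 μ := ∑ b, v b • indLp ℝ (hB.set b)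

lemma exists_familyLp_eq_stepLp (c : FiniteMeasureSet μ →₀ ℝ) (A : FiniteMeasureSet μ) :
    ∃ (m : ℕ) (B : Fin m → Set X) (hB : IsDisjointFamily μ B) (v : Fin m → ℝ) (S : Finset (Fin m)),
      stepLp ℝ μ c = familyLp hB v ∧ A.1 = ⋃ b ∈ S, B b := by
  classical
  let D : Option c.support → FiniteMeasureSet μ := fun k => k.elim A fun a => a.1
  obtain ⟨m, B, S, hB, -, hS⟩ := exists_atoms (μ := μ) (fun k => (D k).1) (fun k => (D k).2.1)
    (fun k => (D k).2.2)
  refine ⟨m, B, hB, fun b => ∑ a : c.support, if b ∈ S (some a) then c a else 0, S none, ?_,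
    hS none⟩
  rw [stepLp, Finsupp.linearCombination_apply, Finsupp.sum, ← Finset.sum_coe_sort, familyLp]
  simp only [Finset.sum_smul]
  rw [Finset.sum_comm]
  refine Finset.sum_congr rfl fun a _ => ?_
  have hind : indLp ℝ a.1 = ∑ b ∈ S (some a), indLp ℝ (hB.set b) :=
    indLp_biUnion hB _ (hS (some a))
  rw [hind, Finset.smul_sum]
  simp [ite_smul, Finset.sum_ite_mem]

variable {ι : Type} [Fintype ι] {B : ι → Set X} (hB : IsDisjointFamily μ B) (v : ι → ℝ)

lemma norm_familyLp_sq : ‖familyLp hB v‖ ^ 2 = ∑ b, v b ^ 2 * μ.real (B b) := by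
  classical
  have hinter (b b' : ι) : μ.real (B b ∩ B b') = if b = b' then μ.real (B b) else 0 := by
    obtain rfl | hb := eq_or_ne b b'
    · simp
    · simp [hb, (hB.disjoint hb).inter_eq]
  rw [← real_inner_self_eq_norm_sq, familyLp]
  simp only [sum_inner, inner_sum, inner_smul_left, inner_smul_right, inner_indLp, hinter]
  simp [pow_two, mul_assoc]

lemma coeFn_familyLp : ∀ᵐ x ∂μ, ∀ b, x ∈ B b → familyLp hB v x = v b := by
  have hterm : ∀ᵐ x ∂μ, ∀ b ∈ Finset.univ, (v b • indLp ℝ (hB.set b)) x =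
      v b * (B b).indicator (fun _ => (1 : ℝ)) x := (Finset.eventually_all _).2 fun b _ => by
    filter_upwards [Lp.coeFn_smul (v b) (indLp ℝ (hB.set b)), coeFn_indLp ℝ (hB.set b)]
      with x hsmul hind
    rw [hsmul, Pi.smul_apply, hind, smul_eq_mul]
  filter_upwards [hterm, Lp.coeFn_finsetSum Finset.univ fun b => v b • indLp ℝ (hB.set b)]
    with x hx hsum b hb
  rw [familyLp, hsum, Finset.sum_apply, Finset.sum_congr rfl hx, Finset.sum_eq_single b]
  · simp [hb]
  · intro b' _ hb'
    rw [indicator_of_notMem fun h => (hB.disjoint hb').notMem_of_mem_left h hb, mul_zero]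
  · simp

lemma coeFn_realInt_familyLp (hP : HasPoissonCounts μ P) :
    ∀ᵐ ν ∂P, realInt hP (familyLp hB v) ν = ∑ b, v b * ctr μ (B b) ν := by
  have hterm : ∀ᵐ ν ∂P, ∀ b ∈ Finset.univ, (v b • realInt hP (indLp ℝ (hB.set b))) ν =
      v b * ctr μ (B b) ν := (Finset.eventually_all _).2 fun b _ => by
    filter_upwards [Lp.coeFn_smul (v b) (realInt hP (indLp ℝ (hB.set b))),
      coeFn_realInt_indLp hP (hB.set b)] with ν hsmul hctr
    rw [hsmul, Pi.smul_apply, hctr, smul_eq_mul]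
  rw [familyLp, map_sum]
  simp only [map_smul]
  filter_upwards [hterm,
    Lp.coeFn_finsetSum Finset.univ fun b => v b • realInt hP (indLp ℝ (hB.set b))] with ν hν hsum
  rw [hsum, Finset.sum_apply, Finset.sum_congr rfl hν]

/-- The value `𝔼[exp (i I(f))]` at `f = familyLp hB v`, where `I` is the stochastic integral, as
given by the characteristic function of the Poisson law. -/
noncomputable def familyChar (μ : Measure X) (B : ι → Set X) (v : ι → ℝ) : ℂ :=
  ∏ b, Complex.exp (-(Complex.I * v b * (μ (B b)).toNNReal)) *
    Complex.exp ((μ (B b)).toNNReal * (Complex.exp (Complex.I * v b) - 1))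

lemma coeFn_expLp_realInt_familyLp (hP : HasPoissonCounts μ P) :
    ∀ᵐ ν ∂P, expLp (realInt hP (familyLp hB v)) ν + 1 =
      ∏ b, Complex.exp (-(Complex.I * v b * (μ (B b)).toNNReal)) *
        Complex.exp (Complex.I * v b) ^ num (B b) ν := by
  have hctr : ∀ᵐ ν ∂P, ∀ b, (ctr μ (B b) ν : ℂ) = (num (B b) ν : ℂ) - (μ (B b)).toNNReal :=
    ae_all_iff.2 fun b => hP.ae_ctr_eq (hB.measurableSet b) (hB.measure_lt_top b)
  filter_upwards [coeFn_expLp (realInt hP (familyLp hB v)), coeFn_realInt_familyLp hB v hP, hctr]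
    with ν hexp hint hν
  rw [hexp, hint, sub_add_cancel, Complex.ofReal_sum]
  simp only [Complex.ofReal_mul]
  rw [Finset.mul_sum, Complex.exp_sum]
  refine Finset.prod_congr rfl fun b _ => ?_
  rw [hν, ← Complex.exp_nat_mul, ← Complex.exp_add]
  congr 1
  ring

lemma integral_expLp_realInt_familyLp (hP : HasPoissonCounts μ P) :
    ∫ ν, (expLp (realInt hP (familyLp hB v)) ν + 1) ∂P = familyChar μ B v := by
  rw [integral_congr_ae (coeFn_expLp_realInt_familyLp hB v hP), hP.integral_prod_comp_num hB
    fun b k => Complex.exp (-(Complex.I * v b * (μ (B b)).toNNReal)) *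
        Complex.exp (Complex.I * v b) ^ k]
  simp only [integral_const_mul, integral_poissonMeasure_pow, familyChar]

lemma integral_ctr_mul_expLp_realInt_familyLp (hP : HasPoissonCounts μ P) (a : ι) :
    ∫ ν, (ctr μ (B a) ν : ℂ) * (expLp (realInt hP (familyLp hB v)) ν + 1) ∂P =
      familyChar μ B v * ((μ (B a)).toNNReal * (Complex.exp (Complex.I * v a) - 1)) := by
  classical
  have hprod : ∀ᵐ ν ∂P, (ctr μ (B a) ν : ℂ) * (expLp (realInt hP (familyLp hB v)) ν + 1) =
      ∏ b, Complex.exp (-(Complex.I * v b * (μ (B b)).toNNReal)) *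
        ((if b = a then (num (B b) ν : ℂ) - (μ (B b)).toNNReal else 1) *
          Complex.exp (Complex.I * v b) ^ num (B b) ν) := by
    filter_upwards [coeFn_expLp_realInt_familyLp hB v hP,
      hP.ae_ctr_eq (hB.measurableSet a) (hB.measure_lt_top a)] with ν hexp hctr
    rw [hexp, hctr]
    simp only [Finset.prod_mul_distrib, Finset.prod_ite_eq', Finset.mem_univ, if_true]
    ring
  rw [integral_congr_ae hprod, hP.integral_prod_comp_num hB
    fun b k => Complex.exp (-(Complex.I * v b * (μ (B b)).toNNReal)) *
        ((if b = a then (k : ℂ) - (μ (B b)).toNNReal else 1) * Complex.exp (Complex.I * v b) ^ k)]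
  have hfactor (b : ι) : ∫ k : ℕ, Complex.exp (-(Complex.I * v b * (μ (B b)).toNNReal)) *
        ((if b = a then (k : ℂ) - (μ (B b)).toNNReal else 1) * Complex.exp (Complex.I * v b) ^ k)
        ∂(poissonMeasure (μ (B b)).toNNReal) =
      (Complex.exp (-(Complex.I * v b * (μ (B b)).toNNReal)) *
        Complex.exp ((μ (B b)).toNNReal * (Complex.exp (Complex.I * v b) - 1))) *
        if b = a then (μ (B b)).toNNReal * (Complex.exp (Complex.I * v b) - 1) else 1 := by
    rw [integral_const_mul]
    split_ifs
    · rw [integral_poissonMeasure_centered_mul_pow]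
      ring
    · simp only [one_mul, mul_one, integral_poissonMeasure_pow]
  simp only [hfactor]
  rw [Finset.prod_mul_distrib, Finset.prod_ite_eq', if_pos (Finset.mem_univ a), familyChar]

lemma integral_ctr (hP : HasPoissonCounts μ P) (A : FiniteMeasureSet μ) :
    ∫ ν, (ctr μ A.1 ν : ℂ) ∂P = 0 := by
  rw [integral_congr_ae (hP.ae_ctr_eq A.2.1 A.2.2),
    hP.integral_comp_num A.2.1 A.2.2 fun k => (k : ℂ) - (μ A.1).toNNReal,
    integral_poissonMeasure_centered]

lemma inner_ctrLp_eq_integral (hP : HasPoissonCounts μ P) (A : FiniteMeasureSet μ) (F : Lp ℂ 2 P) :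
    inner ℂ (ctrLp hP A) F = ∫ ν, (ctr μ A.1 ν : ℂ) * (F ν + 1) ∂P := by
  have hinner : ∀ᵐ ν ∂P, inner ℂ (ctrLp hP A ν) (F ν) =
      (ctr μ A.1 ν : ℂ) * (F ν + 1) - (ctr μ A.1 ν : ℂ) := by
    filter_upwards [coeFn_ctrLp hP A] with ν hν
    rw [hν, RCLike.inner_apply, Complex.conj_ofReal]
    ring
  have hctr := (hP.hasAllMoments_ctr A.2.1 A.2.2).integrable
  have hmul : Integrable (fun ν => (ctr μ A.1 ν : ℂ) * (F ν + 1)) P := by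
    refine ((L2.integrable_inner (ctrLp hP A) F).add hctr).congr ?_
    filter_upwards [hinner] with ν hν
    rw [Pi.add_apply, hν, sub_add_cancel]
  rw [L2.inner_def, integral_congr_ae hinner, integral_sub hmul hctr, integral_ctr hP, sub_zero]

lemma inner_indLp_expLp_familyLp (a : ι) :
    inner ℂ (indLp ℂ (hB.set a)) (expLp (familyLp hB v)) =
      (μ (B a)).toNNReal * (Complex.exp (Complex.I * v a) - 1) := by
  rw [indLp, L2.inner_indicatorConstLp_one, setIntegral_congr_ae (hB.measurableSet a)
    (g := fun _ => Complex.exp (Complex.I * v a) - 1)]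
  · rw [setIntegral_const, Complex.real_smul]
    rfl
  · filter_upwards [coeFn_expLp (familyLp hB v), coeFn_familyLp hB v] with x hexp hfam hx
    rw [hexp, hfam a hx]

lemma exp_le_norm_familyChar :
    Real.exp (-(‖familyLp hB v‖ ^ 2 / 2)) ≤ ‖familyChar μ B v‖ := by
  rw [norm_familyLp_sq, familyChar, norm_prod, Finset.sum_div, ← Finset.sum_neg_distrib,
    Real.exp_sum]
  refine Finset.prod_le_prod (fun _ _ => (Real.exp_pos _).le) fun b _ => ?_
  rw [norm_mul, Complex.norm_exp, Complex.norm_exp, ← Real.exp_add, Real.exp_le_exp]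
  have hre_centering : (-(Complex.I * v b * ((μ (B b)).toNNReal : ℂ))).re = 0 := by simp
  have hre_poisson : (((μ (B b)).toNNReal : ℂ) * (Complex.exp (Complex.I * v b) - 1)).re =
      μ.real (B b) * (Real.cos (v b) - 1) := by
    rw [mul_comm Complex.I, show ((μ (B b)).toNNReal : ℂ) = (μ.real (B b) : ℂ) from rfl,
      Complex.re_ofReal_mul, Complex.sub_re, Complex.exp_ofReal_mul_I_re, Complex.one_re]
  rw [hre_centering, hre_poisson, zero_add]
  nlinarith [Real.one_sub_sq_div_two_le_cos (x := v b), measureReal_nonneg (μ := μ) (s := B b)]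

/-- The value `𝔼[exp (i I(f))]` of the characteristic functional of the stochastic integral `I`. -/
noncomputable def charInt (hP : HasPoissonCounts μ P) (f : Lp ℝ 2 μ) : ℂ :=
  ∫ ν, expLp (realInt hP f) ν ∂P + 1

lemma charInt_familyLp (hP : HasPoissonCounts μ P) :
    charInt hP (familyLp hB v) = familyChar μ B v := by
  have := hP.isProbabilityMeasure
  rw [← integral_expLp_realInt_familyLp hB v hP, integral_add
    ((Lp.memLp _).integrable one_le_two) (integrable_const _)]
  simp [charInt]

lemma continuous_charInt (hP : HasPoissonCounts μ P) : Continuous (charInt hP) := by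
  have := hP.isProbabilityMeasure
  have hint (F : Lp ℂ 2 P) : ∫ ν, F ν ∂P = inner ℂ
      (indicatorConstLp 2 MeasurableSet.univ (measure_ne_top P univ) (1 : ℂ)) F := by
    rw [L2.inner_indicatorConstLp_one, setIntegral_univ]
  rw [show charInt hP = _ from funext fun f => congrArg (· + 1) (hint (expLp (realInt hP f)))]
  exact (continuous_const.inner (continuous_expLp.comp (realInt hP).continuous)).add
    continuous_const

lemma charInt_ne_zero (hP : HasPoissonCounts μ P) (f : Lp ℝ 2 μ) : charInt hP f ≠ 0 := by
  have hexp_le : Real.exp (-(‖f‖ ^ 2 / 2)) ≤ ‖charInt hP f‖ := by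
    refine (denseRange_stepLp ℝ).induction_on (p := fun f =>
      Real.exp (-(‖f‖ ^ 2 / 2)) ≤ ‖charInt hP f‖) f
      (isClosed_le (by fun_prop) (continuous_charInt hP).norm) fun c => ?_
    obtain ⟨m, B, hB, v, S, h, -⟩ := exists_familyLp_eq_stepLp c
      (⟨∅, MeasurableSet.empty, by simp⟩ : FiniteMeasureSet μ)
    rw [h, charInt_familyLp]
    exact exp_le_norm_familyChar hB v
  exact norm_pos_iff.1 ((Real.exp_pos _).trans_le hexp_le)

lemma inner_ctrLp_expLp (hP : HasPoissonCounts μ P) (A : FiniteMeasureSet μ) (f : Lp ℝ 2 μ) :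
    inner ℂ (ctrLp hP A) (expLp (realInt hP f)) =
      charInt hP f * inner ℂ (indLp ℂ A) (expLp f) := by
  refine (denseRange_stepLp ℝ).induction_on (p := fun f => inner ℂ (ctrLp hP A)
    (expLp (realInt hP f)) = charInt hP f * inner ℂ (indLp ℂ A) (expLp f)) f
    (isClosed_eq (continuous_const.inner (continuous_expLp.comp (realInt hP).continuous))
      ((continuous_charInt hP).mul (continuous_const.inner continuous_expLp))) fun c => ?_
  obtain ⟨m, B, hB, v, S, h, hA⟩ := exists_familyLp_eq_stepLp c A
  rw [h, ctrLp_biUnion hP hB S hA, indLp_biUnion hB S hA, sum_inner, sum_inner, Finset.mul_sum]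
  refine Finset.sum_congr rfl fun a _ => ?_
  rw [inner_ctrLp_eq_integral, integral_ctr_mul_expLp_realInt_familyLp, charInt_familyLp,
    inner_indLp_expLp_familyLp]

-- Equivalently: the projection of `exp (i I(f)) - 1` on the first chaos is a nonzero multiple of
-- `I(exp (i f) - 1)`.
lemma inner_stochInt_expLp (hP : HasPoissonCounts μ P) (g : Lp ℂ 2 μ) (f : Lp ℝ 2 μ) :
    inner ℂ (stochInt hP g) (expLp (realInt hP f)) =
      charInt hP f * inner ℂ g (expLp f) := by
  refine (denseRange_stepLp ℂ).induction_on (p := fun g => inner ℂ (stochInt hP g)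
    (expLp (realInt hP f)) = charInt hP f * inner ℂ g (expLp f)) g
    (isClosed_eq ((stochInt hP).continuous.inner continuous_const)
      (continuous_const.mul (continuous_id.inner continuous_const))) fun c => ?_
  simp only [stepLp, Finsupp.linearCombination_apply, Finsupp.sum, map_sum, map_smul,
    stochInt_indLp, sum_inner, inner_smul_left, inner_ctrLp_expLp, Finset.mul_sum]
  exact Finset.sum_congr rfl fun _ _ => mul_left_comm _ _ _

end Characteristic

section Iteration

open Real Filter Topology

/-- A map of `[0, 1]` with attracting fixed points `0` and `1` and repelling fixed point `1 / 2`: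
its iterates turn a function into an indicator function. -/
noncomputable def sharpen (x : ℝ) : ℝ := x - (2 * π)⁻¹ * sin (2 * π * x)

lemma sharpen_one_sub (x : ℝ) : sharpen (1 - x) = 1 - sharpen x := by
  rw [sharpen, sharpen, show 2 * π * (1 - x) = 2 * π - 2 * π * x by ring, sin_two_pi_sub]
  ring

lemma iterate_sharpen_one_sub (n : ℕ) (x : ℝ) : sharpen^[n] (1 - x) = 1 - sharpen^[n] x := by
  induction n generalizing x with
  | zero => rfl
  | succ n ih => rw [Function.iterate_succ_apply, Function.iterate_succ_apply, sharpen_one_sub, ih]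

lemma sharpen_mem {x : ℝ} (h0 : 0 ≤ x) (h1 : x ≤ 1 / 2) : 0 ≤ sharpen x ∧ sharpen x ≤ x := by
  have hp := pi_pos
  have harg : 0 ≤ 2 * π * x := by positivity
  have hsin : 0 ≤ sin (2 * π * x) := sin_nonneg_of_nonneg_of_le_pi harg (by nlinarith)
  have hle : (2 * π)⁻¹ * sin (2 * π * x) ≤ x := by
    rw [inv_mul_le_iff₀ (by positivity)]
    exact sin_le harg
  exact ⟨sub_nonneg.2 hle, sub_le_self _ (by positivity)⟩

lemma iterate_sharpen_mem (n : ℕ) {x : ℝ} (h0 : 0 ≤ x) (h1 : x ≤ 1 / 2) :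
    0 ≤ sharpen^[n] x ∧ sharpen^[n] x ≤ x := by
  induction n generalizing x with
  | zero => exact ⟨h0, le_rfl⟩
  | succ n ih =>
    obtain ⟨hnonneg, hle⟩ := sharpen_mem h0 h1
    rw [Function.iterate_succ_apply]
    exact (ih hnonneg (hle.trans h1)).imp_right fun h => h.trans hle

lemma tendsto_iterate_sharpen_zero {x : ℝ} (h0 : 0 ≤ x) (h1 : x < 1 / 2) :
    Tendsto (fun n => sharpen^[n] x) atTop (𝓝 0) := by
  have hanti : Antitone fun n => sharpen^[n] x := antitone_nat_of_succ_le fun n => by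
    obtain ⟨hnonneg, hle⟩ := iterate_sharpen_mem n h0 h1.le
    rw [Function.iterate_succ_apply']
    exact (sharpen_mem hnonneg (hle.trans h1.le)).2
  have hlim := tendsto_atTop_ciInf hanti ⟨0, by
    rintro _ ⟨n, rfl⟩
    exact (iterate_sharpen_mem n h0 h1.le).1⟩
  set l := ⨅ n, sharpen^[n] x
  have hl0 : 0 ≤ l := ge_of_tendsto' hlim fun n => (iterate_sharpen_mem n h0 h1.le).1
  have hl1 : l ≤ x := le_of_tendsto' hlim fun n => (iterate_sharpen_mem n h0 h1.le).2
  have hfix : Function.IsFixedPt sharpen l := isFixedPt_of_tendsto_iterate hlim (by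
    unfold sharpen
    fun_prop)
  have hp := pi_pos
  have hsin : sin (2 * π * l) = 0 :=
    (mul_eq_zero.1 (sub_eq_self.1 hfix)).resolve_left (by positivity)
  have harg : 2 * π * l = 0 :=
    (sin_eq_zero_iff_of_lt_of_lt (by nlinarith) (by nlinarith)).1 hsin
  have hl : l = 0 := (mul_eq_zero.1 harg).resolve_left (by positivity)
  rwa [hl] at hlim

lemma sharpen_half : sharpen (1 / 2) = 1 / 2 := by
  rw [sharpen, show 2 * π * (1 / 2) = π by ring, sin_pi, mul_zero, sub_zero]

/-- The limit of the iterates of `sharpen` on `[0, 1]`. -/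
noncomputable def sharpenLim (x : ℝ) : ℝ := if x < 1 / 2 then 0 else if x = 1 / 2 then 1 / 2 else 1

lemma measurable_sharpenLim : Measurable sharpenLim :=
  Measurable.ite measurableSet_Iio measurable_const
    (Measurable.ite (measurableSet_singleton _) measurable_const measurable_const)

lemma tendsto_iterate_sharpen {x : ℝ} (h0 : 0 ≤ x) (h1 : x ≤ 1) :
    Tendsto (fun n => sharpen^[n] x) atTop (𝓝 (sharpenLim x)) := by
  unfold sharpenLim
  split_ifs with hlt heq
  · exact tendsto_iterate_sharpen_zero h0 hlt
  · rw [heq]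
    simp only [Function.iterate_fixed sharpen_half]
    exact tendsto_const_nhds
  · have hgt : 1 / 2 < x := lt_of_le_of_ne (not_lt.1 hlt) (Ne.symm heq)
    have h := (tendsto_iterate_sharpen_zero (x := 1 - x) (by linarith) (by linarith)).const_sub 1
    simpa [iterate_sharpen_one_sub] using h

lemma abs_iterate_sharpen_le (n : ℕ) {x : ℝ} (h0 : 0 ≤ x) (h1 : x ≤ 1) :
    |sharpen^[n] x| ≤ 2 * x := by
  rcases le_total x (1 / 2) with hx | hx
  · obtain ⟨hnonneg, hle⟩ := iterate_sharpen_mem n h0 hx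
    rw [abs_of_nonneg hnonneg]
    linarith
  · obtain ⟨hnonneg, hle⟩ := iterate_sharpen_mem n (x := 1 - x) (by linarith) (by linarith)
    rw [iterate_sharpen_one_sub] at hnonneg hle
    rw [abs_of_nonneg (by linarith)]
    linarith

lemma abs_sharpenLim_le {x : ℝ} (h0 : 0 ≤ x) (h1 : x ≤ 1) : |sharpenLim x| ≤ 2 * x :=
  le_of_tendsto' (tendsto_iterate_sharpen h0 h1).abs fun n => abs_iterate_sharpen_le n h0 h1

lemma ite_half_le_eq_cos_sharpenLim (x : ℝ) : (if 1 / 2 ≤ x then 1 else 0) =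
    -1 / 2 * (cos (π * sharpenLim x) - 1) + -1 / 4 * (cos (2 * π * sharpenLim x) - 1) := by
  rcases lt_trichotomy x (1 / 2) with hx | rfl | hx
  · rw [sharpenLim, if_neg hx.not_ge, if_pos hx]
    simp
  · rw [sharpenLim, if_pos le_rfl, if_neg (lt_irrefl _), if_pos rfl, mul_one_div, cos_pi_div_two,
      show 2 * π * (1 / 2) = π by ring, cos_pi]
    norm_num
  · rw [sharpenLim, if_pos hx.le, if_neg hx.not_gt, if_neg hx.ne', mul_one, mul_one, cos_pi,
      cos_two_pi]
    norm_num

end Iteration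

section TrigStable

open Real Filter Topology

variable {X : Type*} [MeasurableSpace X] {μ : Measure X}

/-- Closed subspaces of `L²(μ)` which are stable under `f ↦ cos f - 1` and `f ↦ sin f`. -/
structure IsTrigStable (K : Submodule ℝ (Lp ℝ 2 μ)) : Prop where
  isClosed : IsClosed (K : Set (Lp ℝ 2 μ))
  cos_mem : ∀ f ∈ K, ∀ g : Lp ℝ 2 μ, (∀ᵐ x ∂μ, g x = cos (f x) - 1) → g ∈ K
  sin_mem : ∀ f ∈ K, ∀ g : Lp ℝ 2 μ, (∀ᵐ x ∂μ, g x = sin (f x)) → g ∈ K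

lemma tendsto_of_dominated {u : ℕ → Lp ℝ 2 μ} {v g : Lp ℝ 2 μ}
    (hu : ∀ n, ∀ᵐ x ∂μ, |u n x| ≤ g x) (hv : ∀ᵐ x ∂μ, |v x| ≤ g x)
    (hlim : ∀ᵐ x ∂μ, Tendsto (fun n => u n x) atTop (𝓝 (v x))) : Tendsto u atTop (𝓝 v) := by
  rw [tendsto_iff_norm_sub_tendsto_zero]
  have hnorm (n : ℕ) : ‖u n - v‖ ^ 2 = ∫ x, (u n x - v x) ^ 2 ∂μ := by
    rw [← real_inner_self_eq_norm_sq, L2.inner_def]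
    refine integral_congr_ae ?_
    filter_upwards [Lp.coeFn_sub (u n) v] with x hx
    rw [hx, Pi.sub_apply, real_inner_self_eq_norm_sq, norm_eq_abs, sq_abs]
  have hsq : Tendsto (fun n => ‖u n - v‖ ^ 2) atTop (𝓝 (∫ _, (0 : ℝ) ∂μ)) := by
    simp only [hnorm]
    refine tendsto_integral_of_dominated_convergence (fun x => 4 * (g x) ^ 2)
      (fun n => (((Lp.memLp (u n)).sub (Lp.memLp v)).integrable_sq).aestronglyMeasurable)
      ((Lp.memLp g).integrable_sq.const_mul 4) (fun n => ?_) ?_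
    · filter_upwards [hu n, hv] with x hux hvx
      rw [norm_eq_abs, abs_of_nonneg (sq_nonneg _)]
      nlinarith [abs_le.1 hux, abs_le.1 hvx]
    · filter_upwards [hlim] with x hx
      simpa using (hx.sub_const (v x)).pow 2
  rw [integral_zero] at hsq
  simpa [sqrt_sq_eq_abs] using hsq.sqrt

variable {K : Submodule ℝ (Lp ℝ 2 μ)}

namespace IsTrigStable

lemma exists_cos_mem (hK : IsTrigStable K) {f : Lp ℝ 2 μ} (hf : f ∈ K) (a c : ℝ) :
    ∃ g ∈ K, ∀ᵐ x ∂μ, g x = a * (cos (c * f x) - 1) := by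
  have hlip : LipschitzWith 1 fun x => cos x - 1 := LipschitzWith.of_dist_le_mul fun x y => by
    simpa [dist_eq] using lipschitzWith_cos.dist_le_mul x y
  have hcos := hlip.coeFn_compLp (by simp) (c • f)
  refine ⟨a • hlip.compLp (by simp) (c • f),
    K.smul_mem _ (hK.cos_mem _ (K.smul_mem _ hf) _ hcos), ?_⟩
  filter_upwards [hcos, Lp.coeFn_smul c f, Lp.coeFn_smul a (hlip.compLp (by simp) (c • f))]
    with x hx hc ha
  rw [ha, Pi.smul_apply, hx, Function.comp_apply, hc, Pi.smul_apply, smul_eq_mul, smul_eq_mul]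

lemma exists_sin_mem (hK : IsTrigStable K) {f : Lp ℝ 2 μ} (hf : f ∈ K) (a c : ℝ) :
    ∃ g ∈ K, ∀ᵐ x ∂μ, g x = a * sin (c * f x) := by
  have hsin := lipschitzWith_sin.coeFn_compLp sin_zero (c • f)
  refine ⟨a • lipschitzWith_sin.compLp sin_zero (c • f),
    K.smul_mem _ (hK.sin_mem _ (K.smul_mem _ hf) _ hsin), ?_⟩
  filter_upwards [hsin, Lp.coeFn_smul c f,
    Lp.coeFn_smul a (lipschitzWith_sin.compLp sin_zero (c • f))] with x hx hc ha
  rw [ha, Pi.smul_apply, hx, Function.comp_apply, hc, Pi.smul_apply, smul_eq_mul, smul_eq_mul]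

lemma exists_sharpen_mem (hK : IsTrigStable K) {f : Lp ℝ 2 μ} (hf : f ∈ K) :
    ∃ g ∈ K, ∀ᵐ x ∂μ, g x = sharpen (f x) := by
  obtain ⟨s, hsK, hs⟩ := hK.exists_sin_mem hf (2 * π)⁻¹ (2 * π)
  refine ⟨f - s, K.sub_mem hf hsK, ?_⟩
  filter_upwards [hs, Lp.coeFn_sub f s] with x hsx hsub
  rw [hsub, Pi.sub_apply, hsx, sharpen]

lemma exists_iterate_sharpen_mem (hK : IsTrigStable K) {f : Lp ℝ 2 μ} (hf : f ∈ K) (n : ℕ) :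
    ∃ g ∈ K, ∀ᵐ x ∂μ, g x = sharpen^[n] (f x) := by
  induction n with
  | zero => exact ⟨f, hf, Eventually.of_forall fun _ => rfl⟩
  | succ n ih =>
    obtain ⟨g, hg, hgf⟩ := ih
    obtain ⟨g', hg', hg'g⟩ := hK.exists_sharpen_mem hg
    refine ⟨g', hg', ?_⟩
    filter_upwards [hgf, hg'g] with x hx hx'
    rw [hx', hx, Function.iterate_succ_apply']

lemma exists_sharpenLim_mem (hK : IsTrigStable K) {f : Lp ℝ 2 μ} (hf : f ∈ K)
    (h01 : ∀ᵐ x ∂μ, 0 ≤ f x ∧ f x ≤ 1) : ∃ v ∈ K, ∀ᵐ x ∂μ, v x = sharpenLim (f x) := by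
  choose u hu hux using fun n => hK.exists_iterate_sharpen_mem hf n
  have hmem : MemLp (fun x => sharpenLim (f x)) 2 μ := by
    refine MemLp.of_le ((Lp.memLp f).const_mul 2)
      (measurable_sharpenLim.comp_aemeasurable (Lp.aestronglyMeasurable f).aemeasurable
        ).aestronglyMeasurable ?_
    filter_upwards [h01] with x hx
    exact (abs_sharpenLim_le hx.1 hx.2).trans (le_abs_self _)
  have htwo : ∀ᵐ x ∂μ, ((2 : ℝ) • f : Lp ℝ 2 μ) x = 2 * f x := Lp.coeFn_smul (2 : ℝ) f
  refine ⟨hmem.toLp _, hK.isClosed.mem_of_tendsto (tendsto_of_dominated (g := (2 : ℝ) • f)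
    (fun n => ?_) ?_ ?_) (Eventually.of_forall hu), hmem.coeFn_toLp⟩
  · filter_upwards [hux n, htwo, h01] with x hxn hx2 hx
    rw [hxn, hx2]
    exact abs_iterate_sharpen_le n hx.1 hx.2
  · filter_upwards [hmem.coeFn_toLp, htwo, h01] with x hlim hx2 hx
    rw [hlim, hx2]
    exact abs_sharpenLim_le hx.1 hx.2
  · filter_upwards [ae_all_iff.2 hux, hmem.coeFn_toLp, h01] with x hxn hlim hx
    simp only [hxn, hlim]
    exact tendsto_iterate_sharpen hx.1 hx.2

lemma indLp_half_le_mem (hK : IsTrigStable K) {u : Lp ℝ 2 μ} (hu : u ∈ K)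
    (h01 : ∀ᵐ x ∂μ, 0 ≤ u x ∧ u x ≤ 1) {A : FiniteMeasureSet μ} (hA : A.1 = {x | 1 / 2 ≤ u x}) :
    indLp ℝ A ∈ K := by
  obtain ⟨v, hvK, hv⟩ := hK.exists_sharpenLim_mem hu h01
  obtain ⟨g₁, hg₁K, hg₁⟩ := hK.exists_cos_mem hvK (-1 / 2) π
  obtain ⟨g₂, hg₂K, hg₂⟩ := hK.exists_cos_mem hvK (-1 / 4) (2 * π)
  suffices hind : indLp ℝ A = g₁ + g₂ by
    rw [hind]
    exact K.add_mem hg₁K hg₂K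
  refine Lp.ext ?_
  filter_upwards [coeFn_indLp ℝ A, hg₁, hg₂, hv, Lp.coeFn_add g₁ g₂] with x hx h₁ h₂ hvx hadd
  rw [hx, hadd, Pi.add_apply, h₁, h₂, hvx, ← ite_half_le_eq_cos_sharpenLim, hA]
  rfl

lemma exists_half_le_mem (hK : IsTrigStable K) {f : Lp ℝ 2 μ} (hf : f ∈ K) {c : ℝ} (hc : 0 < c) :
    ∃ u ∈ K, (∀ᵐ x ∂μ, 0 ≤ u x ∧ u x ≤ 1) ∧
      ∀ᵐ x ∂μ, c ≤ |f x| ∧ |f x| ≤ 2 * c → 1 / 2 ≤ u x := by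
  obtain ⟨u, huK, hu⟩ := hK.exists_cos_mem hf (-1 / 2) (π / (2 * c))
  refine ⟨u, huK, ?_, ?_⟩
  · filter_upwards [hu] with x hx
    rw [hx]
    constructor <;> linarith [neg_one_le_cos (π / (2 * c) * f x), cos_le_one (π / (2 * c) * f x)]
  · filter_upwards [hu] with x hx hfx
    have hcos : cos (π / (2 * c) * f x) ≤ 0 := by
      rw [← cos_abs, abs_mul, abs_of_pos (by positivity)]
      refine cos_nonpos_of_pi_div_two_le_of_le ?_ ?_
      · calc π / 2 = π / (2 * c) * c := by field_simp
          _ ≤ π / (2 * c) * |f x| := by gcongr; exact hfx.1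
      · calc π / (2 * c) * |f x| ≤ π / (2 * c) * (2 * c) := by gcongr; exact hfx.2
          _ = π := by field_simp
          _ ≤ π + π / 2 := by linarith [pi_pos]
    rw [hx]
    linarith

end IsTrigStable

lemma measure_le_lt_top (u : Lp ℝ 2 μ) {ε : ℝ} (hε : 0 < ε) : μ {x | ε ≤ u x} < ∞ := by
  refine (measure_mono fun x (hx : ε ≤ u x) => ?_).trans_lt ((Lp.memLp u).meas_ge_lt_top
    (ε := ε.toNNReal) two_ne_zero ENNReal.ofNat_ne_top (toNNReal_pos.2 hε).ne')
  rw [mem_ofPred_eq, ← NNReal.coe_le_coe, coe_nnnorm, coe_toNNReal _ hε.le]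
  exact hx.trans (le_abs_self _)

lemma exists_measure_annulus_ne_zero {f : X → ℝ} (hf : ¬ f =ᵐ[μ] 0) :
    ∃ c : ℝ, 0 < c ∧ μ {x | c ≤ |f x| ∧ |f x| ≤ 2 * c} ≠ 0 := by
  by_contra! hnull
  refine hf ?_
  have hzpow : ∀ᵐ x ∂μ, ∀ n : ℤ, ¬ ((2 : ℝ) ^ n ≤ |f x| ∧ |f x| ≤ 2 * 2 ^ n) :=
    ae_all_iff.2 fun n => measure_eq_zero_iff_ae_notMem.1 (hnull (2 ^ n) (by positivity))
  filter_upwards [hzpow] with x hx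
  by_contra hfx
  obtain ⟨n, hle, hlt⟩ := exists_mem_Ico_zpow (abs_pos.2 hfx) one_lt_two
  refine hx n ⟨hle, hlt.le.trans ?_⟩
  rw [zpow_add_one₀ two_ne_zero, mul_comm]

namespace IsTrigStable

lemma exists_indLp_mem (hK : IsTrigStable K) {f : Lp ℝ 2 μ} (hf : f ∈ K) (hf0 : f ≠ 0) :
    ∃ A : FiniteMeasureSet μ, μ A.1 ≠ 0 ∧ indLp ℝ A ∈ K := by
  obtain ⟨c, hc, hfc⟩ := exists_measure_annulus_ne_zero (μ := μ) (f := f)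
    fun h => hf0 ((Lp.eq_zero_iff_ae_eq_zero).2 h)
  obtain ⟨u, huK, h01, hfu⟩ := hK.exists_half_le_mem hf hc
  have hA : MeasurableSet {x | 1 / 2 ≤ u x} :=
    measurableSet_le measurable_const (Lp.stronglyMeasurable u).measurable
  exact ⟨⟨_, hA, measure_le_lt_top u one_half_pos⟩,
    fun h0 => hfc (measure_mono_null_ae hfu h0), hK.indLp_half_le_mem huK h01 rfl⟩

-- On indicator functions, `1_A 1_B` is `(1_A + 1_B) / 2 + (cos (π (1_A + 1_B)) - 1) / 4`.
lemma indLp_inter_mem (hK : IsTrigStable K) {A B : FiniteMeasureSet μ}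
    (hA : indLp ℝ A ∈ K) (hB : indLp ℝ B ∈ K) {D : FiniteMeasureSet μ} (hD : D.1 = A.1 ∩ B.1) :
    indLp ℝ D ∈ K := by
  have hsumK := K.add_mem hA hB
  obtain ⟨g, hgK, hg⟩ := hK.exists_cos_mem hsumK (1 / 4) π
  suffices hind : indLp ℝ D = (1 / 2 : ℝ) • (indLp ℝ A + indLp ℝ B) + g by
    rw [hind]
    exact K.add_mem (K.smul_mem _ hsumK) hgK
  refine Lp.ext ?_
  filter_upwards [hg, coeFn_indLp ℝ A, coeFn_indLp ℝ B, coeFn_indLp ℝ D,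
    Lp.coeFn_add (indLp ℝ A) (indLp ℝ B), Lp.coeFn_smul (1 / 2 : ℝ) (indLp ℝ A + indLp ℝ B),
    Lp.coeFn_add ((1 / 2 : ℝ) • (indLp ℝ A + indLp ℝ B)) g] with x hgx hAx hBx hDx hAB hhalf hadd
  rw [hDx, hadd, Pi.add_apply, hhalf, Pi.smul_apply, hgx, hAB, Pi.add_apply, hAx, hBx, hD]
  by_cases hxA : x ∈ A.1 <;> by_cases hxB : x ∈ B.1
  · rw [indicator_of_mem (mem_inter hxA hxB), indicator_of_mem hxA, indicator_of_mem hxB,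
      show π * (1 + 1) = 2 * π by ring, cos_two_pi]
    norm_num
  all_goals norm_num [hxA, hxB]

end IsTrigStable

end TrigStable

section StableSigmaAlgebra

variable {X : Type*} [MeasurableSpace X] {μ : Measure X} {K : Submodule ℝ (Lp ℝ 2 μ)}

lemma indLp_eq_zero {A : FiniteMeasureSet μ} (hA : μ A.1 = 0) : indLp ℝ A = 0 := by
  refine Lp.ext ?_
  filter_upwards [coeFn_indLp ℝ A, Lp.coeFn_zero ℝ 2 μ, measure_eq_zero_iff_ae_notMem.1 hA]
    with x hind hzero hx
  rw [hind, hzero, indicator_of_notMem hx, Pi.zero_apply]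

lemma indLp_diff {A B D : FiniteMeasureSet μ} (hBA : B.1 ⊆ A.1) (hD : D.1 = A.1 \ B.1) :
    indLp ℝ D = indLp ℝ A - indLp ℝ B := by
  refine Lp.ext ?_
  filter_upwards [coeFn_indLp ℝ A, coeFn_indLp ℝ B, coeFn_indLp ℝ D,
    Lp.coeFn_sub (indLp ℝ A) (indLp ℝ B)] with x hA hB hDx hsub
  rw [hDx, hsub, Pi.sub_apply, hA, hB, hD, indicator_sdiff hBA, Pi.sub_apply]

/-- The intersection of a set of finite measure with a measurable set. -/
abbrev FiniteMeasureSet.inter (A : FiniteMeasureSet μ) {B : Set X} (hB : MeasurableSet B) :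
    FiniteMeasureSet μ :=
  ⟨A.1 ∩ B, A.2.1.inter hB, (measure_mono inter_subset_left).trans_lt A.2.2⟩

/-- The preimage of a set of finite measure. -/
abbrev FiniteMeasureSet.preimage {T : X ≃ᵐ X} (hT : MeasurePreserving T μ μ)
    (A : FiniteMeasureSet μ) : FiniteMeasureSet μ :=
  ⟨T ⁻¹' A.1, T.measurable A.2.1, by
    rw [hT.measure_preimage A.2.1.nullMeasurableSet]
    exact A.2.2⟩

/-- The sets `B` whose indicator function multiplies the indicator functions in `K` into `K`. -/
structure IsMultiplierSet (K : Submodule ℝ (Lp ℝ 2 μ)) (B : Set X) : Prop where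
  measurableSet : MeasurableSet B
  indLp_inter_mem : ∀ A : FiniteMeasureSet μ, indLp ℝ A ∈ K → indLp ℝ (A.inter measurableSet) ∈ K

namespace IsMultiplierSet

lemma empty : IsMultiplierSet K ∅ :=
  ⟨MeasurableSet.empty, fun A _ => by
    rw [indLp_eq_zero (by simp)]
    exact K.zero_mem⟩

lemma compl {B : Set X} (hB : IsMultiplierSet K B) : IsMultiplierSet K Bᶜ :=
  ⟨hB.measurableSet.compl, fun A hA => by
    rw [indLp_diff (A := A) (B := A.inter hB.measurableSet) inter_subset_left
      (by rw [sdiff_self_inter, sdiff_eq])]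
    exact K.sub_mem hA (hB.indLp_inter_mem A hA)⟩

lemma inter {B B' : Set X} (hB : IsMultiplierSet K B) (hB' : IsMultiplierSet K B') :
    IsMultiplierSet K (B ∩ B') :=
  ⟨hB.measurableSet.inter hB'.measurableSet, fun A hA => by
    have hassoc : A.inter (hB.measurableSet.inter hB'.measurableSet) =
        (A.inter hB.measurableSet).inter hB'.measurableSet :=
      Subtype.ext (inter_assoc A.1 B B').symm
    rw [hassoc]
    exact hB'.indLp_inter_mem _ (hB.indLp_inter_mem A hA)⟩

lemma union {B B' : Set X} (hB : IsMultiplierSet K B) (hB' : IsMultiplierSet K B') :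
    IsMultiplierSet K (B ∪ B') := by
  rw [union_eq_compl_compl_inter_compl]
  exact (hB.compl.inter hB'.compl).compl

lemma accumulate {B : ℕ → Set X} (hB : ∀ n, IsMultiplierSet K (B n)) (n : ℕ) :
    IsMultiplierSet K (accumulate B n) := by
  induction n with
  | zero =>
    rw [accumulate_zero_nat]
    exact hB 0
  | succ n ih =>
    rw [accumulate_succ]
    exact ih.union (hB (n + 1))

lemma iUnion_of_monotone (hK : IsClosed (K : Set (Lp ℝ 2 μ))) {B : ℕ → Set X} (hmono : Monotone B)
    (hB : ∀ n, IsMultiplierSet K (B n)) : IsMultiplierSet K (⋃ n, B n) := by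
  have hm := MeasurableSet.iUnion fun n => (hB n).measurableSet
  refine ⟨hm, fun A hA => ?_⟩
  have hle {B : Set X} (hB : MeasurableSet B) :
      ∀ᵐ x ∂μ, |indLp ℝ (A.inter hB) x| ≤ indLp ℝ A x := by
    filter_upwards [coeFn_indLp ℝ A, coeFn_indLp ℝ (A.inter hB)] with x hAx hABx
    rw [hAx, hABx, abs_of_nonneg (indicator_nonneg (fun _ _ => zero_le_one) _)]
    exact indicator_le_indicator_of_subset inter_subset_left (fun _ => zero_le_one) x
  refine hK.mem_of_tendsto (tendsto_of_dominated (g := indLp ℝ A)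
    (fun n => hle (hB n).measurableSet) (hle hm) ?_)
    (Filter.Eventually.of_forall fun n => (hB n).indLp_inter_mem A hA)
  filter_upwards [ae_all_iff.2 fun n => coeFn_indLp ℝ (A.inter (hB n).measurableSet),
    coeFn_indLp ℝ (A.inter hm)] with x hn hunion
  simp only [hn, hunion, inter_iUnion]
  exact (Monotone.tendsto_indicator (fun n => A.1 ∩ B n)
    (fun _ _ hij => inter_subset_inter_right _ (hmono hij)) (fun _ => (1 : ℝ)) x).mono_right
    (pure_le_nhds _)

lemma preimage {T : X ≃ᵐ X} (hT : MeasurePreserving T μ μ)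
    (hTK : ∀ A : FiniteMeasureSet μ, indLp ℝ A ∈ K → indLp ℝ (A.preimage hT) ∈ K)
    (hTK' : ∀ A : FiniteMeasureSet μ, indLp ℝ A ∈ K → indLp ℝ (A.preimage (hT.symm T)) ∈ K)
    {B : Set X} (hB : IsMultiplierSet K B) : IsMultiplierSet K (T ⁻¹' B) := by
  refine ⟨T.measurable hB.measurableSet, fun A hA => ?_⟩
  have hinter : A.inter (T.measurable hB.measurableSet) =
      ((A.preimage (hT.symm T)).inter hB.measurableSet).preimage hT := by
    refine Subtype.ext ?_
    ext x
    simp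
  rw [hinter]
  exact hTK _ (hB.indLp_inter_mem _ (hTK' A hA))

end IsMultiplierSet

/-- The σ-algebra of the sets `B` such that, for `A` of finite measure, the indicator function of
`A ∩ B` belongs to `K` when that of `A` does. -/
abbrev stableSigmaAlgebra (hK : IsTrigStable K) : MeasurableSpace X where
  MeasurableSet' B := IsMultiplierSet K B
  measurableSet_empty := IsMultiplierSet.empty
  measurableSet_compl _ := IsMultiplierSet.compl
  measurableSet_iUnion B hB := by
    rw [← iUnion_accumulate]
    exact IsMultiplierSet.iUnion_of_monotone hK.isClosed monotone_accumulate
      (IsMultiplierSet.accumulate hB)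

lemma measurableSet_stableSigmaAlgebra (hK : IsTrigStable K) {A : FiniteMeasureSet μ}
    (hA : indLp ℝ A ∈ K) : MeasurableSet[stableSigmaAlgebra hK] A.1 :=
  ⟨A.2.1, fun _ hB => hK.indLp_inter_mem hB hA rfl⟩

section Invariant

variable {T : X ≃ᵐ X} (hT : MeasurePreserving T μ μ)
  (hTK : ∀ A : FiniteMeasureSet μ, indLp ℝ A ∈ K → indLp ℝ (A.preimage hT) ∈ K)
  (hTK' : ∀ A : FiniteMeasureSet μ, indLp ℝ A ∈ K → indLp ℝ (A.preimage (hT.symm T)) ∈ K)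

include hTK hTK'

lemma isFactor_stableSigmaAlgebra (hK : IsTrigStable K) :
    IsFactor T μ (stableSigmaAlgebra hK) := by
  refine ⟨fun B hB => hB.measurableSet, le_antisymm ?_ fun B hB => ?_⟩
  · rintro _ ⟨B, hB, rfl⟩
    exact IsMultiplierSet.preimage hT hTK hTK' hB
  · refine ⟨T.symm ⁻¹' B, IsMultiplierSet.preimage (hT.symm T) hTK' hTK hB, ?_⟩
    rw [← preimage_comp, T.symm_comp_self, preimage_id]

lemma exists_indLp_mem_eq_preimage_zpow {A : FiniteMeasureSet μ} (hA : indLp ℝ A ∈ K) (n : ℤ) :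
    ∃ B : FiniteMeasureSet μ, B.1 = ⇑(T.toEquiv ^ n : Equiv.Perm X) ⁻¹' A.1 ∧ indLp ℝ B ∈ K := by
  induction n using Int.induction_on with
  | zero => exact ⟨A, by simp, hA⟩
  | succ n ih =>
    obtain ⟨B, hB, hBK⟩ := ih
    refine ⟨B.preimage hT, ?_, hTK B hBK⟩
    rw [zpow_add_one]
    ext x
    simp [hB]
  | pred n ih =>
    obtain ⟨B, hB, hBK⟩ := ih
    refine ⟨B.preimage (hT.symm T), ?_, hTK' B hBK⟩
    rw [zpow_sub_one]
    ext x
    simp [hB]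

lemma exists_invariant_iUnion {A : FiniteMeasureSet μ} (hA : indLp ℝ A ∈ K) :
    ∃ s : ℕ → FiniteMeasureSet μ, (∀ n, indLp ℝ (s n) ∈ K) ∧
      T ⁻¹' (⋃ n, (s n).1) = ⋃ n, (s n).1 ∧ A.1 ⊆ ⋃ n, (s n).1 := by
  choose B hB hBK using exists_indLp_mem_eq_preimage_zpow hT hTK hTK' hA
  have hunion : ⋃ n, (B (Equiv.intEquivNat.symm n)).1 = ⋃ k, (B k).1 :=
    Equiv.intEquivNat.symm.surjective.iUnion_comp fun k => (B k).1
  refine ⟨fun n => B (Equiv.intEquivNat.symm n), fun n => hBK _, ?_, ?_⟩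
  · rw [hunion, preimage_iUnion]
    refine iUnion_congr_of_surjective (fun n => n + 1) (Equiv.addRight (1 : ℤ)).surjective
      fun n => ?_
    rw [hB, hB, zpow_add_one]
    rfl
  · have hB0 : (B 0).1 = A.1 := by
      rw [hB, zpow_zero]
      rfl
    rw [hunion, ← hB0]
    exact subset_iUnion (fun k => (B k).1) 0

end Invariant

end StableSigmaAlgebra

section AEMeasurability

variable {Ω : Type*} {C mΩ : MeasurableSpace Ω} {P : Measure Ω}

lemma aestronglyMeasurable_reLp {F : Lp ℂ 2 P} (hF : AEStronglyMeasurable[C] F P) :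
    AEStronglyMeasurable[C] (reLp P F) P :=
  (Complex.continuous_re.comp_aestronglyMeasurable hF).congr
    ((coeFn_reLp F).mono fun _ h => h.symm)

lemma aestronglyMeasurable_imLp {F : Lp ℂ 2 P} (hF : AEStronglyMeasurable[C] F P) :
    AEStronglyMeasurable[C] (imLp P F) P :=
  (Complex.continuous_im.comp_aestronglyMeasurable hF).congr
    ((coeFn_imLp F).mono fun _ h => h.symm)

lemma aestronglyMeasurable_smul_expLp {F : Lp ℝ 2 P} (hF : AEStronglyMeasurable[C] F P) (c : ℂ) :
    AEStronglyMeasurable[C] (c • expLp F : Lp ℂ 2 P) P := by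
  have h : AEStronglyMeasurable[C] (expLp F) P :=
    (lipschitzWith_expSubOne.continuous.comp_aestronglyMeasurable hF).congr
      ((coeFn_expLp F).mono fun _ h => h.symm)
  exact (h.const_smul c).congr (Lp.coeFn_smul c _).symm

lemma eventuallyMeasurable_of_aestronglyMeasurable {f : Ω → ℝ} (hf : AEStronglyMeasurable[C] f P) :
    Measurable[eventuallyMeasurableSpace C (ae P)] f :=
  Measurable.eventuallyMeasurable_of_eventuallyEq hf.stronglyMeasurable_mk.measurable hf.ae_eq_mk

lemma leMod_iff_le_eventuallyMeasurableSpace {D : MeasurableSpace Ω} :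
    LeMod P D C ↔ D ≤ eventuallyMeasurableSpace C (ae P) := Iff.rfl

lemma aestronglyMeasurable_comp {S : Ω → Ω} (hS : MeasurePreserving S P P) (hC : C.comap S = C)
    {f : Ω → ℝ} (hf : AEStronglyMeasurable[C] f P) : AEStronglyMeasurable[C] (f ∘ S) P := by
  have h : Measurable[C, C] S := measurable_iff_comap_le.2 hC.le
  exact ⟨hf.mk f ∘ S, hf.stronglyMeasurable_mk.comp_measurable h,
    hS.quasiMeasurePreserving.ae_eq_comp hf.ae_eq_mk⟩

end AEMeasurability

section MeasurableKernel

variable {X : Type*} [MeasurableSpace X] {μ : Measure X} {P : Measure (CountingMeasures X)}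

/-- The space of functions whose stochastic integral is `C`-measurable modulo null sets. -/
noncomputable def measurableKernel (hP : HasPoissonCounts μ P)
    (C : MeasurableSpace (CountingMeasures X)) : Submodule ℝ (Lp ℝ 2 μ) where
  carrier := {f | AEStronglyMeasurable[C] (realInt hP f) P}
  add_mem' {f g} hf hg := by
    rw [mem_ofPred_eq, map_add]
    exact (hf.add hg).congr (Lp.coeFn_add _ _).symm
  zero_mem' := by
    rw [mem_ofPred_eq, map_zero]
    exact aestronglyMeasurable_zero.congr (Lp.coeFn_zero ℝ 2 P).symm
  smul_mem' c f hf := by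
    rw [mem_ofPred_eq, map_smul]
    exact (hf.const_smul c).congr (Lp.coeFn_smul _ _).symm

lemma mem_measurableKernel (hP : HasPoissonCounts μ P) {C : MeasurableSpace (CountingMeasures X)}
    {f : Lp ℝ 2 μ} :
    f ∈ measurableKernel hP C ↔ AEStronglyMeasurable[C] (realInt hP f) P := Iff.rfl

lemma indLp_mem_measurableKernel (hP : HasPoissonCounts μ P)
    {C : MeasurableSpace (CountingMeasures X)} {A : FiniteMeasureSet μ} :
    indLp ℝ A ∈ measurableKernel hP C ↔ AEStronglyMeasurable[C] (ctr μ A.1) P :=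
  aestronglyMeasurable_congr (coeFn_realInt_indLp hP A)

lemma inner_inv_charInt_smul_expLp_sub_stochInt_eq_zero (hP : HasPoissonCounts μ P)
    (f : Lp ℝ 2 μ) {F : Lp ℂ 2 P} (hF : F ∈ chaos μ P 1) :
    inner ℂ F ((charInt hP f)⁻¹ • expLp (realInt hP f) - stochInt hP (expLp f)) = 0 := by
  obtain ⟨g, rfl⟩ := exists_stochInt_eq hP hF
  rw [inner_sub_right, inner_smul_right, inner_stochInt_expLp, LinearIsometry.inner_map_map,
    inv_mul_cancel_left₀ (charInt_ne_zero hP f), sub_self]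

lemma aestronglyMeasurable_stochInt_expLp (hP : HasPoissonCounts μ P)
    {C : MeasurableSpace (CountingMeasures X)} (hm : C ≤ instMeasurableSpaceCountingMeasures)
    (hCP : ∀ F ∈ chaos μ P 1, (condExpL2 ℂ ℂ hm F : Lp ℂ 2 P) ∈ chaos μ P 1)
    {f : Lp ℝ 2 μ} (hf : f ∈ measurableKernel hP C) :
    AEStronglyMeasurable[C] (stochInt hP (expLp f)) P :=
  aestronglyMeasurable_component hm hCP
    (aestronglyMeasurable_smul_expLp hf (charInt hP f)⁻¹) (stochInt_mem_chaos hP _)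
    fun _ => inner_inv_charInt_smul_expLp_sub_stochInt_eq_zero hP f

lemma isTrigStable_measurableKernel (hP : HasPoissonCounts μ P)
    {C : MeasurableSpace (CountingMeasures X)} (hm : C ≤ instMeasurableSpaceCountingMeasures)
    (hCP : ∀ F ∈ chaos μ P 1, (condExpL2 ℂ ℂ hm F : Lp ℂ 2 P) ∈ chaos μ P 1) :
    IsTrigStable (measurableKernel hP C) where
  isClosed := (isClosed_aestronglyMeasurable hm).preimage (realInt hP).continuous
  cos_mem f hf g hg := by
    have hg_eq : g = reLp μ (expLp f) := Lp.ext <| by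
      filter_upwards [hg, coeFn_reLp (expLp f), coeFn_expLp f] with x hgx hre hexp
      rw [hgx, hre, hexp, mul_comm, Complex.sub_re, Complex.exp_ofReal_mul_I_re, Complex.one_re]
    rw [mem_measurableKernel, hg_eq, ← (reLp_stochInt_and_imLp_stochInt hP (expLp f)).1]
    exact aestronglyMeasurable_reLp (aestronglyMeasurable_stochInt_expLp hP hm hCP hf)
  sin_mem f hf g hg := by
    have hg_eq : g = imLp μ (expLp f) := Lp.ext <| by
      filter_upwards [hg, coeFn_imLp (expLp f), coeFn_expLp f] with x hgx him hexp
      rw [hgx, him, hexp, mul_comm, Complex.sub_im, Complex.exp_ofReal_mul_I_im, Complex.one_im,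
        sub_zero]
    rw [mem_measurableKernel, hg_eq, ← (reLp_stochInt_and_imLp_stochInt hP (expLp f)).2]
    exact aestronglyMeasurable_imLp (aestronglyMeasurable_stochInt_expLp hP hm hCP hf)

lemma exists_ne_zero_mem_measurableKernel (hP : HasPoissonCounts μ P)
    {C : MeasurableSpace (CountingMeasures X)} {F : Lp ℂ 2 P} (hF : F ∈ chaos μ P 1)
    (hFC : AEStronglyMeasurable[C] F P) (hF0 : F ≠ 0) :
    ∃ f ∈ measurableKernel hP C, f ≠ 0 := by
  obtain ⟨g, rfl⟩ := exists_stochInt_eq hP hF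
  obtain ⟨hre, him⟩ := reLp_stochInt_and_imLp_stochInt hP g
  by_cases hg : reLp μ g = 0
  · refine ⟨imLp μ g, ?_, fun hg' => hF0 ?_⟩
    · rw [mem_measurableKernel, ← him]
      exact aestronglyMeasurable_imLp hFC
    · rw [← ofRealLp_reLp_add g, hg, hg', map_zero, smul_zero, add_zero, map_zero]
  · refine ⟨reLp μ g, ?_, hg⟩
    rw [mem_measurableKernel, ← hre]
    exact aestronglyMeasurable_reLp hFC

lemma ctr_preimage {T : X ≃ᵐ X} (hT : MeasurePreserving T μ μ) {A : Set X} (hA : MeasurableSet A) :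
    ctr μ (T ⁻¹' A) = ctr μ A ∘ suspension T := by
  funext ν
  rw [Function.comp_apply, ctr, ctr, N_suspension T hA, hT.measure_preimage hA.nullMeasurableSet]

lemma indLp_preimage_mem_measurableKernel [SigmaFinite μ] (hP : HasPoissonCounts μ P) {T : X ≃ᵐ X}
    (hT : MeasurePreserving T μ μ) {C : MeasurableSpace (CountingMeasures X)}
    (hC : C.comap (suspension T) = C) {A : FiniteMeasureSet μ}
    (hA : indLp ℝ A ∈ measurableKernel hP C) :
    indLp ℝ (A.preimage hT) ∈ measurableKernel hP C := by
  rw [indLp_mem_measurableKernel] at hA ⊢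
  exact (ctr_preimage hT A.2.1).symm ▸
    aestronglyMeasurable_comp (measurePreserving_suspension hT hP) hC hA

lemma suspension_comp_symm (T : X ≃ᵐ X) : suspension T ∘ suspension T.symm = id := by
  funext ν
  refine Subtype.ext ?_
  change (ν.1.map T.symm).map T = ν.1
  rw [Measure.map_map T.measurable T.symm.measurable, T.self_comp_symm, Measure.map_id]

lemma comap_suspension_symm {T : X ≃ᵐ X} {C : MeasurableSpace (CountingMeasures X)}
    (hC : C.comap (suspension T) = C) : C.comap (suspension T.symm) = C := by
  conv_lhs => rw [← hC]
  rw [MeasurableSpace.comap_comp, suspension_comp_symm, MeasurableSpace.comap_id]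

lemma measurable_N_of_mem_measurableKernel (hP : HasPoissonCounts μ P)
    {C : MeasurableSpace (CountingMeasures X)} {A : FiniteMeasureSet μ}
    (hA : indLp ℝ A ∈ measurableKernel hP C) :
    Measurable[eventuallyMeasurableSpace C (ae P)] (N A.1) := by
  have h := eventuallyMeasurable_of_aestronglyMeasurable ((indLp_mem_measurableKernel hP).1 hA)
  refine EventuallyMeasurable.congr
    (ENNReal.measurable_ofReal.comp_eventuallyMeasurable (h.add_const (μ A.1).toReal)) ?_
  filter_upwards [hP.ae_N_lt_top A.2.1 A.2.2] with ν hν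
  simp only [Function.comp_apply, ctr, sub_add_cancel]
  exact (ENNReal.ofReal_toReal hν.ne).symm

end MeasurableKernel

section LeMod

variable {Ω : Type*} {mΩ : MeasurableSpace Ω} {P : Measure Ω}

lemma LeMod.trans {B C D : MeasurableSpace Ω} (hBC : LeMod P B C) (hCD : LeMod P C D) :
    LeMod P B D := fun s hs =>
  have ⟨t, ht, hst⟩ := hBC s hs
  have ⟨u, hu, htu⟩ := hCD t ht
  ⟨u, hu, hst.trans htu⟩

lemma isTrivialMod_bot : IsTrivialMod P ⊥ := fun s hs => ⟨s, hs, Filter.EventuallyEq.rfl⟩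

lemma not_isTrivialMod_of_measureReal_ne [IsProbabilityMeasure P] {D : MeasurableSpace Ω}
    {s : Set Ω} (hs : MeasurableSet[D] s) (hs_zero : P.real s ≠ 0) (hs_one : P.real s ≠ 1) :
    ¬ IsTrivialMod P D := fun hD => by
  obtain ⟨t, ht, hst⟩ := hD s hs
  rcases MeasurableSpace.measurableSet_bot_iff.1 ht with rfl | rfl
  · exact hs_zero ((measureReal_congr hst).trans measureReal_empty)
  · exact hs_one ((measureReal_congr hst).trans probReal_univ)

end LeMod

section InvariantSubset

variable {X : Type*} {G mX : MeasurableSpace X} {μ : Measure X} {A : Set X}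

lemma restrictMeasure_apply (hA : MeasurableSet A) (s : Set A) :
    restrictMeasure μ A s = μ (Subtype.val '' s) :=
  (MeasurableEmbedding.subtype_coe hA).comap_apply μ s

lemma IsFactor.isSigmaFiniteFactor_comap (hA : MeasurableSet A) {T : X → X} (hTA : MapsTo T A A)
    (hG : IsFactor T μ G) {s : ℕ → Set X}
    (hs : ∀ n, MeasurableSet[G] (s n)) (hfin : ∀ n, μ (s n) < ∞) (hcover : A ⊆ ⋃ n, s n) :
    IsSigmaFiniteFactor (hTA.restrict T A A) (restrictMeasure μ A) (G.comap Subtype.val) := by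
  have hle : G.comap Subtype.val ≤ mX.comap (Subtype.val : A → X) :=
    MeasurableSpace.comap_mono hG.le
  refine ⟨⟨hle, ?_⟩, ⟨⟨⟨fun n => Subtype.val ⁻¹' s n, fun _ => trivial, fun n => ?_, ?_⟩⟩⟩⟩
  · conv_rhs => rw [← hG.comap_eq]
    rw [MeasurableSpace.comap_comp, MeasurableSpace.comap_comp, MapsTo.restrict_commutes]
  · rw [trim_measurableSet_eq hle ⟨s n, hs n, rfl⟩, restrictMeasure_apply hA,
      Subtype.image_preimage_coe]
    exact (measure_mono inter_subset_right).trans_lt (hfin n)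
  · rw [← preimage_iUnion]
    exact eq_univ_of_forall fun x => hcover x.2

lemma restrict_surjective_of_preimage_eq {T : X ≃ᵐ X} (hTA : T ⁻¹' A = A) :
    Function.Surjective (MapsTo.restrict T A A hTA.ge) := fun x =>
  ⟨⟨T.symm x, hTA.le (by simp)⟩, Subtype.ext (T.apply_symm_apply x)⟩

lemma IsFactor.map_val {T : X ≃ᵐ X} (hTA : T ⁻¹' A = A) {H : MeasurableSpace A}
    (hH : IsFactor (MapsTo.restrict T A A hTA.ge) (restrictMeasure μ A) H) :
    IsFactor T μ (H.map Subtype.val ⊓ mX) := by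
  set R := MapsTo.restrict T A A hTA.ge
  have hval (B : Set X) : Subtype.val ⁻¹' (T ⁻¹' B) = R ⁻¹' (Subtype.val ⁻¹' B) := rfl
  refine ⟨inf_le_right, le_antisymm ?_ ?_⟩
  · rintro _ ⟨B, ⟨hBH, hB⟩, rfl⟩
    refine ⟨?_, T.measurable hB⟩
    change MeasurableSet[H] _
    rw [hval, ← hH.comap_eq]
    exact ⟨_, hBH, rfl⟩
  · rintro B ⟨hBH, hB⟩
    obtain ⟨c, hc, hcB⟩ := hH.comap_eq.ge _ hBH
    have hTB : T ⁻¹' (T.symm ⁻¹' B) = B := by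
      rw [← preimage_comp, T.symm_comp_self, preimage_id]
    refine ⟨T.symm ⁻¹' B, ⟨?_, T.symm.measurable hB⟩, hTB⟩
    have hc_eq : c = Subtype.val ⁻¹' (T.symm ⁻¹' B) :=
      (restrict_surjective_of_preimage_eq hTA).preimage_injective (by rw [hcB, ← hval, hTB])
    change MeasurableSet[H] _
    rwa [← hc_eq]

lemma IsSigmaFiniteFactor.map_val [SigmaFinite μ] (hA : MeasurableSet A) {T : X ≃ᵐ X}
    (hTA : T ⁻¹' A = A) {H : MeasurableSpace A}
    (hH : IsSigmaFiniteFactor (MapsTo.restrict T A A hTA.ge) (restrictMeasure μ A) H) :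
    IsSigmaFiniteFactor T μ (H.map Subtype.val ⊓ mX) := by
  have hle := hH.isFactor.le
  have := hH.sigmaFinite
  set s := spanningSets ((restrictMeasure μ A).trim hle)
  set t : ℕ → Set X := fun n => Subtype.val '' s n ∪ spanningSets μ n \ A
  have hs (n : ℕ) : MeasurableSet[H] (s n) := measurableSet_spanningSets _ n
  have ht (n : ℕ) : MeasurableSet[H.map Subtype.val ⊓ mX] (t n) := by
    refine ⟨?_, (hA.subtype_image (hle _ (hs n))).union
      ((measurableSet_spanningSets μ n).diff hA)⟩
    change MeasurableSet[H] (Subtype.val ⁻¹' t n)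
    have hval : (Subtype.val ⁻¹' t n : Set A) = s n := by
      ext x
      simp [t]
    rw [hval]
    exact hs n
  refine ⟨hH.isFactor.map_val hTA, ⟨⟨⟨t, fun _ => trivial, fun n => ?_, ?_⟩⟩⟩⟩
  · rw [trim_measurableSet_eq _ (ht n)]
    refine measure_union_lt_top ?_
      ((measure_mono sdiff_subset).trans_lt (measure_spanningSets_lt_top μ n))
    rw [← restrictMeasure_apply hA, ← trim_measurableSet_eq hle (hs n)]
    exact measure_spanningSets_lt_top _ n
  · rw [iUnion_union_distrib, ← image_iUnion, ← iUnion_sdiff, iUnion_spanningSets,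
      iUnion_spanningSets]
    simp

end InvariantSubset

section PoissonianFactors

variable {X : Type*} [mX : MeasurableSpace X] {μ : Measure X} {P : Measure (CountingMeasures X)}

lemma leMod_sigmaN_iff {S : Set (Set X)} {C : MeasurableSpace (CountingMeasures X)} :
    LeMod P (sigmaN S) C ↔ ∀ A ∈ S, Measurable[eventuallyMeasurableSpace C (ae P)] (N A) := by
  simp only [leMod_iff_le_eventuallyMeasurableSpace, iSup_le_iff, measurable_iff_comap_le]

lemma measurable_N_of_mem {S : Set (Set X)} {A : Set X} (hA : A ∈ S) :
    Measurable[sigmaN S] (N A) :=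
  measurable_iff_comap_le.2 (le_iSup₂_of_le A hA le_rfl)

lemma HasPoissonCounts.measureReal_N_preimage_zero (hP : HasPoissonCounts μ P) {B : Set X}
    (hB : MeasurableSet B) (hfin : μ B < ∞) :
    P.real (N B ⁻¹' {0}) = Real.exp (-(μ B).toReal) := by
  have hnum : N B ⁻¹' {0} =ᵐ[P] num B ⁻¹' {0} := by
    filter_upwards [hP.ae_N_eq B hB hfin] with ν hν
    have hiff : N B ν = 0 ↔ num B ν = 0 := by rw [hν, Nat.cast_eq_zero]
    exact propext hiff
  rw [measureReal_congr hnum,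
    ← map_measureReal_apply (measurable_num hB) (measurableSet_singleton 0),
    hP.map_num B hB hfin, poissonMeasure_real_singleton, pow_zero, mul_one, Nat.factorial_zero,
    Nat.cast_one, div_one, ENNReal.coe_toNNReal_eq_toReal]

lemma not_isTrivialMod_of_measurable_N (hP : HasPoissonCounts μ P) {B : Set X}
    (hB : MeasurableSet B) (h0 : μ B ≠ 0) (hfin : μ B < ∞)
    {D : MeasurableSpace (CountingMeasures X)} (hD : Measurable[D] (N B)) :
    ¬ IsTrivialMod P D := by
  have hprob := hP.isProbabilityMeasure
  have hvoid := hP.measureReal_N_preimage_zero hB hfin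
  refine not_isTrivialMod_of_measureReal_ne (hD (measurableSet_singleton 0)) ?_ ?_
  · exact hvoid ▸ Real.exp_ne_zero _
  · rw [hvoid, Ne, Real.exp_eq_one_iff, neg_eq_zero]
    exact (ENNReal.toReal_pos h0 hfin.ne).ne'

lemma IsPoissonMeasure.ae_N_congr [SigmaFinite μ] (hμ : μ ≠ 0) (hP : IsPoissonMeasure μ P)
    {A B : Set X} (hA : MeasurableSet A) (hB : MeasurableSet B) (h : A =ᵐ[μ] B) :
    N A =ᵐ[P] N B := by
  obtain ⟨hAB, hBA⟩ := ae_eq_set.1 h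
  filter_upwards [hP.ae_N_eq_zero hμ (hA.diff hB) hAB, hP.ae_N_eq_zero hμ (hB.diff hA) hBA]
    with ν hνAB hνBA
  exact measure_congr (ae_eq_set.2 ⟨hνAB, hνBA⟩)

lemma measurable_N_iUnion {m : MeasurableSpace (CountingMeasures X)} {B : ℕ → Set X}
    (hB : ∀ n, MeasurableSet (B n)) (hd : Pairwise (Function.onFun Disjoint B))
    (h : ∀ n, Measurable[m] (N (B n))) : Measurable[m] (N (⋃ n, B n)) := by
  have hN : N (⋃ n, B n) = fun ν => ∑' n, N (B n) ν := funext fun ν => measure_iUnion hd hB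
  exact hN ▸ Measurable.tsum h

lemma measurable_N_of_measurableSet_stableSigmaAlgebra (hP : HasPoissonCounts μ P)
    {C : MeasurableSpace (CountingMeasures X)} (hK : IsTrigStable (measurableKernel hP C))
    {s : ℕ → FiniteMeasureSet μ} (hs : ∀ n, indLp ℝ (s n) ∈ measurableKernel hP C)
    {B : Set X} (hB : MeasurableSet[stableSigmaAlgebra hK] B) (hBs : B ⊆ ⋃ n, (s n).1) :
    Measurable[eventuallyMeasurableSpace C (ae P)] (N B) := by
  set d := disjointed fun n => (s n).1
  have hd (n : ℕ) : MeasurableSet[stableSigmaAlgebra hK] (B ∩ d n) :=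
    hB.inter (MeasurableSet.disjointed (fun k => measurableSet_stableSigmaAlgebra hK (hs k)) n)
  have hBd : B = ⋃ n, B ∩ d n := by
    rw [← inter_iUnion, iUnion_disjointed, inter_eq_left.2 hBs]
  rw [hBd]
  refine measurable_N_iUnion (fun n => (hd n).measurableSet) (fun i j hij => ?_) fun n => ?_
  · exact (disjoint_disjointed (fun n => (s n).1) hij).mono inter_subset_right inter_subset_right
  · have hpiece : B ∩ d n = ((s n).inter (hd n).measurableSet).1 :=
      (inter_eq_right.2 (inter_subset_right.trans (disjointed_subset _ n))).symm
    rw [hpiece]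
    exact measurable_N_of_mem_measurableKernel hP ((hd n).indLp_inter_mem (s n) (hs n))

lemma exists_poissonianFactor_of_indLp_mem [SigmaFinite μ] (hP : HasPoissonCounts μ P) {T : X ≃ᵐ X}
    (hT : MeasurePreserving T μ μ) {C : MeasurableSpace (CountingMeasures X)}
    (hC : C.comap (suspension T) = C) (hK : IsTrigStable (measurableKernel hP C))
    {A : FiniteMeasureSet μ} (hA : indLp ℝ A ∈ measurableKernel hP C) (hA0 : μ A.1 ≠ 0) :
    ∃ D : MeasurableSpace (CountingMeasures X), IsPoissonianFactor T μ D ∧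
      ¬ IsTrivialMod P D ∧ LeMod P D C := by
  have hTK (A) := indLp_preimage_mem_measurableKernel (A := A) hP hT hC
  have hTK' (A) := indLp_preimage_mem_measurableKernel (A := A) hP (hT.symm T)
    (comap_suspension_symm hC)
  obtain ⟨s, hs, hTU, hAU⟩ := exists_invariant_iUnion hT hTK hTK' hA
  have hsK (n : ℕ) := measurableSet_stableSigmaAlgebra hK (hs n)
  set U := ⋃ n, (s n).1
  have hU : MeasurableSet U := MeasurableSet.iUnion fun n => (s n).2.1
  have hUK : MeasurableSet[stableSigmaAlgebra hK] U := MeasurableSet.iUnion hsK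
  refine ⟨_, Or.inr ⟨U, hU, hTU, _, (isFactor_stableSigmaAlgebra hT hTK hTK'
    hK).isSigmaFiniteFactor_comap hU hTU.ge hsK (fun n => (s n).2.2) le_rfl, rfl⟩, ?_, ?_⟩
  · refine not_isTrivialMod_of_measurable_N hP A.2.1 hA0 A.2.2 (measurable_N_of_mem ?_)
    refine ⟨_, ⟨A.1, measurableSet_stableSigmaAlgebra hK hA, rfl⟩, ?_⟩
    rw [Subtype.image_preimage_coe, inter_eq_right.2 hAU]
  · rw [leMod_sigmaN_iff]
    rintro _ ⟨_, ⟨B, hB, rfl⟩, rfl⟩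
    rw [Subtype.image_preimage_coe]
    exact measurable_N_of_measurableSet_stableSigmaAlgebra hP hK hs (hUK.inter hB)
      inter_subset_left

lemma exists_poissonianFactor [MeasurableSpace.CountablySeparated X] [NullSingletonClass μ]
    [SigmaFinite μ] (hP : HasPoissonCounts μ P) {T : X ≃ᵐ X} (hT : MeasurePreserving T μ μ)
    (hCP : PropertyCP T μ P) {C : MeasurableSpace (CountingMeasures X)}
    (hC : IsFactor (suspension T) P C) (hC0 : ¬ IsTrivialMod P C) :
    ∃ D : MeasurableSpace (CountingMeasures X), IsPoissonianFactor T μ D ∧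
      ¬ IsTrivialMod P D ∧ LeMod P D C := by
  obtain ⟨F, hF, hFC, hF0⟩ := exists_ne_zero_mem_chaos_one hP hC.le hC0 (hCP C hC)
  obtain ⟨f, hf, hf0⟩ := exists_ne_zero_mem_measurableKernel hP hF hFC hF0
  have hK := isTrigStable_measurableKernel hP hC.le (hCP C hC 1)
  obtain ⟨A, hA0, hA⟩ := hK.exists_indLp_mem hf hf0
  exact exists_poissonianFactor_of_indLp_mem hP hT hC.comap_eq hK hA hA0

lemma isTrivialMod_sigmaN_of_measure_eq_zero [SigmaFinite μ] (hμ : μ ≠ 0)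
    (hP : IsPoissonMeasure μ P) {S : Set (Set X)} (hS : ∀ A ∈ S, MeasurableSet A ∧ μ A = 0) :
    IsTrivialMod P (sigmaN S) := by
  refine leMod_sigmaN_iff.2 fun A hA => ?_
  exact EventuallyMeasurable.congr measurable_const (hP.ae_N_eq_zero hμ (hS A hA).1 (hS A hA).2)

lemma leMod_sigmaN_of_isPrimeInfiniteSystem [SigmaFinite μ] (hμ : μ ≠ 0)
    (hP : IsPoissonMeasure μ P) {T : X ≃ᵐ X} (hprime : IsPrimeInfiniteSystem T μ)
    {A : Set X} (hA : MeasurableSet A) (hTA : T ⁻¹' A = A) (hAc : μ Aᶜ = 0)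
    {H : MeasurableSpace A}
    (hH : IsSigmaFiniteFactor (MapsTo.restrict T A A hTA.ge) (restrictMeasure μ A) H) :
    LeMod P instMeasurableSpaceCountingMeasures
      (sigmaN {B | ∃ c : Set A, MeasurableSet[H] c ∧ B = Subtype.val '' c}) := by
  refine leMod_sigmaN_iff.2 fun E hE => ?_
  obtain ⟨B, ⟨hBH, hB⟩, hEB⟩ := hprime _ (hH.map_val hA hTA) E hE
  have hEBA : E =ᵐ[μ] (B ∩ A : Set X) :=
    hEB.trans (inter_ae_eq_left_of_ae_eq_univ (ae_eq_univ.2 hAc)).symm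
  have hN : Measurable[sigmaN {B | ∃ c : Set A, MeasurableSet[H] c ∧ B = Subtype.val '' c}]
      (N (B ∩ A)) :=
    measurable_N_of_mem ⟨_, hBH, by rw [Subtype.image_preimage_coe, inter_comm]⟩
  exact hN.eventuallyMeasurable_of_eventuallyEq (hP.ae_N_congr hμ hE (hB.inter hA) hEBA)

lemma leMod_of_isPoissonianFactor [SigmaFinite μ] (hμ : μ ≠ 0) (hP : IsPoissonMeasure μ P)
    {T : X ≃ᵐ X} (hT : Ergodic T μ) (hprime : IsPrimeInfiniteSystem T μ)
    {D : MeasurableSpace (CountingMeasures X)} (hD : IsPoissonianFactor T μ D)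
    (hD0 : ¬ IsTrivialMod P D) : LeMod P instMeasurableSpaceCountingMeasures D := by
  obtain rfl | ⟨A, hA, hTA, H, hH, rfl⟩ := hD
  · exact absurd isTrivialMod_bot hD0
  · obtain hA0 | hAc := hT.measure_self_or_compl_eq_zero hA hTA
    · refine absurd (isTrivialMod_sigmaN_of_measure_eq_zero hμ hP ?_) hD0
      rintro _ ⟨c, hc, rfl⟩
      exact ⟨hA.subtype_image (hH.isFactor.le _ hc),
        measure_mono_null (Subtype.coe_image_subset A c) hA0⟩
    · exact leMod_sigmaN_of_isPrimeInfiniteSystem hμ hP hprime hA hTA hAc hH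

end PoissonianFactors

end PoissonSuspension

theorem theorem4p2_general {X : Type*} [MeasurableSpace X] [MeasurableSpace.CountablySeparated X]
    (μ : Measure X) [SigmaFinite μ] [NullSingletonClass μ] (hμ : μ ≠ 0)
    (T : X ≃ᵐ X) (hT : MeasurePreserving T μ μ)
    (P : Measure (PoissonSuspension.CountingMeasures X))
    (hP : PoissonSuspension.IsPoissonMeasure μ P)
    (hCP : PoissonSuspension.PropertyCP T μ P) :
    (∀ C : MeasurableSpace (PoissonSuspension.CountingMeasures X),
      PoissonSuspension.IsFactor (PoissonSuspension.suspension T) P C →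
      ¬ PoissonSuspension.IsTrivialMod P C →
      ∃ D : MeasurableSpace (PoissonSuspension.CountingMeasures X),
        PoissonSuspension.IsPoissonianFactor T μ D ∧
        ¬ PoissonSuspension.IsTrivialMod P D ∧
        PoissonSuspension.LeMod P D C) ∧
    (Ergodic T μ → PoissonSuspension.IsPrimeInfiniteSystem T μ →
      PoissonSuspension.IsPrimeProbSystem (PoissonSuspension.suspension T) P) := by
  have hpoisson := fun C hC hC0 =>
    PoissonSuspension.exists_poissonianFactor (C := C) (hP.hasPoissonCounts hμ) hT hCP hC hC0
  refine ⟨hpoisson, fun hErg hprime C hC => or_iff_not_imp_right.2 fun hC0 => ?_⟩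
  obtain ⟨D, hD, hD0, hDC⟩ := hpoisson C hC hC0
  exact (PoissonSuspension.leMod_of_isPoissonianFactor hμ hP hErg hprime hD hD0).trans hDC

theorem theorem4p2 {X : Type*} [MeasurableSpace X] [StandardBorelSpace X]
    (μ : Measure X) [SigmaFinite μ] [NullSingletonClass μ] (hμ : μ Set.univ = ∞)
    (T : X ≃ᵐ X) (hT : Ergodic T μ)
    (P : Measure (PoissonSuspension.CountingMeasures X))
    (hP : PoissonSuspension.IsPoissonMeasure μ P)
    (hCP : PoissonSuspension.PropertyCP T μ P) :
    (∀ C : MeasurableSpace (PoissonSuspension.CountingMeasures X),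
      PoissonSuspension.IsFactor (PoissonSuspension.suspension T) P C →
      ¬ PoissonSuspension.IsTrivialMod P C →
      ∃ D : MeasurableSpace (PoissonSuspension.CountingMeasures X),
        PoissonSuspension.IsPoissonianFactor T μ D ∧
        ¬ PoissonSuspension.IsTrivialMod P D ∧
        PoissonSuspension.LeMod P D C) ∧
    (PoissonSuspension.IsPrimeInfiniteSystem T μ →
      PoissonSuspension.IsPrimeProbSystem (PoissonSuspension.suspension T) P) :=
  (theorem4p2_general μ (Measure.measure_univ_ne_zero.1 (by simp [hμ])) T
    hT.toMeasurePreserving P hP hCP).imp_right fun h => h hT
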